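/- **Model.** Let $1\le K\le N$ be integers and let $\lambda_s>0$, $0<c<T_{\mathrm D}$. The service times $T_{m,j}$ ($m=1,\dots,N$; $j=0,1,2,\dots$) are i.i.d. with $\mathbb P(T_{m,j}\le t)=1-e^{-\lambda_s(t-c)}$ for $t>c$ (and $0$ for $t\le c$). For update $j$ let $T_N(K)$ be the $K$-th smallest of $T_{1,j},\dots,T_{N,j}$. Update $0$ is generated at time $t_0=0$; update $j$ is terminated, and update $j+1$ is generated, at time $t_{j+1}=t_j+\min\{T_{\mathrm D},T_N(K)\}$. Fix a device $n$. It receives update $j$ iff $T_{n,j}\le\min\{T_{\mathrm D},T_N(K)\}$ (event $\mathcal C_{\mathrm S}$; otherwise $\mathcal C_{\mathrm F}$), and then at time $t_j+T_{n,j}$. Let $u_n(t)$ be the generation time of the most recent update received by device $n$ by time $t$ (equal to $-a_0$ before the first reception, for an arbitrary constant $a_0\ge 0$), and let $\Delta_n(t)=t-u_n(t)$ be the age of information (AoI). For the $q$-th received update ($q=0,1,\dots$) let $\hat T_q$ be its service time, $X^{\mathrm S}_q$ the time from its generation to the generation of the next update, $W_q$ the sum of $t_{i+1}-t_i$ over the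 updates $i$ that device $n$ fails to receive after its previous reception (or after the start, if $q=0$) and before update $q$ is generated, and let the $q$-th peak AoI $P_q$ be the left limit of $\Delta_n$ at its reception instant. Write $\mathcal C_{\mathrm F,1},\mathcal C_{\mathrm S,1}$ for the parts of $\mathcal C_{\mathrm F},\mathcal C_{\mathrm S}$ where $T_N(K)<T_{\mathrm D}$ and $\mathcal C_{\mathrm F,2}$ for the part of $\mathcal C_{\mathrm F}$ where $T_{\mathrm D}<T_N(K)$. **Closed forms.** For $1\le h\le N$ and $0\le j<h$ put $$B_{h,j}=h\tbinom Nh\tbinom{h-1}{j}(-1)^j,\quad U_{h,j}=N-h+1+j,\quad V_{h,j}=e^{-\lambda_sU_{h,j}(T_{\mathrm D}-c)},\quad \mathcal Z_h=\sum_{j=0}^{h-1}B_{h,j}\frac{V_{h,j}}{U_{h,j}},$$ $$m_1=\frac1{1-\mathcal Z_K}\sum_{j=0}^{K-1}\frac{B_{K,j}}{\lambda_sU_{K,j}^2}\Big[1+c\lambda_sU_{K,j}-(1+T_{\mathrm D}\lambda_sU_{K,j})V_{K,j}\Big],$$ $$m_2=\frac1{1-\mathcal Z_K}\sum_{j=0}^{K-1}\frac{B_{K,j}}{\lambda_s^2U_{K,j}^3}\Big[(1+c\lambda_sU_{K,j})^2+1-\big((1+T_{\mathrm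 D}\lambda_sU_{K,j})^2+1\big)V_{K,j}\Big],$$ $$p=\frac1N\sum_{h=1}^K(1-\mathcal Z_h),\quad f=\frac{(N-K)\mathcal Z_K+\sum_{h=1}^K\mathcal Z_h}{Ne^{-\lambda_s(T_{\mathrm D}-c)}+(N-K)-\sum_{h=K+1}^N\mathcal Z_h},\quad s=\frac{K(1-\mathcal Z_K)}{Np},$$ $$x^{\mathrm F}_i=(1-f)m_i+fT_{\mathrm D}^i,\qquad x^{\mathrm S}_i=s\,m_i+(1-s)T_{\mathrm D}^i\qquad(i=1,2),$$ $$w_1=\Big(\frac1p-1\Big)x^{\mathrm F}_1,\qquad w_2=w_1^2+(x^{\mathrm F}_1)^2\Big(\frac{2-p}{p^2}-\frac1{p^2}\Big)+\big(x^{\mathrm F}_2-(x^{\mathrm F}_1)^2\big)\Big(\frac1p-1\Big),$$ $$\hat\tau=\sum_{h=1}^K\sum_{j=0}^{h-1}B_{h,j}\,\frac{c\lambda_sU_{h,j}+1-V_{h,j}(\lambda_sU_{h,j}T_{\mathrm D}+1)}{Np\,\lambda_sU_{h,j}^2}.$$ **Theorem.** 1. For every update, $\mathbb P(\mathcal C_{\mathrm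 S})=p$, $\mathbb P(\mathcal C_{\mathrm F,2}\mid\mathcal C_{\mathrm F})=f$, $\mathbb P(\mathcal C_{\mathrm S,1}\mid\mathcal C_{\mathrm S})=s$; for $i=1,2$, $\mathbb E[T_N(K)^i\mid\mathcal C_{\mathrm S,1}]=m_i$, also $\mathbb E[T_N(K)^i\mid\mathcal C_{\mathrm F,1}]=m_i$ if $K<N$, and $\mathbb E[\min\{T_{\mathrm D},T_N(K)\}^i\mid\mathcal C_{\mathrm F}]=x^{\mathrm F}_i$. 2. For every $q\ge0$ the variables $X^{\mathrm S}_q$ and $W_q$ are square integrable, $\hat T_q$ is integrable, and $\mathbb E[(X^{\mathrm S}_q)^i]=x^{\mathrm S}_i$, $\mathbb E[W_q^i]=w_i$ ($i=1,2$), $\mathbb E[\hat T_q]=\hat\tau$. 3. (Average AoI.) Almost surely device $n$ receives infinitely many updates, $\Delta_n$ is integrable on every $[0,t]$, and $$\lim_{t\to\infty}\frac1t\int_0^t\Delta_n(r)\,dr=\frac{w_2+2(\hat\tau+x^{\mathrm S}_1)w_1+2x^{\mathrm S}_1\hat\tau+x^{\mathrm S}_2}{2w_1+2x^{\mathrm S}_1},$$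 that is, the limit is $\dfrac{\mathbb E[W^2]+2(\mathbb E[\hat T]+\mathbb E[X^{\mathrm S}])\mathbb E[W]+2\mathbb E[X^{\mathrm S}]\mathbb E[\hat T]+\mathbb E[(X^{\mathrm S})^2]}{2\mathbb E[W]+2\mathbb E[X^{\mathrm S}]}$. 4. (Average peak AoI.) Almost surely the left limits defining all $P_q$ exist and $$\lim_{Q\to\infty}\frac1Q\sum_{q=0}^{Q-1}P_q=x^{\mathrm S}_1+w_1+\hat\tau=\mathbb E[X^{\mathrm S}]+\mathbb E[W]+\mathbb E[\hat T];$$ moreover, for every $q\ge1$, $P_q$ is integrable with $\mathbb E[P_q]=x^{\mathrm S}_1+w_1+\hat\tau$. -/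

import Mathlib

open MeasureTheory ProbabilityTheory Filter Topology

noncomputable section

namespace MulticastAoI

/-! ### The transmission system along one sample path

`x : Fin N → ℝ` holds the service times of one status update, `τ : Fin N → ℕ → ℝ` those of all
status updates, `τ m j` being the time needed to deliver update `j` to device `m`.
Updates are indexed by `j = 0, 1, 2, …`, and update `0` is generated at time `0`. -/

/-- The law of `c + Y` with `Y` exponentially distributed with rate `lam`. -/
def shiftedExp (lam c : ℝ) : Measure ℝ := (expMeasure lam).map (fun y => y + c)

/-- `T_N(K)`: the first time at which at least `K` of the devices have received the update, that is
(for `1 ≤ K ≤ N`) the `K`-th smallest of the service times. -/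
def ordStat {N : ℕ} (K : ℕ) (x : Fin N → ℝ) : ℝ :=
  sInf {t : ℝ | K ≤ (Finset.univ.filter (fun i => x i ≤ t)).card}

/-- Time from generation to termination of an update: it is terminated when it is served (received
by `K` devices) or when the deadline `TD` expires, whichever is first. -/
def duration {N : ℕ} (K : ℕ) (TD : ℝ) (x : Fin N → ℝ) : ℝ := min TD (ordStat K x)

/-- Generation time `t_j` of update `j`: each update is generated when its predecessor is
terminated, so `t_{j+1} - t_j` is the duration of update `j`. -/
def genTime {N : ℕ} (K : ℕ) (TD : ℝ) (τ : Fin N → ℕ → ℝ) (j : ℕ) : ℝ :=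
  ∑ i ∈ Finset.range j, duration K TD (fun m => τ m i)

/-- Device `n` successfully receives update `j`. -/
def Received {N : ℕ} (K : ℕ) (TD : ℝ) (τ : Fin N → ℕ → ℝ) (n : Fin N) (j : ℕ) : Prop :=
  τ n j ≤ duration K TD (fun m => τ m j)

/-- `u_n(t)`: the generation time of the most recently generated update that device `n` has received
by time `t`. The information held at time `0` has age `a₀`, i.e. was generated at `-a₀`. -/
def latestGen {N : ℕ} (K : ℕ) (TD a₀ : ℝ) (τ : Fin N → ℕ → ℝ) (n : Fin N) (t : ℝ) : ℝ :=
  sSup (insert (-a₀)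
    {g : ℝ | ∃ j : ℕ, Received K TD τ n j ∧ genTime K TD τ j + τ n j ≤ t ∧ g = genTime K TD τ j})

/-- The instantaneous age of information `Δ_n(t) = t - u_n(t)`. -/
def age {N : ℕ} (K : ℕ) (TD a₀ : ℝ) (τ : Fin N → ℕ → ℝ) (n : Fin N) (t : ℝ) : ℝ :=
  t - latestGen K TD a₀ τ n t

/-- The index of the `q`-th update (`q = 0, 1, …`) that device `n` receives. -/
def recvIdx {N : ℕ} (K : ℕ) (TD : ℝ) (τ : Fin N → ℕ → ℝ) (n : Fin N) (q : ℕ) : ℕ :=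
  Nat.nth (fun j => Received K TD τ n j) q

/-- The instant at which device `n` receives its `q`-th update. -/
def recvTime {N : ℕ} (K : ℕ) (TD : ℝ) (τ : Fin N → ℕ → ℝ) (n : Fin N) (q : ℕ) : ℝ :=
  genTime K TD τ (recvIdx K TD τ n q) + τ n (recvIdx K TD τ n q)

/-- Index of the first update generated after the `(q-1)`-st reception (`0` if `q = 0`). -/
def cycleStart {N : ℕ} (K : ℕ) (TD : ℝ) (τ : Fin N → ℕ → ℝ) (n : Fin N) : ℕ → ℕ
  | 0 => 0
  | q + 1 => recvIdx K TD τ n q + 1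

/-- `X^S`: inter-generation time following the `q`-th update received by device `n`. -/
def succInter {N : ℕ} (K : ℕ) (TD : ℝ) (τ : Fin N → ℕ → ℝ) (n : Fin N) (q : ℕ) : ℝ :=
  genTime K TD τ (recvIdx K TD τ n q + 1) - genTime K TD τ (recvIdx K TD τ n q)

/-- `W`: the sum of the inter-generation times of the updates that device `n` fails to
receive between its `(q-1)`-st and its `q`-th reception. -/
def failSum {N : ℕ} (K : ℕ) (TD : ℝ) (τ : Fin N → ℕ → ℝ) (n : Fin N) (q : ℕ) : ℝ :=
  ∑ i ∈ Finset.Ico (cycleStart K TD τ n q) (recvIdx K TD τ n q),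
    (genTime K TD τ (i + 1) - genTime K TD τ i)

/-- `T̂`: the service time of the `q`-th update received by device `n`. -/
def succService {N : ℕ} (K : ℕ) (TD : ℝ) (τ : Fin N → ℕ → ℝ) (n : Fin N) (q : ℕ) : ℝ :=
  τ n (recvIdx K TD τ n q)

/-- The `q`-th peak age: the value of the instantaneous age immediately before the
`q`-th reception, i.e. its left limit there. -/
def peakAge {N : ℕ} (K : ℕ) (TD a₀ : ℝ) (τ : Fin N → ℕ → ℝ) (n : Fin N) (q : ℕ) : ℝ :=
  Function.leftLim (age K TD a₀ τ n) (recvTime K TD τ n q)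

/-! ### Events concerning one status update -/

/-- `C_S`: device `n` receives the update. -/
def evS {N : ℕ} (K : ℕ) (TD : ℝ) (n : Fin N) : Set (Fin N → ℝ) :=
  {x | x n ≤ min TD (ordStat K x)}

/-- `C_F`: device `n` fails to receive the update. -/
def evF {N : ℕ} (K : ℕ) (TD : ℝ) (n : Fin N) : Set (Fin N → ℝ) :=
  {x | min TD (ordStat K x) < x n}

/-- The update is served before its deadline. -/
def evServed {N : ℕ} (K : ℕ) (TD : ℝ) : Set (Fin N → ℝ) := {x | ordStat K x < TD}

/-- The deadline expires before the update is served. -/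
def evExpired {N : ℕ} (K : ℕ) (TD : ℝ) : Set (Fin N → ℝ) := {x | TD < ordStat K x}

/-! ### Closed-form expressions -/

/-- `B_{h,j}` -/
def cB (N h j : ℕ) : ℝ := h * (N.choose h : ℝ) * ((h - 1).choose j : ℝ) * (-1) ^ j

/-- `U_{h,j}` -/
def cU (N h j : ℕ) : ℝ := (N : ℝ) - h + 1 + j

/-- `V_{h,j}` -/
def cV (N : ℕ) (lam c TD : ℝ) (h j : ℕ) : ℝ := Real.exp (-(lam * cU N h j * (TD - c)))

/-- `Z_h` -/
def cZ (N : ℕ) (lam c TD : ℝ) (h : ℕ) : ℝ :=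
  ∑ j ∈ Finset.range h, cB N h j * cV N lam c TD h j / cU N h j

/-- Closed form of `E[T_N(K) | C_{F,1}] = E[T_N(K) | C_{S,1}]`. -/
def mom1TK (N K : ℕ) (lam c TD : ℝ) : ℝ :=
  1 / (1 - cZ N lam c TD K) * ∑ j ∈ Finset.range K, cB N K j / (lam * cU N K j ^ 2) *
    (1 + c * lam * cU N K j - (1 + TD * lam * cU N K j) * cV N lam c TD K j)

/-- Closed form of `E[T_N(K)² | C_{F,1}] = E[T_N(K)² | C_{S,1}]`. -/
def mom2TK (N K : ℕ) (lam c TD : ℝ) : ℝ :=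
  1 / (1 - cZ N lam c TD K) * ∑ j ∈ Finset.range K, cB N K j / (lam ^ 2 * cU N K j ^ 3) *
    ((1 + c * lam * cU N K j) ^ 2 + 1
      - ((1 + TD * lam * cU N K j) ^ 2 + 1) * cV N lam c TD K j)

/-- Closed form of `P(C_{F,2})` (conditional on failure). -/
def probF2 (N K : ℕ) (lam c TD : ℝ) : ℝ :=
  (((N : ℝ) - K) * cZ N lam c TD K + ∑ h ∈ Finset.Icc 1 K, cZ N lam c TD h) /
    (N * Real.exp (-(lam * (TD - c))) + ((N : ℝ) - K)
      - ∑ h ∈ Finset.Icc (K + 1) N, cZ N lam c TD h)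

/-- Closed form of `P(C_S)`. -/
def probS (N K : ℕ) (lam c TD : ℝ) : ℝ :=
  1 / N * ∑ h ∈ Finset.Icc 1 K, (1 - cZ N lam c TD h)

/-- Closed form of `P(C_{S,1})` (conditional on success). -/
def probS1 (N K : ℕ) (lam c TD : ℝ) : ℝ :=
  K * (1 - cZ N lam c TD K) / (N * probS N K lam c TD)

/-- Closed form of `E[X^F]`. -/
def mom1XF (N K : ℕ) (lam c TD : ℝ) : ℝ :=
  (1 - probF2 N K lam c TD) * mom1TK N K lam c TD + probF2 N K lam c TD * TD

/-- Closed form of `E[(X^F)²]`. -/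
def mom2XF (N K : ℕ) (lam c TD : ℝ) : ℝ :=
  (1 - probF2 N K lam c TD) * mom2TK N K lam c TD + probF2 N K lam c TD * TD ^ 2

/-- Closed form of `E[X^S]`. -/
def mom1XS (N K : ℕ) (lam c TD : ℝ) : ℝ :=
  probS1 N K lam c TD * mom1TK N K lam c TD + (1 - probS1 N K lam c TD) * TD

/-- Closed form of `E[(X^S)²]`. -/
def mom2XS (N K : ℕ) (lam c TD : ℝ) : ℝ :=
  probS1 N K lam c TD * mom2TK N K lam c TD + (1 - probS1 N K lam c TD) * TD ^ 2

/-- `E[M]` for `M` geometric on `{1, 2, …}` with success probability `P(C_S)`. -/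
def mom1M (N K : ℕ) (lam c TD : ℝ) : ℝ := 1 / probS N K lam c TD

/-- `E[M²]` for `M` geometric on `{1, 2, …}` with success probability `P(C_S)`. -/
def mom2M (N K : ℕ) (lam c TD : ℝ) : ℝ := (2 - probS N K lam c TD) / probS N K lam c TD ^ 2

/-- Closed form of `E[W]`. -/
def mom1W (N K : ℕ) (lam c TD : ℝ) : ℝ := (mom1M N K lam c TD - 1) * mom1XF N K lam c TD

/-- Closed form of `Var[W]`. -/
def varW (N K : ℕ) (lam c TD : ℝ) : ℝ :=
  mom1XF N K lam c TD ^ 2 * (mom2M N K lam c TD - mom1M N K lam c TD ^ 2)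
    + (mom2XF N K lam c TD - mom1XF N K lam c TD ^ 2) * (mom1M N K lam c TD - 1)

/-- Closed form of `E[W²]`. -/
def mom2W (N K : ℕ) (lam c TD : ℝ) : ℝ := mom1W N K lam c TD ^ 2 + varW N K lam c TD

/-- Closed form of `E[T̂]`. -/
def mom1T (N K : ℕ) (lam c TD : ℝ) : ℝ :=
  ∑ h ∈ Finset.Icc 1 K, ∑ j ∈ Finset.range h, cB N h j *
    ((c * lam * cU N h j + 1 - cV N lam c TD h j * (lam * cU N h j * TD + 1)) /
      (N * probS N K lam c TD * lam * cU N h j ^ 2))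

/-- The ratio formula for the average age. -/
def aveAge (EW EW2 EX EX2 ET : ℝ) : ℝ :=
  (EW2 + 2 * (ET + EX) * EW) / (2 * EW + 2 * EX) + (2 * EX * ET + EX2) / (2 * EW + 2 * EX)

end MulticastAoI

end

/-! The vectors of service times of successive updates are i.i.d., and device `n` receives an update
exactly when its vector lies in the fixed set `evS`. Cutting the sequence after each visit to this
set produces cycles, each consisting of the total duration W of the failed updates and the vector of
the received one. The cycles are themselves i.i.d. (`measurePreserving_cycle`), since the first
cycle is independent of the continuation and the continuation has the original law.

Along a path, let Y_q = X_q + W_{q+1} be the time between the generations of the received updates q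
and q+1. The age just before reception q+1 is Y_q + T̂_{q+1}, and the area under the age between
these receptions is Y_q²/2 + Y_q T̂_{q+1} + (T̂_{q+1}² - T̂_q²)/2, whose last term telescopes to
something bounded. Both long-run averages are therefore averages of a function of two consecutive
cycles. The strong law handles them along even and odd indices separately
(`ae_tendsto_average_consecutive`), and monotonicity of the accumulated area carries the limit from
reception instants to all times (`tendsto_div_of_tendsto_along`).

The moments of a cycle come from conditioning on its first vector: either this update is received,
or its duration is added and the cycle starts afresh. By `integral_cycleLaw` each moment solves a
linear equation whose data are integrals over `evS` or its complement. These rest on two facts about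
one update. Given the service time t of device `n`, the number of other devices served by time t is
binomial, so order statistics have densities that expand into the exponentials with weights B
(`orderStat_density`). And by exchangeability device `n` is among the first K with probability K/N,
independently of the value of T_N(K) (`integral_le_ordStat_comp_ordStat`). Ties are null throughout.
-/

noncomputable section

namespace MulticastAoI

/-! ### Cycles of an i.i.d. sequence between successive visits to a set -/

section Cycle

variable {E : Type*}

/-- The first index at which the sequence `s` visits `A` (`0` if it never does). -/
def firstHit (A : Set E) (s : ℕ → E) : ℕ := sInf {m | s m ∈ A}

/-- The total weight collected by `s` before its first visit to `A`, paired with the point visited. -/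
def firstCycle (A : Set E) (d : E → ℝ) (s : ℕ → E) : ℝ × E :=
  (∑ i ∈ Finset.range (firstHit A s), d (s i), s (firstHit A s))

/-- The sequence `s` after its first visit to `A`. -/
def afterHit (A : Set E) (s : ℕ → E) : ℕ → E := fun i => s (firstHit A s + 1 + i)

/-- The `q`-th cycle of `s`. -/
def cycle (A : Set E) (d : E → ℝ) : ℕ → (ℕ → E) → ℝ × E
  | 0, s => firstCycle A d s
  | q + 1, s => cycle A d q (afterHit A s)

/-- The index of the `q`-th visit of `s` to `A`. -/
def hitIdx (A : Set E) : ℕ → (ℕ → E) → ℕ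
  | 0, s => firstHit A s
  | q + 1, s => firstHit A s + 1 + hitIdx A q (afterHit A s)

/-- Prepend a term to a sequence. -/
def seqCons (x : E) (s : ℕ → E) : ℕ → E := fun n => Nat.casesOn n x s

@[simp] lemma seqCons_zero (x : E) (s : ℕ → E) : seqCons x s 0 = x := rfl

@[simp] lemma seqCons_succ (x : E) (s : ℕ → E) (n : ℕ) : seqCons x s (n + 1) = s n := rfl

lemma firstHit_eq_iff {A : Set E} {s : ℕ → E} (h : ∃ m, s m ∈ A) (m : ℕ) :
    firstHit A s = m ↔ s m ∈ A ∧ ∀ i < m, s i ∉ A := by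
  constructor
  · rintro rfl
    exact ⟨Nat.sInf_mem (s := {m | s m ∈ A}) h, fun i hi => Nat.notMem_of_lt_sInf hi⟩
  · rintro ⟨h1, h2⟩
    refine le_antisymm (Nat.sInf_le h1) ?_
    by_contra hlt
    exact h2 _ (not_le.mp hlt) (Nat.sInf_mem (s := {m | s m ∈ A}) h)

lemma firstHit_mem {A : Set E} {s : ℕ → E} (h : ∃ m, s m ∈ A) : s (firstHit A s) ∈ A :=
  ((firstHit_eq_iff h _).1 rfl).1

lemma notMem_of_lt_firstHit {A : Set E} {s : ℕ → E} {i : ℕ} (h : i < firstHit A s) : s i ∉ A :=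
  Nat.notMem_of_lt_sInf h

lemma firstHit_seqCons_of_mem {A : Set E} {x : E} (hx : x ∈ A) (s : ℕ → E) :
    firstHit A (seqCons x s) = 0 :=
  Nat.sInf_eq_zero.2 (Or.inl hx)

lemma firstHit_seqCons_of_notMem {A : Set E} {x : E} (hx : x ∉ A) {s : ℕ → E}
    (hs : ∃ m, s m ∈ A) : firstHit A (seqCons x s) = firstHit A s + 1 := by
  obtain ⟨m, hm⟩ := hs
  rw [firstHit_eq_iff ⟨m + 1, hm⟩]
  refine ⟨firstHit_mem ⟨m, hm⟩, fun i hi => ?_⟩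
  cases i with
  | zero => exact hx
  | succ i => exact notMem_of_lt_firstHit (A := A) (s := s) (by omega)

lemma firstCycle_seqCons_of_mem {A : Set E} (d : E → ℝ) {x : E} (hx : x ∈ A) (s : ℕ → E) :
    firstCycle A d (seqCons x s) = (0, x) := by
  simp [firstCycle, firstHit_seqCons_of_mem hx]

lemma firstCycle_seqCons_of_notMem {A : Set E} (d : E → ℝ) {x : E} (hx : x ∉ A) {s : ℕ → E}
    (hs : ∃ m, s m ∈ A) :
    firstCycle A d (seqCons x s) = (d x + (firstCycle A d s).1, (firstCycle A d s).2) := by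
  simp [firstCycle, firstHit_seqCons_of_notMem hx hs, Finset.sum_range_succ', add_comm]

variable [MeasurableSpace E]

lemma measurable_firstHit {A : Set E} (hA : MeasurableSet A) :
    Measurable (firstHit A : (ℕ → E) → ℕ) := by
  refine measurable_to_nat fun s => ?_
  have hev : ∀ i : ℕ, MeasurableSet {t : ℕ → E | t i ∈ A} := fun i => measurable_pi_apply i hA
  -- Sequences that never visit `A` receive the default value `sInf ∅ = 0`, hence the extra piece of
  -- the fibre over `0`.
  have h : ∀ m, firstHit A ⁻¹' {m} = {t : ℕ → E | t m ∈ A ∧ ∀ i < m, t i ∉ A} ∪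
      {t : ℕ → E | m = 0 ∧ ∀ i, t i ∉ A} := by
    intro m
    ext t
    by_cases ht : ∃ i, t i ∈ A
    · have : ¬ ∀ i, t i ∉ A := by push Not; exact ht
      simp [firstHit_eq_iff ht, this]
    · push Not at ht
      have h0 : firstHit A t = 0 := Nat.sInf_eq_zero.2 (Or.inr (by ext i; simp [ht i]))
      simp [h0, ht, eq_comm]
  rw [h]
  refine MeasurableSet.union ?_ ?_
  · simp only [Set.ofPred_and, Set.ofPred_forall]
    exact (hev _).inter (.iInter fun i => .iInter fun _ => (hev i).compl)
  · simp only [Set.ofPred_and, Set.ofPred_forall]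
    exact (MeasurableSet.const _).inter (.iInter fun i => (hev i).compl)

/-- A shift by a random amount is a jointly measurable map on ℕ × sequences, because it is
measurable for each of the countably many fixed amounts. -/
lemma measurable_afterHit {A : Set E} (hA : MeasurableSet A) :
    Measurable (afterHit A : (ℕ → E) → ℕ → E) := by
  have h : Measurable (fun p : ℕ × (ℕ → E) => fun i => p.2 (p.1 + 1 + i)) :=
    measurable_from_prod_countable_right fun k => by dsimp only; fun_prop
  exact h.comp ((measurable_firstHit hA).prodMk measurable_id)

lemma measurable_firstCycle {A : Set E} (hA : MeasurableSet A) {d : E → ℝ} (hd : Measurable d) :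
    Measurable (firstCycle A d) := by
  have h : Measurable (fun p : ℕ × (ℕ → E) => (∑ i ∈ Finset.range p.1, d (p.2 i), p.2 p.1)) :=
    measurable_from_prod_countable_right fun k => by dsimp only; fun_prop
  exact h.comp ((measurable_firstHit hA).prodMk measurable_id)

lemma measurable_cycle {A : Set E} (hA : MeasurableSet A) {d : E → ℝ} (hd : Measurable d) (q : ℕ) :
    Measurable (cycle A d q) := by
  induction q with
  | zero => exact measurable_firstCycle hA hd
  | succ q ih => exact ih.comp (measurable_afterHit hA)

lemma measurable_seqCons : Measurable (fun p : E × (ℕ → E) => seqCons p.1 p.2) := by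
  refine measurable_pi_lambda _ fun n => ?_
  cases n with
  | zero => exact measurable_fst
  | succ n => exact (measurable_pi_apply n).comp measurable_snd

variable (μ : Measure E) [IsProbabilityMeasure μ]

/-- The law of an i.i.d. sequence with marginals `μ`. -/
abbrev seqLaw : Measure (ℕ → E) := Measure.infinitePi fun _ : ℕ => μ

/-- A law on sequences that factors on finite initial segments is an infinite product. -/
lemma eq_seqLaw_of_forall_range {κ : Measure (ℕ → E)}
    (h : ∀ (Q : ℕ) (B : ℕ → Set E), (∀ q, MeasurableSet (B q)) →
      κ {s | ∀ q < Q, s q ∈ B q} = ∏ q ∈ Finset.range Q, μ (B q)) : κ = seqLaw μ := by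
  refine Measure.eq_infinitePi _ fun s t ht => ?_
  classical
  -- Padding with the whole space turns a cylinder over an arbitrary finite index set into one over
  -- an initial segment.
  set t' : ℕ → Set E := fun n => if n ∈ s then t n else Set.univ with ht'
  have hmt' : ∀ n, MeasurableSet (t' n) := fun n => by
    simp only [ht']; split_ifs; exacts [ht n, .univ]
  obtain ⟨Q, hQ⟩ : ∃ Q, s ⊆ Finset.range (Q + 1) :=
    ⟨s.sup id, fun i hi => Finset.mem_range.2 (Nat.lt_succ_of_le (Finset.le_sup (f := id) hi))⟩
  have hprod : ∏ i ∈ s, μ (t i) = ∏ i ∈ Finset.range (Q + 1), μ (t' i) := by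
    rw [← Finset.prod_subset hQ (f := fun i => μ (t' i))]
    · exact Finset.prod_congr rfl fun i hi => by simp [ht', hi]
    · intro i _ hi
      simp [ht', hi]
  rw [hprod, ← h _ _ hmt']
  congr 1
  ext x
  simp only [Set.mem_pi, Finset.mem_coe, ht', Set.mem_ofPred_eq]
  constructor
  · intro h i _
    split_ifs with hi
    exacts [h i hi, trivial]
  · intro h i hi
    simpa [hi] using h i (Finset.mem_range.1 (hQ hi))

/-- This is the device for conditioning on the first term; the induction on the hitting time and the
renewal equation both use it. -/
lemma measurePreserving_seqCons :
    MeasurePreserving (fun p : E × (ℕ → E) => seqCons p.1 p.2) (μ.prod (seqLaw μ)) (seqLaw μ) := by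
  refine ⟨measurable_seqCons, eq_seqLaw_of_forall_range μ fun Q B hB => ?_⟩
  rw [Measure.map_apply measurable_seqCons (by
    simp only [Set.ofPred_forall]
    exact .iInter fun i => .iInter fun _ => measurable_pi_apply i (hB i))]
  cases Q with
  | zero => simp
  | succ Q =>
    have : (fun p : E × (ℕ → E) => seqCons p.1 p.2) ⁻¹' {s | ∀ q < Q + 1, s q ∈ B q}
        = B 0 ×ˢ Set.pi (Finset.range Q : Set ℕ) (fun i => B (i + 1)) := by
      ext p
      simp only [Set.mem_preimage, Set.mem_pi, Finset.coe_range, Set.mem_Iio, Set.mem_prod,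
        Set.mem_ofPred_eq]
      constructor
      · intro h
        exact ⟨h 0 (Nat.succ_pos _), fun i hi => h (i + 1) (by omega)⟩
      · rintro ⟨h0, h1⟩ i hi
        cases i with
        | zero => exact h0
        | succ i => exact h1 i (by omega)
    rw [this, Measure.prod_prod, Measure.infinitePi_pi _ (fun i _ => hB _),
      Finset.prod_range_succ', mul_comm]

/-- Avoiding `A` during the first m terms has probability μ(Aᶜ)^m, which tends to zero. -/
lemma ae_exists_hit {A : Set E} (hA : MeasurableSet A) (hpos : μ A ≠ 0) :
    ∀ᵐ s ∂(seqLaw μ), ∃ m, s m ∈ A := by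
  have hlt : μ Aᶜ < 1 := by
    rw [prob_compl_eq_one_sub hA]
    exact ENNReal.sub_lt_self ENNReal.one_ne_top one_ne_zero hpos
  have hle : ∀ m : ℕ, seqLaw μ {s | ¬ ∃ m, s m ∈ A} ≤ μ Aᶜ ^ m := by
    intro m
    calc seqLaw μ {s | ¬ ∃ m, s m ∈ A}
        ≤ seqLaw μ (Set.pi (Finset.range m : Set ℕ) fun _ => Aᶜ) := by
          refine measure_mono fun s hs i _ => ?_
          simp only [Set.mem_ofPred_eq, not_exists] at hs
          exact hs i
      _ = μ Aᶜ ^ m := by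
          rw [Measure.infinitePi_pi _ (fun i _ => hA.compl)]; simp
  exact le_antisymm (ge_of_tendsto' (ENNReal.tendsto_pow_atTop_nhds_zero_of_lt_one hlt) hle) bot_le

/-- The law of the first cycle. -/
def cycleLaw (A : Set E) (d : E → ℝ) : Measure (ℝ × E) := (seqLaw μ).map (firstCycle A d)

lemma isProbabilityMeasure_cycleLaw {A : Set E} (hA : MeasurableSet A) {d : E → ℝ}
    (hd : Measurable d) : IsProbabilityMeasure (cycleLaw μ A d) :=
  Measure.isProbabilityMeasure_map (measurable_firstCycle hA hd).aemeasurable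

/-- The sequences whose first visit to `A` is at time `m`, whose first cycle lies in `B`, and whose
continuation lies in `R`. -/
def hitAt (A : Set E) (d : E → ℝ) (m : ℕ) (B : Set (ℝ × E)) (R : Set (ℕ → E)) : Set (ℕ → E) :=
  {s | s m ∈ A ∧ (∀ i < m, s i ∉ A) ∧ (∑ i ∈ Finset.range m, d (s i), s m) ∈ B ∧
    (fun i => s (m + 1 + i)) ∈ R}

lemma measurableSet_hitAt {A : Set E} (hA : MeasurableSet A) {d : E → ℝ} (hd : Measurable d)
    (m : ℕ) {B : Set (ℝ × E)} (hB : MeasurableSet B) {R : Set (ℕ → E)} (hR : MeasurableSet R) :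
    MeasurableSet (hitAt A d m B R) := by
  have hev : ∀ i : ℕ, MeasurableSet {t : ℕ → E | t i ∈ A} := fun i => measurable_pi_apply i hA
  have h2 : MeasurableSet {s : ℕ → E | ∀ i < m, s i ∉ A} := by
    simp only [Set.ofPred_forall]
    exact .iInter fun i => .iInter fun _ => (hev i).compl
  have h3 : Measurable fun s : ℕ → E => (∑ i ∈ Finset.range m, d (s i), s m) := by fun_prop
  have h4 : Measurable fun s : ℕ → E => fun i => s (m + 1 + i) := by fun_prop
  exact (hev m).inter (h2.inter ((h3 hB).inter (h4 hR)))

/-- Strong Markov property at a fixed value of the hitting time. The induction peels off the first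
term: it lies outside `A` and adds `d x` to the weight, so `B` is replaced by its preimage under
that translation while `R` is untouched. -/
lemma seqLaw_hitAt {A : Set E} (hA : MeasurableSet A) {d : E → ℝ} (hd : Measurable d)
    (m : ℕ) {B : Set (ℝ × E)} (hB : MeasurableSet B) {R : Set (ℕ → E)} (hR : MeasurableSet R) :
    seqLaw μ (hitAt A d m B R) = seqLaw μ (hitAt A d m B Set.univ) * seqLaw μ R := by
  induction m generalizing B with
  | zero =>
    have key : ∀ R : Set (ℕ → E), MeasurableSet R →
        seqLaw μ (hitAt A d 0 B R) = μ {x | x ∈ A ∧ ((0 : ℝ), x) ∈ B} * seqLaw μ R := by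
      intro R hR
      rw [← (measurePreserving_seqCons μ).measure_preimage
        (measurableSet_hitAt hA hd 0 hB hR).nullMeasurableSet, ← Measure.prod_prod]
      congr 1
      ext p
      have : (fun i => seqCons p.1 p.2 (0 + 1 + i)) = p.2 := by
        funext i; rw [zero_add, add_comm]; rfl
      simp [hitAt, this, and_assoc]
    rw [key R hR, key _ .univ, measure_univ, mul_one]
  | succ m ih =>
    have key : ∀ R : Set (ℕ → E), MeasurableSet R →
        seqLaw μ (hitAt A d (m + 1) B R) = ∫⁻ x, Aᶜ.indicator (fun x =>
          seqLaw μ (hitAt A d m ((fun y : ℝ × E => (d x + y.1, y.2)) ⁻¹' B) R)) x ∂μ := by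
      intro R hR
      have hm := measurableSet_hitAt hA hd (m + 1) hB hR
      rw [← (measurePreserving_seqCons μ).measure_preimage hm.nullMeasurableSet,
        Measure.prod_apply (measurable_seqCons hm)]
      refine lintegral_congr fun x => ?_
      by_cases hx : x ∈ A
      · rw [Set.indicator_of_notMem (by simpa using hx)]
        convert! measure_empty (μ := seqLaw μ)
        refine Set.eq_empty_of_forall_notMem fun s hs => ?_
        exact hs.2.1 0 (Nat.succ_pos _) hx
      · rw [Set.indicator_of_mem (by simpa using hx)]
        congr 1
        ext s
        have h1 : (fun i => seqCons x s (m + 1 + 1 + i)) = fun i => s (m + 1 + i) := by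
          funext i
          rw [show m + 1 + 1 + i = (m + 1 + i) + 1 by ring]; rfl
        have h2 : (∀ i < m + 1, seqCons x s i ∉ A) ↔ ∀ i < m, s i ∉ A := by
          constructor
          · intro h i hi; exact h (i + 1) (by omega)
          · intro h i hi
            cases i with
            | zero => exact hx
            | succ i => exact h i (by omega)
        simp only [hitAt, Set.mem_preimage, Set.mem_ofPred_eq, h1, h2, seqCons_succ,
          Finset.sum_range_succ', seqCons_zero, add_comm _ (d x)]
    rw [key R hR, key _ .univ, ← lintegral_mul_const']
    · refine lintegral_congr fun x => ?_
      by_cases hx : x ∈ Aᶜ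
      · rw [Set.indicator_of_mem hx, Set.indicator_of_mem hx]
        exact ih ((by fun_prop : Measurable fun y : ℝ × E => (d x + y.1, y.2)) hB)
      · rw [Set.indicator_of_notMem hx, Set.indicator_of_notMem hx, zero_mul]
    · exact measure_ne_top _ _

/-- The first cycle and the continuation are independent, and the continuation is again an i.i.d.
sequence. -/
lemma measurePreserving_firstCycle_afterHit {A : Set E} (hA : MeasurableSet A) (hpos : μ A ≠ 0)
    {d : E → ℝ} (hd : Measurable d) :
    MeasurePreserving (fun s => (firstCycle A d s, afterHit A s)) (seqLaw μ)
      ((cycleLaw μ A d).prod (seqLaw μ)) := by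
  have hmeas : Measurable fun s : ℕ → E => (firstCycle A d s, afterHit A s) :=
    (measurable_firstCycle hA hd).prodMk (measurable_afterHit hA)
  have := isProbabilityMeasure_cycleLaw μ hA hd
  refine ⟨hmeas, (Measure.prod_eq fun B R hB hR => ?_).symm⟩
  -- Decomposition by the value of the hitting time, valid up to the null set of sequences that
  -- never hit. Used for `R` and for the whole space.
  have key : ∀ R : Set (ℕ → E), MeasurableSet R →
      seqLaw μ ((fun s => (firstCycle A d s, afterHit A s)) ⁻¹' (B ×ˢ R))
        = ∑' m, seqLaw μ (hitAt A d m B R) := by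
    intro R hR
    rw [← measure_iUnion]
    · refine measure_congr ?_
      filter_upwards [ae_exists_hit μ hA hpos] with s hs
      refine propext ?_
      change ((firstCycle A d s, afterHit A s) ∈ B ×ˢ R) ↔ s ∈ ⋃ m, hitAt A d m B R
      simp only [Set.mem_iUnion, hitAt, Set.mem_ofPred_eq, Set.mem_prod]
      constructor
      · rintro ⟨h1, h2⟩
        exact ⟨firstHit A s, firstHit_mem hs, fun i hi => notMem_of_lt_firstHit hi, h1, h2⟩
      · rintro ⟨m, h1, h2, h3, h4⟩
        obtain rfl := (firstHit_eq_iff hs m).2 ⟨h1, h2⟩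
        exact ⟨h3, h4⟩
    · intro m m' hmm'
      refine Set.disjoint_left.2 fun s hs hs' => hmm' ?_
      rw [← (firstHit_eq_iff ⟨m, hs.1⟩ m).2 ⟨hs.1, hs.2.1⟩,
        (firstHit_eq_iff ⟨m, hs.1⟩ m').2 ⟨hs'.1, hs'.2.1⟩]
    · exact fun m => measurableSet_hitAt hA hd m hB hR
  rw [Measure.map_apply hmeas (hB.prod hR), key R hR, tsum_congr fun m => seqLaw_hitAt μ hA hd m hB hR,
    ENNReal.tsum_mul_right, ← key _ .univ, cycleLaw, Measure.map_apply (measurable_firstCycle hA hd) hB]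
  congr 2
  ext s
  simp

/-- The cycles of an i.i.d. sequence are i.i.d. -/
lemma measurePreserving_cycle {A : Set E} (hA : MeasurableSet A) (hpos : μ A ≠ 0)
    {d : E → ℝ} (hd : Measurable d) [IsProbabilityMeasure (cycleLaw μ A d)] :
    MeasurePreserving (fun s q => cycle A d q s) (seqLaw μ) (seqLaw (cycleLaw μ A d)) := by
  have hmeas : Measurable fun (s : ℕ → E) q => cycle A d q s :=
    measurable_pi_lambda _ fun q => measurable_cycle hA hd q
  -- The later cycles are the cycles of the continuation, so splitting off the first one reduces Q +
  -- 1 cycles to Q.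
  have hrange : ∀ (Q : ℕ) (B : ℕ → Set (ℝ × E)), (∀ q, MeasurableSet (B q)) →
      seqLaw μ {s | ∀ q < Q, cycle A d q s ∈ B q} = ∏ q ∈ Finset.range Q, cycleLaw μ A d (B q) := by
    intro Q
    induction Q with
    | zero => intro B _; simp
    | succ Q ih =>
      intro B hB
      have hmR : MeasurableSet {s : ℕ → E | ∀ q < Q, cycle A d q s ∈ B (q + 1)} := by
        simp only [Set.ofPred_forall]
        exact .iInter fun i => .iInter fun _ => measurable_cycle hA hd i (hB _)
      rw [Finset.prod_range_succ', ← ih (fun q => B (q + 1)) (fun q => hB _), mul_comm,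
        ← Measure.prod_prod, ← (measurePreserving_firstCycle_afterHit μ hA hpos hd).measure_preimage
        ((hB 0).prod hmR).nullMeasurableSet]
      congr 1
      ext s
      simp only [Set.mem_ofPred_eq, Set.mem_preimage, Set.mem_prod]
      constructor
      · intro h
        exact ⟨h 0 (Nat.succ_pos _), fun i hi => h (i + 1) (by omega)⟩
      · rintro ⟨h0, h1⟩ i hi
        cases i with
        | zero => exact h0
        | succ i => exact h1 i (by omega)
  refine ⟨hmeas, eq_seqLaw_of_forall_range _ fun Q B hB => ?_⟩
  rw [← hrange Q B hB, Measure.map_apply hmeas]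
  · rfl
  · simp only [Set.ofPred_forall]
    exact .iInter fun i => .iInter fun _ => measurable_pi_apply i (hB i)

end Cycle

/-! ### Moments of one cycle via a renewal equation -/

section CycleMoments

variable {E : Type*} [MeasurableSpace E] (μ : Measure E) [IsProbabilityMeasure μ]

lemma ae_seqLaw_forall {S : Set E} (hS : ∀ᵐ x ∂μ, x ∈ S) : ∀ᵐ s ∂(seqLaw μ), ∀ i, s i ∈ S :=
  ae_all_iff.2 fun i =>
    (measurePreserving_eval_infinitePi (fun _ : ℕ => μ) i).quasiMeasurePreserving.ae hS

lemma ae_cycleLaw {A : Set E} (hA : MeasurableSet A) (hpos : μ A ≠ 0) {d : E → ℝ}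
    (hd : Measurable d) {S : Set E} (hmS : MeasurableSet S) (hS : ∀ᵐ x ∂μ, x ∈ A → x ∈ S) :
    ∀ᵐ y ∂(cycleLaw μ A d), y.2 ∈ S := by
  rw [cycleLaw, ae_map_iff (measurable_firstCycle hA hd).aemeasurable (measurable_snd hmS)]
  filter_upwards [ae_exists_hit μ hA hpos, ae_seqLaw_forall μ (S := {x | x ∈ A → x ∈ S}) hS]
    with s h1 h2
  exact h2 _ (firstHit_mem h1)

/-- Renewal equation: a first term in `A` ends the cycle with weight zero, and otherwise its weight
is added to that of an independent fresh cycle. With p = μ(A), suitable choices of `G` give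
equations m = data + (1 - p) m; integrability has to be known beforehand in order to solve them. -/
lemma integral_cycleLaw {A : Set E} (hA : MeasurableSet A) (hpos : μ A ≠ 0) {d : E → ℝ}
    (hd : Measurable d) {G : ℝ × E → ℝ} (hG : Measurable G) (hi : Integrable G (cycleLaw μ A d)) :
    ∫ y, G y ∂(cycleLaw μ A d) = ∫ x in A, G (0, x) ∂μ
      + ∫ x in Aᶜ, ∫ y, G (d x + y.1, y.2) ∂(cycleLaw μ A d) ∂μ := by
  have hC := measurable_firstCycle hA hd
  have hGC : Measurable fun s => G (firstCycle A d s) := hG.comp hC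
  have hi' : Integrable (fun s => G (firstCycle A d s)) (seqLaw μ) :=
    (integrable_map_measure hG.aestronglyMeasurable hC.aemeasurable).1 hi
  have hcons := measurePreserving_seqCons μ
  have hi2 : Integrable (fun p : E × (ℕ → E) => G (firstCycle A d (seqCons p.1 p.2)))
      (μ.prod (seqLaw μ)) := hcons.integrable_comp_of_integrable hi'
  rw [cycleLaw, integral_map hC.aemeasurable hG.aestronglyMeasurable, ← hcons.map_eq,
    integral_map hcons.measurable.aemeasurable hGC.aestronglyMeasurable, integral_prod _ hi2,
    ← integral_add_compl hA hi2.integral_prod_left]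
  congr 1
  · refine setIntegral_congr_fun hA fun x hx => ?_
    simp [firstCycle_seqCons_of_mem d hx]
  · refine setIntegral_congr_fun hA.compl fun x hx => ?_
    dsimp only
    rw [hcons.map_eq, integral_map hC.aemeasurable
      (show Measurable fun y : ℝ × E => G (d x + y.1, y.2) from
        hG.comp (by fun_prop)).aestronglyMeasurable]
    refine integral_congr_ae ?_
    filter_upwards [ae_exists_hit μ hA hpos] with s hs
    rw [firstCycle_seqCons_of_notMem d hx hs]

/-- The collected weight is at most `D` times the hitting time, whose tail is geometric, so that Σ
m² μ(Aᶜ)^m bounds its second moment. -/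
lemma memLp_cycleLaw_fst {A : Set E} (hA : MeasurableSet A) (hpos : μ A ≠ 0) {d : E → ℝ}
    (hd : Measurable d) {D : ℝ} (hD : ∀ᵐ x ∂μ, |d x| ≤ D) :
    MemLp (fun y : ℝ × E => y.1) 2 (cycleLaw μ A d) := by
  have hC := measurable_firstCycle hA hd
  have hH : Measurable (firstHit A : (ℕ → E) → ℕ) := measurable_firstHit hA
  have hp : μ.real Aᶜ < 1 := by
    rw [probReal_compl_eq_one_sub hA]
    have := ENNReal.toReal_pos hpos (measure_ne_top μ A)
    rw [Measure.real]; linarith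
  have hhit : MemLp (fun s : ℕ → E => (firstHit A s : ℝ)) 2 (seqLaw μ) := by
    rw [memLp_two_iff_integrable_sq (by fun_prop)]
    refine ⟨by fun_prop, ?_⟩
    have hle : ∀ m : ℕ, (seqLaw μ).map (firstHit A) {m} ≤ ENNReal.ofReal (μ.real Aᶜ ^ m) := by
      intro m
      rw [Measure.map_apply hH (measurableSet_singleton m)]
      calc seqLaw μ (firstHit A ⁻¹' {m})
          ≤ seqLaw μ (Set.pi (Finset.range m : Set ℕ) fun _ => Aᶜ) := by
            refine measure_mono fun s hs i hi => ?_
            rw [Set.mem_preimage, Set.mem_singleton_iff] at hs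
            exact notMem_of_lt_firstHit (by rw [hs]; simpa using hi)
        _ = ENNReal.ofReal (μ.real Aᶜ ^ m) := by
            rw [Measure.infinitePi_pi _ (fun i _ => hA.compl),
              ENNReal.ofReal_pow measureReal_nonneg]
            simp [Measure.real]
    have hsum : Summable fun m : ℕ => (m : ℝ) ^ 2 * μ.real Aᶜ ^ m :=
      summable_pow_mul_geometric_of_norm_lt_one 2
        (by rwa [Real.norm_eq_abs, abs_of_nonneg measureReal_nonneg])
    calc ∫⁻ s, ‖(firstHit A s : ℝ) ^ 2‖ₑ ∂(seqLaw μ)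
        = ∫⁻ m, ‖(m : ℝ) ^ 2‖ₑ ∂((seqLaw μ).map (firstHit A)) := by
          rw [lintegral_map (by fun_prop) hH]
      _ = ∑' m : ℕ, ‖(m : ℝ) ^ 2‖ₑ * (seqLaw μ).map (firstHit A) {m} := lintegral_countable' _
      _ ≤ ∑' m : ℕ, ENNReal.ofReal ((m : ℝ) ^ 2 * μ.real Aᶜ ^ m) := by
          refine ENNReal.tsum_le_tsum fun m => ?_
          rw [ENNReal.ofReal_mul (by positivity), Real.enorm_of_nonneg (by positivity)]
          gcongr
          exact hle m
      _ < ⊤ := hsum.tsum_ofReal_lt_top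
  rw [cycleLaw, memLp_map_measure_iff (by fun_prop) hC.aemeasurable]
  refine (hhit.const_mul D).mono' (measurable_fst.comp hC).aestronglyMeasurable ?_
  filter_upwards [ae_seqLaw_forall μ (S := {x | |d x| ≤ D}) hD] with s hs
  calc ‖(firstCycle A d s).1‖ ≤ ∑ i ∈ Finset.range (firstHit A s), |d (s i)| :=
        Finset.abs_sum_le_sum_abs (fun i => d (s i)) (Finset.range (firstHit A s))
    _ ≤ ∑ i ∈ Finset.range (firstHit A s), D := Finset.sum_le_sum fun i _ => hs i
    _ = D * firstHit A s := by simp [mul_comm]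

lemma integrable_cycleLaw_snd {A : Set E} (hA : MeasurableSet A) (hpos : μ A ≠ 0) {d : E → ℝ}
    (hd : Measurable d) {f : E → ℝ} (hf : Measurable f) {C : ℝ}
    (hC : ∀ᵐ x ∂μ, x ∈ A → |f x| ≤ C) : Integrable (fun y : ℝ × E => f y.2) (cycleLaw μ A d) := by
  have := isProbabilityMeasure_cycleLaw μ hA hd
  exact Integrable.of_bound (hf.comp measurable_snd).aestronglyMeasurable C
    (ae_cycleLaw μ hA hpos hd (S := {x | |f x| ≤ C})
      (measurableSet_le hf.abs measurable_const) hC)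

lemma integrable_cycleLaw_fst_mul_snd {A : Set E} (hA : MeasurableSet A) (hpos : μ A ≠ 0)
    {d : E → ℝ} (hd : Measurable d) {D : ℝ} (hD : ∀ᵐ x ∂μ, |d x| ≤ D) {f : E → ℝ}
    (hf : Measurable f) {C : ℝ} (hC : ∀ᵐ x ∂μ, x ∈ A → |f x| ≤ C) :
    Integrable (fun y : ℝ × E => y.1 * f y.2) (cycleLaw μ A d) := by
  have := isProbabilityMeasure_cycleLaw μ hA hd
  exact ((memLp_cycleLaw_fst μ hA hpos hd hD).integrable one_le_two).mul_bdd
    (hf.comp measurable_snd).aestronglyMeasurable (ae_cycleLaw μ hA hpos hd (S := {x | |f x| ≤ C})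
      (measurableSet_le hf.abs measurable_const) hC)

/-- Solves m = ∫_A f + (1 - p) m. -/
lemma integral_cycleLaw_snd {A : Set E} (hA : MeasurableSet A) (hpos : μ A ≠ 0) {d : E → ℝ}
    (hd : Measurable d) {f : E → ℝ} (hf : Measurable f) {C : ℝ}
    (hC : ∀ᵐ x ∂μ, x ∈ A → |f x| ≤ C) :
    ∫ y, f y.2 ∂(cycleLaw μ A d) = (∫ x in A, f x ∂μ) / μ.real A := by
  have h := integral_cycleLaw μ hA hpos hd (hf.comp measurable_snd)
    (integrable_cycleLaw_snd μ hA hpos hd hf hC)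
  have hp : μ.real A ≠ 0 := (measureReal_ne_zero_iff).2 hpos
  simp only [Function.comp_apply, setIntegral_const, probReal_compl_eq_one_sub hA,
    smul_eq_mul] at h
  rw [eq_div_iff hp]
  linarith

/-- Solves m = ∫_{Aᶜ} d + (1 - p) m. -/
lemma integral_cycleLaw_fst {A : Set E} (hA : MeasurableSet A) (hpos : μ A ≠ 0) {d : E → ℝ}
    (hd : Measurable d) {D : ℝ} (hD : ∀ᵐ x ∂μ, |d x| ≤ D) :
    ∫ y, y.1 ∂(cycleLaw μ A d) = (∫ x in Aᶜ, d x ∂μ) / μ.real A := by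
  have := isProbabilityMeasure_cycleLaw μ hA hd
  have hi := (memLp_cycleLaw_fst μ hA hpos hd hD).integrable one_le_two
  have hid : Integrable d μ := Integrable.of_bound hd.aestronglyMeasurable D hD
  have h := integral_cycleLaw μ hA hpos hd measurable_fst hi
  have hp : μ.real A ≠ 0 := (measureReal_ne_zero_iff).2 hpos
  have hin : ∀ x, ∫ y : ℝ × E, d x + y.1 ∂(cycleLaw μ A d)
      = d x + ∫ y, y.1 ∂(cycleLaw μ A d) := fun x => by
    rw [integral_add (integrable_const _) hi]; simp
  simp only [hin, integral_zero, zero_add] at h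
  rw [integral_add hid.integrableOn (integrable_const _), setIntegral_const,
    probReal_compl_eq_one_sub hA, smul_eq_mul] at h
  rw [eq_div_iff hp]
  linarith

/-- The failed updates carry no information about the received one. Only this uncorrelatedness is
needed, and it follows from m = (∫_{Aᶜ} d) E[f] + (1 - p) m. -/
lemma integral_cycleLaw_fst_mul_snd {A : Set E} (hA : MeasurableSet A) (hpos : μ A ≠ 0)
    {d : E → ℝ} (hd : Measurable d) {D : ℝ} (hD : ∀ᵐ x ∂μ, |d x| ≤ D) {f : E → ℝ}
    (hf : Measurable f) {C : ℝ} (hC : ∀ᵐ x ∂μ, x ∈ A → |f x| ≤ C) :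
    ∫ y, y.1 * f y.2 ∂(cycleLaw μ A d)
      = (∫ y, y.1 ∂(cycleLaw μ A d)) * ∫ y, f y.2 ∂(cycleLaw μ A d) := by
  have := isProbabilityMeasure_cycleLaw μ hA hd
  have hi := integrable_cycleLaw_fst_mul_snd μ hA hpos hd hD hf hC
  have hif := integrable_cycleLaw_snd μ hA hpos hd hf hC
  have hid : Integrable d μ := Integrable.of_bound hd.aestronglyMeasurable D hD
  have h := integral_cycleLaw μ hA hpos hd (G := fun y => y.1 * f y.2)
    (measurable_fst.mul (hf.comp measurable_snd)) hi
  have hp : μ.real A ≠ 0 := (measureReal_ne_zero_iff).2 hpos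
  have hin : ∀ x, ∫ y : ℝ × E, (d x + y.1) * f y.2 ∂(cycleLaw μ A d)
      = d x * (∫ y, f y.2 ∂(cycleLaw μ A d)) + ∫ y, y.1 * f y.2 ∂(cycleLaw μ A d) := fun x => by
    simp only [add_mul]
    rw [integral_add (hif.const_mul _) hi, integral_const_mul]
  simp only [hin, zero_mul, integral_zero, zero_add] at h
  rw [integral_add (hid.integrableOn.mul_const _) (integrable_const _), setIntegral_const,
    integral_mul_const, probReal_compl_eq_one_sub hA, smul_eq_mul] at h
  rw [integral_cycleLaw_fst μ hA hpos hd hD, div_mul_eq_mul_div, eq_div_iff hp]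
  linarith

/-- Expanding the square in the renewal equation leaves a cross term in which the first moment
appears. -/
lemma integral_cycleLaw_fst_sq {A : Set E} (hA : MeasurableSet A) (hpos : μ A ≠ 0) {d : E → ℝ}
    (hd : Measurable d) {D : ℝ} (hD : ∀ᵐ x ∂μ, |d x| ≤ D) :
    ∫ y, y.1 ^ 2 ∂(cycleLaw μ A d) = ((∫ x in Aᶜ, d x ^ 2 ∂μ)
      + 2 * (∫ x in Aᶜ, d x ∂μ) * ∫ y, y.1 ∂(cycleLaw μ A d)) / μ.real A := by
  have := isProbabilityMeasure_cycleLaw μ hA hd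
  have hm := memLp_cycleLaw_fst μ hA hpos hd hD
  have hi := hm.integrable one_le_two
  have hi2 := hm.integrable_sq
  have hid : MemLp d 2 μ := MemLp.of_bound hd.aestronglyMeasurable D hD
  have h := integral_cycleLaw μ hA hpos hd (G := fun y => y.1 ^ 2) (by fun_prop) hi2
  have hp : μ.real A ≠ 0 := (measureReal_ne_zero_iff).2 hpos
  have hin : ∀ x, ∫ y : ℝ × E, (d x + y.1) ^ 2 ∂(cycleLaw μ A d)
      = (d x ^ 2 + d x * (2 * ∫ y, y.1 ∂(cycleLaw μ A d)))
        + ∫ y, y.1 ^ 2 ∂(cycleLaw μ A d) := fun x => by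
    have : ∀ y : ℝ × E, (d x + y.1) ^ 2 = (d x ^ 2 + (2 * d x) * y.1) + y.1 ^ 2 := fun y => by ring
    have h1 : Integrable (fun y : ℝ × E => d x ^ 2 + (2 * d x) * y.1) (cycleLaw μ A d) :=
      (integrable_const _).add (hi.const_mul _)
    simp only [this]
    rw [integral_add h1 hi2, integral_add (integrable_const _) (hi.const_mul _), integral_const_mul]
    simp; ring
  have hsq : Integrable (fun x => d x ^ 2) μ := hid.integrable_sq
  have hid1 : Integrable (fun x => d x * (2 * ∫ y, y.1 ∂(cycleLaw μ A d))) μ :=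
    (hid.integrable one_le_two).mul_const _
  have hsum : Integrable (fun x => d x ^ 2 + d x * (2 * ∫ y, y.1 ∂(cycleLaw μ A d))) μ :=
    hsq.add hid1
  simp only [hin, zero_pow two_ne_zero, integral_zero, zero_add] at h
  rw [integral_add hsum.integrableOn (integrable_const _), setIntegral_const,
    integral_add hsq.integrableOn hid1.integrableOn,
    integral_mul_const, probReal_compl_eq_one_sub hA, smul_eq_mul] at h
  rw [eq_div_iff hp]
  linarith

end CycleMoments

/-! ### A strong law for functionals of consecutive terms -/

section StrongLaw

lemma tendsto_div_two_div_self : Tendsto (fun n : ℕ => ((n / 2 : ℕ) : ℝ) / n) atTop (𝓝 (1 / 2)) := by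
  have h := tendsto_nat_floor_mul_div_atTop (R := ℝ) (a := 1 / 2) (by norm_num)
  refine (h.comp tendsto_natCast_atTop_atTop).congr fun n => ?_
  have : ⌊(1 / 2 : ℝ) * n⌋₊ = n / 2 := by
    rw [one_div, ← div_eq_inv_mul]; exact_mod_cast Nat.floor_div_eq_div (K := ℝ) n 2
  simp only [Function.comp_apply, this]

/-- Among the first n indices about half are even and half odd, so the average is asymptotically the
mean of the two averages. -/
lemma tendsto_average_of_even_odd {u : ℕ → ℝ} {L : ℝ}
    (he : Tendsto (fun n : ℕ => (∑ i ∈ Finset.range n, u (2 * i)) / n) atTop (𝓝 L))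
    (ho : Tendsto (fun n : ℕ => (∑ i ∈ Finset.range n, u (2 * i + 1)) / n) atTop (𝓝 L)) :
    Tendsto (fun n : ℕ => (∑ i ∈ Finset.range n, u i) / n) atTop (𝓝 L) := by
  have hsum : ∀ n : ℕ, ∑ i ∈ Finset.range n, u i = ∑ i ∈ Finset.range ((n + 1) / 2), u (2 * i)
      + ∑ i ∈ Finset.range (n / 2), u (2 * i + 1) := by
    intro n
    induction n with
    | zero => simp
    | succ n ih =>
      rw [Finset.sum_range_succ, ih]
      obtain ⟨k, rfl | rfl⟩ := Nat.even_or_odd' n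
      · rw [show (2 * k + 1) / 2 = k by omega, show 2 * k / 2 = k by omega,
          show (2 * k + 1 + 1) / 2 = k + 1 by omega, Finset.sum_range_succ]
        ring
      · rw [show (2 * k + 1 + 1) / 2 = k + 1 by omega, show (2 * k + 1) / 2 = k by omega,
          show (2 * k + 1 + 1 + 1) / 2 = k + 1 by omega,
          Finset.sum_range_succ (fun i => u (2 * i + 1))]
        ring
  have hdiv : Tendsto (fun n : ℕ => n / 2) atTop atTop :=
    Nat.tendsto_div_const_atTop two_ne_zero
  have h1 : Tendsto (fun n : ℕ => (((n + 1) / 2 : ℕ) : ℝ) / n) atTop (𝓝 (1 / 2)) := by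
    have h2 := tendsto_div_two_div_self.const_sub 1
    rw [show (1 : ℝ) - 1 / 2 = 1 / 2 by norm_num] at h2
    refine h2.congr' ?_
    filter_upwards [eventually_ge_atTop 1] with n hn
    have hn0 : (n : ℝ) ≠ 0 := by positivity
    have h3 : (((n + 1) / 2 : ℕ) : ℝ) + ((n / 2 : ℕ) : ℝ) = n := by
      exact_mod_cast (by omega : (n + 1) / 2 + n / 2 = n)
    rw [eq_div_iff hn0, sub_mul, div_mul_cancel₀ _ hn0]
    linarith
  have h2 := (he.comp (hdiv.comp (tendsto_add_atTop_nat 1))).mul h1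
  have h3 := (ho.comp hdiv).mul tendsto_div_two_div_self
  have h4 := h2.add h3
  rw [show L * (1 / 2) + L * (1 / 2) = L by ring] at h4
  refine h4.congr' ?_
  filter_upwards [eventually_ge_atTop 2] with n hn
  have hn0 : (n : ℝ) ≠ 0 := by positivity
  have ha : (((n + 1) / 2 : ℕ) : ℝ) ≠ 0 := by
    have : 0 < (n + 1) / 2 := by omega
    positivity
  have hb : ((n / 2 : ℕ) : ℝ) ≠ 0 := by
    have : 0 < n / 2 := by omega
    positivity
  simp only [Function.comp_apply]
  rw [hsum, div_mul_div_cancel₀ ha, div_mul_div_cancel₀ hb, add_div]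

variable {F : Type*} [MeasurableSpace F]

/-- Terms with adjacent q share a coordinate and are dependent, but terms with q of one parity
depend on disjoint pairs of coordinates. -/
lemma ae_tendsto_average_consecutive (ν : Measure F) [IsProbabilityMeasure ν] {G : F × F → ℝ}
    (hG : Measurable G) (hi : Integrable G (ν.prod ν)) :
    ∀ᵐ c ∂(seqLaw ν), Tendsto (fun n : ℕ => (∑ q ∈ Finset.range n, G (c q, c (q + 1))) / n) atTop
      (𝓝 (∫ y, G y ∂(ν.prod ν))) := by
  have hind : iIndepFun (fun (i : ℕ) (c : ℕ → F) => c i) (seqLaw ν) :=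
    iIndepFun_infinitePi (P := fun _ : ℕ => ν) (X := fun _ x => x) (fun _ => measurable_id)
  have hpair : ∀ i j : ℕ, i ≠ j →
      MeasurePreserving (fun c : ℕ → F => (c i, c j)) (seqLaw ν) (ν.prod ν) := fun i j hij =>
    ⟨by fun_prop, Measure.infinitePi_map_eval_prod (P := fun _ : ℕ => ν) hij⟩
  -- The hypothesis on `a`, applied in both orders, says that the pairs {a i, a i + 1} are disjoint,
  -- which gives the pairwise independence required by the strong law.
  have hlaw : ∀ a : ℕ → ℕ, (∀ i j, i ≠ j → a i ≠ a j ∧ a i ≠ a j + 1) →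
      ∀ᵐ c ∂(seqLaw ν), Tendsto (fun n : ℕ =>
        (∑ q ∈ Finset.range n, G (c (a q), c (a q + 1))) / n) atTop (𝓝 (∫ y, G y ∂(ν.prod ν))) := by
    intro a ha
    have hp := fun q => hpair (a q) (a q + 1) (Nat.succ_ne_self _).symm
    have h := strong_law_ae_real (μ := seqLaw ν) (fun q c => G (c (a q), c (a q + 1)))
      ((hp 0).integrable_comp_of_integrable hi) (fun i j hij =>
        (hind.indepFun_prodMk_prodMk (fun i => measurable_pi_apply i) (a i) (a i + 1) (a j)
          (a j + 1) (ha i j hij).1 (ha i j hij).2 (ha j i hij.symm).2.symm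
            (by have := (ha i j hij).1; omega)).comp hG hG)
      (fun q => ⟨(hG.comp (hp q).measurable).aemeasurable, (hG.comp (hp 0).measurable).aemeasurable,
        by
          change (seqLaw ν).map (G ∘ _) = (seqLaw ν).map (G ∘ _)
          rw [← Measure.map_map hG (hp q).measurable, ← Measure.map_map hG (hp 0).measurable,
            (hp q).map_eq, (hp 0).map_eq]⟩)
    rwa [← (hp 0).map_eq, integral_map (hp 0).measurable.aemeasurable hG.aestronglyMeasurable]
  filter_upwards [hlaw (fun i => 2 * i) (fun i j h => by omega),
    hlaw (fun i => 2 * i + 1) (fun i j h => by omega)] with c h1 h2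
  exact tendsto_average_of_even_odd (u := fun q => G (c q, c (q + 1))) h1 h2

end StrongLaw

/-! ### Visits and cycles along one path -/

section Visits

variable {E : Type*} {A : Set E}

/-- The index at which the `q`-th cycle starts. -/
def hitStart (A : Set E) : ℕ → (ℕ → E) → ℕ
  | 0, _ => 0
  | q + 1, s => hitIdx A q s + 1

lemma infinite_afterHit {s : ℕ → E} (h : {j | s j ∈ A}.Infinite) :
    {j | afterHit A s j ∈ A}.Infinite := by
  rw [Set.infinite_iff_exists_gt] at h ⊢
  intro a
  obtain ⟨b, hb, hab⟩ := h (firstHit A s + 1 + a)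
  obtain ⟨k, rfl⟩ := Nat.exists_eq_add_of_le (show firstHit A s + 1 ≤ b by omega)
  exact ⟨k, hb, by omega⟩

lemma nth_mem_eq_hitIdx (q : ℕ) {s : ℕ → E} (h : {j | s j ∈ A}.Infinite) :
    Nat.nth (fun j => s j ∈ A) q = hitIdx A q s := by
  classical
  -- An element of the set is determined by the number of elements before it, so membership and the
  -- count suffice.
  suffices H : s (hitIdx A q s) ∈ A ∧ Nat.count (fun j => s j ∈ A) (hitIdx A q s) = q by
    conv_lhs => rw [← H.2]
    exact Nat.nth_count (p := fun j => s j ∈ A) H.1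
  induction q generalizing s with
  | zero =>
    obtain ⟨m, hm⟩ := h.nonempty
    exact ⟨firstHit_mem ⟨m, hm⟩, (Nat.count_iff_forall_not).2 fun i hi => notMem_of_lt_firstHit hi⟩
  | succ q ih =>
    obtain ⟨m, hm⟩ := h.nonempty
    obtain ⟨h1, h2⟩ := ih (infinite_afterHit h)
    refine ⟨h1, ?_⟩
    have h0 : Nat.count (fun j => s j ∈ A) (firstHit A s) = 0 :=
      (Nat.count_iff_forall_not).2 fun i hi => notMem_of_lt_firstHit hi
    rw [hitIdx, Nat.count_add, Nat.count_succ, h0, if_pos (show s (firstHit A s) ∈ A from firstHit_mem ⟨m, hm⟩)]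
    have h2' : Nat.count (fun j => s (firstHit A s + 1 + j) ∈ A) (hitIdx A q (afterHit A s)) = q := h2
    rw [h2']; ring

lemma cycle_snd (d : E → ℝ) (q : ℕ) (s : ℕ → E) :
    (cycle A d q s).2 = s (hitIdx A q s) := by
  induction q generalizing s with
  | zero => rfl
  | succ q ih => exact ih _

lemma cycle_fst (d : E → ℝ) (q : ℕ) (s : ℕ → E) :
    (cycle A d q s).1 = ∑ i ∈ Finset.Ico (hitStart A q s) (hitIdx A q s), d (s i) := by
  induction q generalizing s with
  | zero =>
    rw [hitStart, hitIdx, Nat.Ico_zero_eq_range]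
    rfl
  | succ q ih =>
    have h : hitStart A (q + 1) s = firstHit A s + 1 + hitStart A q (afterHit A s) := by
      cases q <;> simp only [hitStart, hitIdx, add_assoc, add_zero]
    rw [cycle, ih, h, hitIdx, add_comm _ (hitStart A q _), add_comm _ (hitIdx A q _),
      ← Finset.sum_Ico_add' (fun i => d (s i))]
    exact Finset.sum_congr rfl fun i _ => by rw [afterHit, add_comm i]

variable [MeasurableSpace E] (μ : Measure E) [IsProbabilityMeasure μ]

/-- Prepending an independent term and then shifting is the second projection. -/
lemma measurePreserving_seqShift : MeasurePreserving (fun (s : ℕ → E) i => s (i + 1))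
    (seqLaw μ) (seqLaw μ) := by
  have hm : Measurable (fun (s : ℕ → E) i => s (i + 1)) := by fun_prop
  refine ⟨hm, ?_⟩
  conv_lhs => rw [← (measurePreserving_seqCons μ).map_eq]
  rw [Measure.map_map hm measurable_seqCons]
  exact measurePreserving_snd.map_eq

/-- Each of the countably many shifts of the sequence is again i.i.d. and hence visits `A`. -/
lemma ae_infinite_hits {A : Set E} (hA : MeasurableSet A) (hpos : μ A ≠ 0) :
    ∀ᵐ s ∂(seqLaw μ), {j | s j ∈ A}.Infinite := by
  have h : ∀ k : ℕ, ∀ᵐ s ∂(seqLaw μ), ∃ m, s (m + k) ∈ A := by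
    intro k
    have hk := ((measurePreserving_seqShift μ).iterate k).quasiMeasurePreserving.ae
      (ae_exists_hit μ hA hpos)
    have hit : ∀ (k : ℕ) (s : ℕ → E) (m : ℕ), (fun (s : ℕ → E) i => s (i + 1))^[k] s m = s (m + k) := by
      intro k
      induction k with
      | zero => intro s m; rfl
      | succ k ih =>
        intro s m
        rw [Function.iterate_succ_apply, ih]; rfl
    simpa only [hit] using hk
  filter_upwards [ae_all_iff.2 h] with s hs
  rw [Set.infinite_iff_exists_gt]
  intro a
  obtain ⟨m, hm⟩ := hs (a + 1)
  exact ⟨_, hm, by omega⟩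

end Visits

/-! ### The age along one path -/

/-- If a nonnegative monotone function grows like `α n` along times `r n` growing like `β n`, then
it grows like `α / β`. -/
lemma tendsto_div_of_tendsto_along {r : ℕ → ℝ} (hr : StrictMono r) (hr0 : 0 < r 0) {F : ℝ → ℝ}
    (hF : MonotoneOn F (Set.Ici (r 0))) (hF0 : 0 ≤ F (r 0)) {α β : ℝ} (hβ : 0 < β)
    (hrβ : Tendsto (fun n : ℕ => r n / n) atTop (𝓝 β))
    (hFα : Tendsto (fun n : ℕ => F (r n) / n) atTop (𝓝 α)) :
    Tendsto (fun t => F t / t) atTop (𝓝 (α / β)) := by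
  have hrtop : Tendsto r atTop atTop := by
    refine (hrβ.pos_mul_atTop hβ tendsto_natCast_atTop_atTop).congr' ?_
    filter_upwards [eventually_ge_atTop 1] with n hn
    have : (n : ℝ) ≠ 0 := by positivity
    field_simp
  -- The index of the interval between consecutive `r n` that contains t; its value for t below `r
  -- 0` is irrelevant.
  have hex : ∀ t : ℝ, ∃ n, r 0 ≤ t → r n ≤ t ∧ t < r (n + 1) := by
    intro t
    by_cases ht : r 0 ≤ t
    · have hex : ∃ m, t < r m := (hrtop.eventually (eventually_gt_atTop t)).exists
      classical
      have h0 : Nat.find hex ≠ 0 := fun h => absurd (Nat.find_spec hex) (by rw [h]; exact not_lt.2 ht)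
      obtain ⟨m, hm⟩ := Nat.exists_eq_succ_of_ne_zero h0
      refine ⟨m, fun _ => ⟨?_, ?_⟩⟩
      · exact not_lt.1 (Nat.find_min hex (by omega))
      · have := Nat.find_spec hex
        rwa [hm] at this
    · exact ⟨0, fun h => absurd h ht⟩
  choose M hM using hex
  have hMtop : Tendsto M atTop atTop := by
    refine tendsto_atTop.2 fun m => ?_
    filter_upwards [eventually_ge_atTop (r m)] with t ht
    have := (hM t ((hr.monotone (Nat.zero_le m)).trans ht)).2
    have := hr.lt_iff_lt.1 (ht.trans_lt this)
    omega
  have hpos : ∀ n, 0 < r n := fun n => hr0.trans_le (hr.monotone (Nat.zero_le n))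
  have hmem : ∀ n, r n ∈ Set.Ici (r 0) := fun n => hr.monotone (Nat.zero_le n)
  have hFpos : ∀ n, 0 ≤ F (r n) := fun n => hF0.trans (hF (hmem 0) (hmem n) (hmem n))
  have hratio : Tendsto (fun n : ℕ => (n : ℝ) / (n + 1)) atTop (𝓝 1) :=
    tendsto_natCast_div_add_atTop 1
  have hrβ' := (tendsto_add_atTop_iff_nat 1).2 hrβ
  have hFα' := (tendsto_add_atTop_iff_nat 1).2 hFα
  -- For r n ≤ t < r (n+1), the ratio F t / t lies between F (r n) / r (n+1) and F (r (n+1)) / r n,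
  -- and both bounds tend to α / β.
  have hlow : Tendsto (fun n : ℕ => F (r n) / r (n + 1)) atTop (𝓝 (α / β)) := by
    have h := (hFα.mul hratio).div hrβ' hβ.ne'
    rw [mul_one] at h
    refine h.congr' ?_
    filter_upwards [eventually_ge_atTop 1] with n hn
    have : (n : ℝ) ≠ 0 := by positivity
    have : (n : ℝ) + 1 ≠ 0 := by positivity
    have := (hpos (n + 1)).ne'
    simp only [Pi.div_apply]
    push_cast
    field_simp
  have hupp : Tendsto (fun n : ℕ => F (r (n + 1)) / r n) atTop (𝓝 (α / β)) := by
    have h := (hFα'.div (hratio.mul hrβ) (by simpa using hβ.ne'))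
    rw [one_mul] at h
    refine h.congr' ?_
    filter_upwards [eventually_ge_atTop 1] with n hn
    have : (n : ℝ) ≠ 0 := by positivity
    have : (n : ℝ) + 1 ≠ 0 := by positivity
    have := (hpos n).ne'
    simp only [Pi.div_apply]
    push_cast
    field_simp
  refine tendsto_of_tendsto_of_tendsto_of_le_of_le' (hlow.comp hMtop) (hupp.comp hMtop) ?_ ?_
  · filter_upwards [eventually_ge_atTop (r 0)] with t ht
    obtain ⟨h1, h2⟩ := hM t ht
    exact div_le_div₀ ((hFpos _).trans (hF (hmem _) ht h1)) (hF (hmem _) ht h1)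
      (hr0.trans_le ht) h2.le
  · filter_upwards [eventually_ge_atTop (r 0)] with t ht
    obtain ⟨h1, h2⟩ := hM t ht
    exact div_le_div₀ (hFpos _) (hF ht (hmem _) h2.le) (hpos _) h1

section Path

variable {N K : ℕ} {TD a₀ : ℝ} {τ : Fin N → ℕ → ℝ} {n : Fin N}

/-- The path properties that hold almost surely: all durations are nonnegative, the service times
of device `n` are positive, and it receives infinitely many updates. -/
structure RegularPath (K : ℕ) (TD : ℝ) (τ : Fin N → ℕ → ℝ) (n : Fin N) : Prop where
  duration_nonneg : ∀ j, 0 ≤ duration K TD fun m => τ m j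
  service_pos : ∀ j, 0 < τ n j
  infinite_received : {j | Received K TD τ n j}.Infinite

namespace RegularPath

lemma genTime_succ (j : ℕ) :
    genTime K TD τ (j + 1) = genTime K TD τ j + duration K TD fun m => τ m j :=
  Finset.sum_range_succ _ _

lemma genTime_mono (h : RegularPath K TD τ n) : Monotone (genTime K TD τ) :=
  monotone_nat_of_le_succ fun j => by
    rw [genTime_succ]; linarith [h.duration_nonneg j]

lemma genTime_nonneg (h : RegularPath K TD τ n) (j : ℕ) : 0 ≤ genTime K TD τ j :=
  Finset.sum_nonneg fun i _ => h.duration_nonneg i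

lemma received_recvIdx (h : RegularPath K TD τ n) (q : ℕ) :
    Received K TD τ n (recvIdx K TD τ n q) :=
  Nat.nth_mem_of_infinite h.infinite_received q

lemma recvIdx_strictMono (h : RegularPath K TD τ n) : StrictMono (recvIdx K TD τ n) :=
  Nat.nth_strictMono h.infinite_received

lemma exists_recvIdx_eq {j : ℕ} (hj : Received K TD τ n j) : ∃ q, recvIdx K TD τ n q = j := by
  classical
  exact ⟨_, Nat.nth_count hj⟩

/-- A received update arrives no later than its own termination. Receptions thus occur in the order
of generation, on which all later path computations rest. -/
lemma recvTime_le_genTime (h : RegularPath K TD τ n) (q : ℕ) :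
    recvTime K TD τ n q ≤ genTime K TD τ (recvIdx K TD τ n (q + 1)) := by
  have h1 : τ n (recvIdx K TD τ n q) ≤ duration K TD fun m => τ m (recvIdx K TD τ n q) :=
    h.received_recvIdx q
  calc recvTime K TD τ n q ≤ genTime K TD τ (recvIdx K TD τ n q + 1) := by
        rw [genTime_succ]; unfold recvTime; linarith
    _ ≤ _ := h.genTime_mono (h.recvIdx_strictMono (Nat.lt_succ_self q))

lemma recvTime_strictMono (h : RegularPath K TD τ n) : StrictMono (recvTime K TD τ n) :=
  strictMono_nat_of_lt_succ fun q => (h.recvTime_le_genTime q).trans_lt (by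
    unfold recvTime; linarith [h.service_pos (recvIdx K TD τ n (q + 1))])

lemma recvTime_pos (h : RegularPath K TD τ n) (q : ℕ) : 0 < recvTime K TD τ n q :=
  add_pos_of_nonneg_of_pos (h.genTime_nonneg _) (h.service_pos _)

/-- Generation times increase with the index, so the supremum is attained at the last reception; the
initial value -a₀ ≤ 0 cannot exceed it. -/
lemma latestGen_of_mem_Ico (h : RegularPath K TD τ n) (ha₀ : 0 ≤ a₀) {q : ℕ} {t : ℝ}
    (h1 : recvTime K TD τ n q ≤ t) (h2 : t < recvTime K TD τ n (q + 1)) :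
    latestGen K TD a₀ τ n t = genTime K TD τ (recvIdx K TD τ n q) := by
  refine IsGreatest.csSup_eq ⟨Or.inr ⟨_, h.received_recvIdx q, h1, rfl⟩, ?_⟩
  rintro g (rfl | ⟨j, hj, hjt, rfl⟩)
  · linarith [h.genTime_nonneg (recvIdx K TD τ n q)]
  · obtain ⟨q', rfl⟩ := exists_recvIdx_eq hj
    have : q' < q + 1 := h.recvTime_strictMono.lt_iff_lt.1 (lt_of_le_of_lt hjt h2)
    exact h.genTime_mono (h.recvIdx_strictMono.monotone (by omega))

lemma latestGen_of_lt (h : RegularPath K TD τ n) {t : ℝ} (ht : t < recvTime K TD τ n 0) :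
    latestGen K TD a₀ τ n t = -a₀ := by
  refine IsGreatest.csSup_eq ⟨Or.inl rfl, ?_⟩
  rintro g (rfl | ⟨j, hj, hjt, rfl⟩)
  · exact le_rfl
  · obtain ⟨q', rfl⟩ := exists_recvIdx_eq hj
    have : q' < 0 := h.recvTime_strictMono.lt_iff_lt.1 (lt_of_le_of_lt hjt ht)
    omega

lemma bddAbove_latestGen (h : RegularPath K TD τ n) (t : ℝ) : BddAbove (insert (-a₀)
    {g : ℝ | ∃ j : ℕ, Received K TD τ n j ∧ genTime K TD τ j + τ n j ≤ t ∧
      g = genTime K TD τ j}) := by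
  refine ⟨max (-a₀) t, ?_⟩
  rintro g (rfl | ⟨j, -, hjt, rfl⟩)
  · exact le_max_left _ _
  · exact le_max_of_le_right (by linarith [h.service_pos j])

lemma latestGen_mono (h : RegularPath K TD τ n) : Monotone (latestGen K TD a₀ τ n) := by
  intro t t' htt'
  refine csSup_le_csSup (h.bddAbove_latestGen t') (Set.insert_nonempty _ _) ?_
  refine Set.insert_subset_insert ?_
  rintro g ⟨j, hj, hjt, hg⟩
  exact ⟨j, hj, hjt.trans htt', hg⟩

/-- The age is the identity minus a monotone function, so no piecewise description is needed. -/
lemma intervalIntegrable_age (h : RegularPath K TD τ n) (t t' : ℝ) :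
    IntervalIntegrable (age K TD a₀ τ n) volume t t' :=
  (continuous_id.intervalIntegrable t t').sub h.latestGen_mono.intervalIntegrable

lemma age_nonneg (h : RegularPath K TD τ n) (ha₀ : 0 ≤ a₀) {t : ℝ} (ht : 0 ≤ t) :
    0 ≤ age K TD a₀ τ n t := by
  refine sub_nonneg.2 (csSup_le (Set.insert_nonempty _ _) ?_)
  rintro g (rfl | ⟨j, -, hjt, rfl⟩)
  · linarith
  · linarith [h.service_pos j]

/-- Between receptions the age grows with slope one, starting from the service time of the last
received update: the area of a trapezoid. -/
lemma integral_age_recvTime (h : RegularPath K TD τ n) (ha₀ : 0 ≤ a₀) (q : ℕ) :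
    ∫ t in (recvTime K TD τ n q)..(recvTime K TD τ n (q + 1)), age K TD a₀ τ n t
      = ((recvTime K TD τ n (q + 1) - genTime K TD τ (recvIdx K TD τ n q)) ^ 2
        - τ n (recvIdx K TD τ n q) ^ 2) / 2 := by
  have hle := (h.recvTime_strictMono (Nat.lt_succ_self q)).le
  have hcongr : ∫ t in (recvTime K TD τ n q)..(recvTime K TD τ n (q + 1)), age K TD a₀ τ n t
      = ∫ t in (recvTime K TD τ n q)..(recvTime K TD τ n (q + 1)),
        (t - genTime K TD τ (recvIdx K TD τ n q)) := by
    -- The right endpoint is discarded because the age has already dropped there.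
    rw [intervalIntegral.integral_of_le hle, intervalIntegral.integral_of_le hle,
      integral_Ioc_eq_integral_Ioo, integral_Ioc_eq_integral_Ioo]
    refine setIntegral_congr_fun measurableSet_Ioo fun t ht => ?_
    rw [age, h.latestGen_of_mem_Ico ha₀ ht.1.le ht.2]
  rw [hcongr, intervalIntegral.integral_comp_sub_right (fun t => t), integral_id]
  congr 3
  simp [recvTime]

lemma tendsto_age_left_succ (h : RegularPath K TD τ n) (ha₀ : 0 ≤ a₀) (q : ℕ) :
    Tendsto (age K TD a₀ τ n) (𝓝[<] (recvTime K TD τ n (q + 1)))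
      (𝓝 (recvTime K TD τ n (q + 1) - genTime K TD τ (recvIdx K TD τ n q))) := by
  have hc : Tendsto (fun t => t - genTime K TD τ (recvIdx K TD τ n q))
      (𝓝[<] (recvTime K TD τ n (q + 1)))
      (𝓝 (recvTime K TD τ n (q + 1) - genTime K TD τ (recvIdx K TD τ n q))) :=
    ((continuous_id.sub continuous_const).tendsto _).mono_left nhdsWithin_le_nhds
  refine hc.congr' ?_
  filter_upwards [Ioo_mem_nhdsLT (h.recvTime_strictMono (Nat.lt_succ_self q))] with t ht
  rw [age, h.latestGen_of_mem_Ico ha₀ ht.1.le ht.2]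

lemma tendsto_age_left_zero (h : RegularPath K TD τ n) :
    Tendsto (age K TD a₀ τ n) (𝓝[<] (recvTime K TD τ n 0)) (𝓝 (recvTime K TD τ n 0 + a₀)) := by
  have hc : Tendsto (fun t => t + a₀) (𝓝[<] (recvTime K TD τ n 0)) (𝓝 (recvTime K TD τ n 0 + a₀)) :=
    ((continuous_id.add continuous_const).tendsto _).mono_left nhdsWithin_le_nhds
  refine hc.congr' ?_
  filter_upwards [self_mem_nhdsWithin] with t ht
  rw [age, h.latestGen_of_lt ht, sub_neg_eq_add]

lemma peakAge_succ (h : RegularPath K TD τ n) (ha₀ : 0 ≤ a₀) (q : ℕ) :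
    peakAge K TD a₀ τ n (q + 1)
      = recvTime K TD τ n (q + 1) - genTime K TD τ (recvIdx K TD τ n q) :=
  leftLim_eq_of_tendsto (h.tendsto_age_left_succ ha₀ q)

lemma tendsto_age_peakAge (h : RegularPath K TD τ n) (ha₀ : 0 ≤ a₀) (q : ℕ) :
    Tendsto (age K TD a₀ τ n) (𝓝[<] (recvTime K TD τ n q)) (𝓝 (peakAge K TD a₀ τ n q)) := by
  cases q with
  | zero =>
    rw [peakAge, leftLim_eq_of_tendsto h.tendsto_age_left_zero]
    exact h.tendsto_age_left_zero
  | succ q =>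
    rw [h.peakAge_succ ha₀]
    exact h.tendsto_age_left_succ ha₀ q

/-- Consecutive receptions are separated by `X^S` and `W`. -/
lemma genTime_recvIdx_succ (h : RegularPath K TD τ n) (q : ℕ) :
    genTime K TD τ (recvIdx K TD τ n (q + 1)) = genTime K TD τ (recvIdx K TD τ n q)
      + (succInter K TD τ n q + failSum K TD τ n (q + 1)) := by
  have hle : recvIdx K TD τ n q + 1 ≤ recvIdx K TD τ n (q + 1) :=
    h.recvIdx_strictMono (Nat.lt_succ_self q)
  have : failSum K TD τ n (q + 1) = genTime K TD τ (recvIdx K TD τ n (q + 1))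
      - genTime K TD τ (recvIdx K TD τ n q + 1) :=
    Finset.sum_Ico_sub (genTime K TD τ) hle
  rw [this, succInter]; ring

lemma recvTime_succ_sub (h : RegularPath K TD τ n) (q : ℕ) :
    recvTime K TD τ n (q + 1) - genTime K TD τ (recvIdx K TD τ n q)
      = succInter K TD τ n q + failSum K TD τ n (q + 1) + succService K TD τ n (q + 1) := by
  rw [recvTime, h.genTime_recvIdx_succ, succService]; ring

/-- Here β is the mean spacing of receptions and α the mean area per spacing. Service times of
received updates lie in (0, TD], so every boundary term is bounded and disappears after division by
Q. -/
lemma tendsto_average_age (h : RegularPath K TD τ n) (ha₀ : 0 ≤ a₀) {α β : ℝ} (hβ : 0 < β)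
    (hY : Tendsto (fun Q : ℕ => (∑ q ∈ Finset.range Q,
      (succInter K TD τ n q + failSum K TD τ n (q + 1))) / (Q : ℝ)) atTop (𝓝 β))
    (hS : Tendsto (fun Q : ℕ => (∑ q ∈ Finset.range Q,
      ((succInter K TD τ n q + failSum K TD τ n (q + 1)) ^ 2 / 2
        + (succInter K TD τ n q + failSum K TD τ n (q + 1)) * succService K TD τ n (q + 1))) / (Q : ℝ))
      atTop (𝓝 α)) :
    Tendsto (fun t : ℝ => 1 / t * ∫ s in (0 : ℝ)..t, age K TD a₀ τ n s) atTop (𝓝 (α / β)) := by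
  set g : ℕ → ℝ := fun q => genTime K TD τ (recvIdx K TD τ n q) with hg
  set Y : ℕ → ℝ := fun q => succInter K TD τ n q + failSum K TD τ n (q + 1) with hYdef
  set S : ℕ → ℝ := succService K TD τ n with hSdef
  have hSpos : ∀ q, 0 ≤ S q := fun q => (h.service_pos _).le
  have hSle : ∀ q, S q ≤ TD := fun q => (h.received_recvIdx q).trans (min_le_left _ _)
  have hgsum : ∀ Q, g Q = g 0 + ∑ q ∈ Finset.range Q, Y q := by
    intro Q
    induction Q with
    | zero => simp
    | succ Q ih => rw [Finset.sum_range_succ, ← add_assoc, ← ih]; exact h.genTime_recvIdx_succ Q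
  have hr : ∀ Q, recvTime K TD τ n Q = g Q + S Q := fun Q => rfl
  have hzero : ∀ (u : ℕ → ℝ) (C : ℝ), (∀ Q, |u Q| ≤ C) →
      Tendsto (fun Q : ℕ => u Q / Q) atTop (𝓝 0) := fun u C hu =>
    tendsto_bdd_div_atTop_nhds_zero (b := -C) (B := C) (Eventually.of_forall fun Q => (abs_le.1 (hu Q)).1)
      (Eventually.of_forall fun Q => (abs_le.1 (hu Q)).2) tendsto_natCast_atTop_atTop
  -- The trapezoid (Y + S')²/2 - S²/2 equals Y²/2 + Y S' plus (S'² - S²)/2, and the last part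
  -- telescopes.
  have hint : ∀ Q, ∫ s in (0 : ℝ)..(recvTime K TD τ n Q), age K TD a₀ τ n s
      = (∫ s in (0 : ℝ)..(recvTime K TD τ n 0), age K TD a₀ τ n s)
        + ∑ q ∈ Finset.range Q, (Y q ^ 2 / 2 + Y q * S (q + 1)) + (S Q ^ 2 - S 0 ^ 2) / 2 := by
    intro Q
    induction Q with
    | zero => simp
    | succ Q ih =>
      rw [← intervalIntegral.integral_add_adjacent_intervals (h.intervalIntegrable_age 0 _)
        (h.intervalIntegrable_age (recvTime K TD τ n Q) _), ih, h.integral_age_recvTime ha₀,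
        h.recvTime_succ_sub, Finset.sum_range_succ]
      simp only [hYdef, hSdef, succService]
      ring
  have hF0 : 0 ≤ ∫ s in (0 : ℝ)..(recvTime K TD τ n 0), age K TD a₀ τ n s :=
    intervalIntegral.integral_nonneg (h.recvTime_pos 0).le fun t ht => h.age_nonneg ha₀ ht.1
  simp only [one_div_mul_eq_div]
  refine tendsto_div_of_tendsto_along h.recvTime_strictMono (h.recvTime_pos 0) ?_ hF0 hβ ?_ ?_
  · intro t ht t' ht' htt'
    have h0t : 0 ≤ t := (h.recvTime_pos 0).le.trans ht
    dsimp only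
    rw [← intervalIntegral.integral_add_adjacent_intervals (h.intervalIntegrable_age 0 t)
        (h.intervalIntegrable_age t t')]
    have : 0 ≤ ∫ s in t..t', age K TD a₀ τ n s :=
      intervalIntegral.integral_nonneg htt' fun s hs => h.age_nonneg ha₀ (h0t.trans hs.1)
    linarith
  · have h1 := (hzero (fun Q => g 0 + S Q) (|g 0| + TD) fun Q =>
      (abs_add_le _ _).trans (by rw [abs_of_nonneg (hSpos Q)]; linarith [hSle Q])).add hY
    rw [zero_add] at h1
    refine h1.congr fun Q => ?_
    rw [hr, hgsum Q, ← add_div]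
    congr 1; ring
  · have h1 := (hzero (fun Q => (∫ s in (0 : ℝ)..(recvTime K TD τ n 0), age K TD a₀ τ n s)
        + (S Q ^ 2 - S 0 ^ 2) / 2)
      (|∫ s in (0 : ℝ)..(recvTime K TD τ n 0), age K TD a₀ τ n s| + TD ^ 2) fun Q => by
        refine (abs_add_le _ _).trans (add_le_add le_rfl ?_)
        have h2 : S Q ^ 2 ≤ TD ^ 2 := pow_le_pow_left₀ (hSpos Q) (hSle Q) 2
        have h3 : S 0 ^ 2 ≤ TD ^ 2 := pow_le_pow_left₀ (hSpos 0) (hSle 0) 2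
        rw [abs_le]
        constructor <;> nlinarith [sq_nonneg (S Q), sq_nonneg (S 0)]).add hS
    rw [zero_add] at h1
    refine h1.congr fun Q => ?_
    rw [hint Q, ← add_div]
    congr 1; ring

end RegularPath

end Path

/-! ### Order statistics of finitely many reals -/

section OrdStat

variable {N K : ℕ}

/-- Lowering an admissible t to the largest sample value not exceeding it keeps the count, so the
infimum is a minimum over finitely many sample values. -/
lemma isLeast_ordStat (hK : 1 ≤ K) (hKN : K ≤ N) (x : Fin N → ℝ) :
    IsLeast {t : ℝ | K ≤ (Finset.univ.filter (fun i => x i ≤ t)).card} (ordStat K x) ∧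
      ∃ i, x i = ordStat K x := by
  classical
  set S := {t : ℝ | K ≤ (Finset.univ.filter (fun i => x i ≤ t)).card} with hS
  have hdown : ∀ t ∈ S, ∃ i, x i ≤ t ∧ x i ∈ S := by
    intro t ht
    have hne : (Finset.univ.filter (fun i => x i ≤ t)).Nonempty := by
      rw [← Finset.card_pos]; exact lt_of_lt_of_le hK ht
    obtain ⟨i, hi, hmax⟩ := Finset.exists_max_image _ x hne
    refine ⟨i, (Finset.mem_filter.1 hi).2, le_trans (b := _) ht (Finset.card_le_card fun j hj => ?_)⟩
    exact Finset.mem_filter.2 ⟨Finset.mem_univ _, hmax j hj⟩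
  have hNpos : 0 < N := by omega
  have hne : (Finset.univ.filter fun i => x i ∈ S).Nonempty := by
    obtain ⟨i, -, hmax⟩ := Finset.exists_max_image Finset.univ x ⟨⟨0, hNpos⟩, Finset.mem_univ _⟩
    refine ⟨i, Finset.mem_filter.2 ⟨Finset.mem_univ _, ?_⟩⟩
    have : (Finset.univ.filter fun j => x j ≤ x i) = Finset.univ :=
      Finset.filter_true_of_mem hmax
    simpa [hS, this] using hKN
  obtain ⟨i, hi, hmin⟩ := Finset.exists_min_image _ x hne
  have hleast : IsLeast S (x i) := by
    refine ⟨(Finset.mem_filter.1 hi).2, fun t ht => ?_⟩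
    obtain ⟨j, hjt, hj⟩ := hdown t ht
    exact (hmin j (Finset.mem_filter.2 ⟨Finset.mem_univ _, hj⟩)).trans hjt
  have heq : ordStat K x = x i := hleast.csInf_eq
  exact ⟨heq ▸ hleast, i, heq.symm⟩

lemma ordStat_le_iff (hK : 1 ≤ K) (hKN : K ≤ N) (x : Fin N → ℝ) (t : ℝ) :
    ordStat K x ≤ t ↔ K ≤ (Finset.univ.filter (fun i => x i ≤ t)).card := by
  have h := (isLeast_ordStat hK hKN x).1
  refine ⟨fun ht => le_trans (b := _) h.1 (Finset.card_le_card fun j hj => ?_), fun ht => h.2 ht⟩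
  exact Finset.mem_filter.2 ⟨Finset.mem_univ _, (Finset.mem_filter.1 hj).2.trans ht⟩

lemma ordStat_comp_equiv (K : ℕ) (x : Fin N → ℝ) (σ : Equiv.Perm (Fin N)) :
    ordStat K (fun i => x (σ i)) = ordStat K x := by
  unfold ordStat
  congr 1
  ext t
  have : (Finset.univ.filter (fun i => x (σ i) ≤ t)).card
      = (Finset.univ.filter (fun i => x i ≤ t)).card :=
    Finset.card_equiv σ fun i => by simp
  simp [this]

/-- The number of other coordinates that do not exceed the `n`-th one. -/
def numBelow (x : Fin N → ℝ) (n : Fin N) : ℕ :=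
  (Finset.univ.filter fun j => j ≠ n ∧ x j ≤ x n).card

lemma card_le_eq_numBelow_add_one (x : Fin N → ℝ) (n : Fin N) :
    (Finset.univ.filter fun j => x j ≤ x n).card = numBelow x n + 1 := by
  have : (Finset.univ.filter fun j => x j ≤ x n)
      = insert n (Finset.univ.filter fun j => j ≠ n ∧ x j ≤ x n) := by
    ext j
    by_cases hj : j = n <;> simp [hj]
  rw [this, Finset.card_insert_of_notMem (by simp)]
  rfl

lemma numBelow_lt (x : Fin N → ℝ) (n : Fin N) : numBelow x n < N := by
  have := card_le_eq_numBelow_add_one x n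
  have h2 := Finset.card_le_univ (Finset.univ.filter fun j => x j ≤ x n)
  rw [Fintype.card_fin] at h2
  omega

/-- Without ties, "not exceeding" and "strictly below" agree for the other coordinates. Being beyond
the K-th smallest then means that at least K coordinates lie strictly below. -/
lemma le_ordStat_iff (hK : 1 ≤ K) (hKN : K ≤ N) {x : Fin N → ℝ} (hx : Function.Injective x)
    (n : Fin N) : x n ≤ ordStat K x ↔ numBelow x n < K := by
  obtain ⟨hl, i, hi⟩ := isLeast_ordStat hK hKN x
  have hbelow : ∀ j, (j ≠ n ∧ x j ≤ x n) ↔ x j < x n := fun j =>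
    ⟨fun h => lt_of_le_of_ne h.2 fun he => h.1 (hx he), fun h => ⟨fun he => by simp [he] at h, h.le⟩⟩
  rw [← not_iff_not, not_le, not_lt]
  simp only [numBelow, hbelow]
  constructor
  · intro h
    refine le_trans (b := _) hl.1 (Finset.card_le_card fun j hj => ?_)
    exact Finset.mem_filter.2 ⟨Finset.mem_univ _, (Finset.mem_filter.1 hj).2.trans_lt h⟩
  · intro h
    have hne : (Finset.univ.filter (fun i => x i < x n)).Nonempty := by
      rw [← Finset.card_pos]; exact lt_of_lt_of_le hK h
    obtain ⟨k, hk, hmax⟩ := Finset.exists_max_image _ x hne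
    refine lt_of_le_of_lt ((ordStat_le_iff hK hKN x (x k)).2 (h.trans ?_)) (Finset.mem_filter.1 hk).2
    exact Finset.card_le_card fun j hj => Finset.mem_filter.2 ⟨Finset.mem_univ _, hmax j hj⟩

/-- `numBelow` omits the coordinate itself, so rank K corresponds to the value K - 1. -/
lemma eq_ordStat_iff (hK : 1 ≤ K) (hKN : K ≤ N) {x : Fin N → ℝ} (hx : Function.Injective x)
    (n : Fin N) : x n = ordStat K x ↔ numBelow x n = K - 1 := by
  rw [le_antisymm_iff, le_ordStat_iff hK hKN hx, ordStat_le_iff hK hKN,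
    card_le_eq_numBelow_add_one]
  omega

lemma card_le_ordStat (hK : 1 ≤ K) (hKN : K ≤ N) {x : Fin N → ℝ} (hx : Function.Injective x) :
    (Finset.univ.filter fun i => x i ≤ ordStat K x).card = K := by
  obtain ⟨-, i, hi⟩ := isLeast_ordStat hK hKN x
  have h := (eq_ordStat_iff hK hKN hx i).1 hi
  rw [← hi, card_le_eq_numBelow_add_one, h]
  omega

lemma measurable_card_filter {α ι : Type*} [MeasurableSpace α] [Fintype ι] {p : ι → α → Prop}
    [∀ a, DecidablePred fun i => p i a] (hp : ∀ i, MeasurableSet {a | p i a}) :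
    Measurable fun a => (Finset.univ.filter fun i => p i a).card := by
  simp only [Finset.card_filter]
  exact Finset.measurable_sum _ fun i _ => by
    classical
    convert Measurable.ite (hp i) measurable_const measurable_const

lemma measurable_numBelow (n : Fin N) : Measurable fun x : Fin N → ℝ => numBelow x n :=
  measurable_card_filter fun j => (MeasurableSet.const _).inter
    (measurableSet_le (measurable_pi_apply j) (measurable_pi_apply n))

lemma measurable_ordStat (hK : 1 ≤ K) (hKN : K ≤ N) :
    Measurable (ordStat K : (Fin N → ℝ) → ℝ) := by
  refine measurable_of_Iic fun t => ?_
  have : (ordStat K : (Fin N → ℝ) → ℝ) ⁻¹' Set.Iic t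
      = {x | K ≤ (Finset.univ.filter (fun i => x i ≤ t)).card} := by
    ext x; exact ordStat_le_iff hK hKN x t
  rw [this]
  exact measurableSet_le measurable_const (measurable_card_filter fun i =>
    measurableSet_le (measurable_pi_apply i) measurable_const)

lemma measurable_duration (hK : 1 ≤ K) (hKN : K ≤ N) (TD : ℝ) :
    Measurable (duration K TD : (Fin N → ℝ) → ℝ) :=
  measurable_const.min (measurable_ordStat hK hKN)

end OrdStat

/-! ### Order statistics of an i.i.d. sample without ties -/

section Sample

variable (ρ : Measure ℝ) [IsProbabilityMeasure ρ]

/-- The law of an i.i.d. sample of size `N`. -/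
abbrev sampleLaw (N : ℕ) : Measure (Fin N → ℝ) := Measure.pi fun _ => ρ

/-- The binomial law: partition according to the set of indices whose coordinate falls in `S`; each
part is a product set. -/
lemma sampleLaw_card_mem (M k : ℕ) {S : Set ℝ} (hS : MeasurableSet S) [DecidablePred (· ∈ S)] :
    (sampleLaw ρ M).real {y | (Finset.univ.filter fun j => y j ∈ S).card = k}
      = M.choose k * ρ.real S ^ k * (1 - ρ.real S) ^ (M - k) := by
  classical
  let box : Finset (Fin M) → Set (Fin M → ℝ) := fun A => Set.univ.pi fun j => if j ∈ A then S else Sᶜ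
  have hbox : ∀ A y, y ∈ box A ↔ (Finset.univ.filter fun j => y j ∈ S) = A := by
    intro A y
    simp only [box, Set.mem_univ_pi, Finset.ext_iff, Finset.mem_filter, Finset.mem_univ, true_and]
    refine forall_congr' fun j => ?_
    by_cases hj : j ∈ A <;> simp [hj]
  have hm : ∀ A, MeasurableSet (box A) := fun A =>
    MeasurableSet.univ_pi fun j => by split_ifs; exacts [hS, hS.compl]
  have hset : {y : Fin M → ℝ | (Finset.univ.filter fun j => y j ∈ S).card = k}
      = ⋃ A ∈ Finset.univ.powersetCard k, box A := by
    ext y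
    simp only [Set.mem_iUnion, hbox, Finset.mem_powersetCard, Finset.subset_univ, true_and,
      Set.mem_ofPred_eq, exists_prop, exists_eq_right']
  rw [hset, measureReal_biUnion_finset]
  · have hval : ∀ A ∈ (Finset.univ : Finset (Fin M)).powersetCard k, (sampleLaw ρ M).real (box A)
        = ρ.real S ^ k * (1 - ρ.real S) ^ (M - k) := by
      intro A hA
      have hc := (Finset.mem_powersetCard.1 hA).2
      rw [measureReal_def, Measure.pi_pi, ENNReal.toReal_prod]
      have : ∀ j, (ρ (if j ∈ A then S else Sᶜ)).toReal
          = if j ∈ A then ρ.real S else 1 - ρ.real S := by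
        intro j
        split_ifs
        · rfl
        · rw [← probReal_compl_eq_one_sub hS]; rfl
      simp only [this]
      rw [Finset.prod_ite, Finset.prod_const, Finset.prod_const]
      simp only [Finset.filter_mem_eq_inter, Finset.univ_inter, hc]
      rw [Finset.filter_not, Finset.filter_mem_eq_inter, Finset.univ_inter,
        Finset.card_sdiff_of_subset (Finset.subset_univ A), hc, Finset.card_univ, Fintype.card_fin]
    rw [Finset.sum_congr rfl hval, Finset.sum_const, Finset.card_powersetCard, Finset.card_univ,
      Fintype.card_fin, nsmul_eq_mul, mul_assoc]
  · intro A _ B _ hAB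
    refine Set.disjoint_left.2 fun y hA hB => hAB ?_
    rw [← (hbox A y).1 hA, ← (hbox B y).1 hB]
  · exact fun A _ => hm A

/-- Given that coordinate `n` equals t, the other N - 1 coordinates are still i.i.d., and the number
of them not exceeding t is binomial. -/
lemma integral_numBelow (N k : ℕ) (n : Fin N) {φ : ℝ → ℝ} (hφ : Measurable φ) {C : ℝ}
    (hC : ∀ t, |φ t| ≤ C) :
    ∫ x, (if numBelow x n = k then φ (x n) else 0) ∂(sampleLaw ρ N)
      = ∫ t, φ t * ((N - 1).choose k * ρ.real (Set.Iic t) ^ k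
        * (1 - ρ.real (Set.Iic t)) ^ (N - 1 - k)) ∂ρ := by
  classical
  obtain ⟨M, rfl⟩ : ∃ M, N = M + 1 := ⟨N - 1, by have := n.pos; omega⟩
  have hmp := measurePreserving_piFinSuccAbove (fun _ : Fin (M + 1) => ρ) n
  have hcount : ∀ x : Fin (M + 1) → ℝ, numBelow x n
      = (Finset.univ.filter fun j : Fin M => x (n.succAbove j) ∈ Set.Iic (x n)).card := by
    intro x
    rw [numBelow, ← Finset.card_map (Fin.succAboveEmb n)]
    congr 1
    ext j
    simp only [Finset.mem_filter, Finset.mem_univ, true_and, Finset.mem_map, Set.mem_Iic,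
      Fin.coe_succAboveEmb]
    constructor
    · rintro ⟨h1, h2⟩
      obtain ⟨k, rfl⟩ := Fin.exists_succAbove_eq h1
      exact ⟨k, h2, rfl⟩
    · rintro ⟨k, hk, rfl⟩
      exact ⟨Fin.succAbove_ne n k, hk⟩
  let H : ℝ × (Fin M → ℝ) → ℝ := fun p =>
    if (Finset.univ.filter fun j => p.2 j ∈ Set.Iic p.1).card = k then φ p.1 else 0
  have hms : MeasurableSet {p : ℝ × (Fin M → ℝ) |
      (Finset.univ.filter fun j => p.2 j ∈ Set.Iic p.1).card = k} :=
    measurable_card_filter (p := fun j (p : ℝ × (Fin M → ℝ)) => p.2 j ∈ Set.Iic p.1)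
      (fun j => measurableSet_le ((measurable_pi_apply j).comp measurable_snd) measurable_fst)
      (measurableSet_singleton k)
  have hH : Measurable H := Measurable.ite hms (hφ.comp measurable_fst) measurable_const
  have hHi : Integrable H (ρ.prod (sampleLaw ρ M)) :=
    Integrable.of_bound hH.aestronglyMeasurable C (Eventually.of_forall fun p => by
      simp only [H]
      split_ifs
      · exact hC _
      · simpa using (abs_nonneg _).trans (hC 0))
  have h1 : ∫ x, (if numBelow x n = k then φ (x n) else 0) ∂(sampleLaw ρ (M + 1))
      = ∫ p, H p ∂(ρ.prod (sampleLaw ρ M)) := by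
    rw [← hmp.integral_comp (MeasurableEquiv.measurableEmbedding _)]
    refine integral_congr_ae (Eventually.of_forall fun x => ?_)
    simp only [hcount]
    rfl
  rw [h1, integral_prod _ hHi]
  refine integral_congr_ae (Eventually.of_forall fun t => ?_)
  have h2 : ∀ y : Fin M → ℝ, H (t, y) = Set.indicator
      {y : Fin M → ℝ | (Finset.univ.filter fun j => y j ∈ Set.Iic t).card = k} (fun _ => φ t) y := by
    intro y
    simp only [H, Set.indicator, Set.mem_ofPred_eq]
  have h3 : MeasurableSet {y : Fin M → ℝ | (Finset.univ.filter fun j => y j ∈ Set.Iic t).card = k} :=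
    (measurable_prodMk_left (x := t)) hms
  dsimp only
  simp only [h2]
  rw [integral_indicator_const _ h3, sampleLaw_card_mem ρ M k measurableSet_Iic, smul_eq_mul, mul_comm,
    Nat.add_sub_cancel]

variable {ρ}

/-- By Fubini the diagonal is null for the square of an atomless law. -/
lemma ae_injective_sampleLaw [NullSingletonClass ρ] (N : ℕ) :
    ∀ᵐ x ∂(sampleLaw ρ N), Function.Injective x := by
  have hpair : ∀ i j : Fin N, ∀ᵐ x ∂(sampleLaw ρ N), i ≠ j → x i ≠ x j := by
    intro i j
    by_cases hij : i = j
    · exact Eventually.of_forall fun _ h => absurd hij h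
    have hmap : (sampleLaw ρ N).map (fun x => (x i, x j)) = ρ.prod ρ := by
      rw [sampleLaw, ← Measure.infinitePi_eq_pi]
      exact Measure.infinitePi_map_eval_prod (P := fun _ : Fin N => ρ) hij
    have hdiag : ∀ᵐ p ∂(ρ.prod ρ), p.1 ≠ p.2 := by
      rw [ae_iff]
      simp only [ne_eq, not_not]
      rw [Measure.measure_prod_null (measurableSet_eq_fun measurable_fst measurable_snd)]
      refine Eventually.of_forall fun t => ?_
      have : Prod.mk t ⁻¹' {a : ℝ × ℝ | a.1 = a.2} = {t} := by ext; simp [eq_comm]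
      simp [this]
    rw [← hmap] at hdiag
    filter_upwards [ae_of_ae_map (by fun_prop) hdiag] with x hx _ using hx
  filter_upwards [ae_all_iff.2 fun i => ae_all_iff.2 (hpair i)] with x hx i j hij
  by_contra hne
  exact hx i j hne hij

lemma ae_sampleLaw_forall (N : ℕ) {S : Set ℝ} (hS : ∀ᵐ t ∂ρ, t ∈ S) :
    ∀ᵐ x ∂(sampleLaw ρ N), ∀ i, x i ∈ S :=
  ae_all_iff.2 fun i => (measurePreserving_eval (fun _ : Fin N => ρ) i).quasiMeasurePreserving.ae hS

/-- Transposing the two coordinates preserves the product law; `hg` expresses that `g` commutes with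
relabelling. -/
lemma integral_sampleLaw_exchange {N : ℕ} (n m : Fin N) (g : (Fin N → ℝ) → Fin N → ℝ)
    (hg : ∀ (x : Fin N → ℝ) (σ : Equiv.Perm (Fin N)) i, g (fun i => x (σ i)) i = g x (σ i)) :
    ∫ x, g x n ∂(sampleLaw ρ N) = ∫ x, g x m ∂(sampleLaw ρ N) := by
  have hmp := measurePreserving_piCongrLeft (fun _ : Fin N => ρ) (Equiv.swap n m)
  rw [← hmp.integral_comp (MeasurableEquiv.measurableEmbedding _)]
  refine integral_congr_ae (Eventually.of_forall fun x => ?_)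
  have : MeasurableEquiv.piCongrLeft (fun _ : Fin N => ℝ) (Equiv.swap n m) x
      = fun i => x ((Equiv.swap n m) i) := by
    funext i
    have h := Equiv.piCongrLeft_apply_apply (fun _ : Fin N => ℝ) (Equiv.swap n m) x
      (Equiv.swap n m i)
    rwa [Equiv.swap_apply_self] at h
  dsimp only
  rw [this, hg, Equiv.swap_apply_left]

variable [NullSingletonClass ρ] {N K : ℕ}

/-- Almost surely exactly one coordinate has rank K, and by symmetry all N coordinates contribute
equally. -/
lemma integral_comp_ordStat (hK : 1 ≤ K) (hKN : K ≤ N) (n : Fin N) {φ : ℝ → ℝ} (hφ : Measurable φ)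
    {C : ℝ} (hC : ∀ t, |φ t| ≤ C) :
    ∫ x, φ (ordStat K x) ∂(sampleLaw ρ N)
      = N * ∫ x, (if numBelow x n = K - 1 then φ (x n) else 0) ∂(sampleLaw ρ N) := by
  have hint : ∀ m : Fin N, Integrable (fun x => if numBelow x m = K - 1 then φ (x m) else 0)
      (sampleLaw ρ N) := fun m =>
    Integrable.of_bound (Measurable.ite (measurable_numBelow m (measurableSet_singleton _))
      (hφ.comp (measurable_pi_apply m)) measurable_const).aestronglyMeasurable C
      (Eventually.of_forall fun x => by
        split_ifs
        · exact hC _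
        · simpa using (abs_nonneg _).trans (hC 0))
  have hnb : ∀ (x : Fin N → ℝ) (σ : Equiv.Perm (Fin N)) i,
      numBelow (fun i => x (σ i)) i = numBelow x (σ i) := fun x σ i =>
    Finset.card_equiv σ fun j => by simp
  have hsum : ∫ x, φ (ordStat K x) ∂(sampleLaw ρ N)
      = ∫ x, ∑ m, (if numBelow x m = K - 1 then φ (x m) else 0) ∂(sampleLaw ρ N) := by
    refine integral_congr_ae ?_
    filter_upwards [ae_injective_sampleLaw (ρ := ρ) N] with x hx
    obtain ⟨-, i, hi⟩ := isLeast_ordStat hK hKN x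
    simp only [← eq_ordStat_iff hK hKN hx]
    rw [Finset.sum_eq_single i, if_pos hi, hi]
    · intro j _ hj
      rw [if_neg]
      exact fun h => hj (hx (h.trans hi.symm))
    · simp
  rw [hsum, integral_finsetSum _ fun m _ => hint m,
    Finset.sum_congr rfl fun m _ => integral_sampleLaw_exchange m n
      (fun x i => if numBelow x i = K - 1 then φ (x i) else 0) fun x σ i => by simp only [hnb]]
  simp

/-- Split according to the rank h of coordinate `n`, which must be at most K. -/
lemma integral_le_ordStat (hK : 1 ≤ K) (hKN : K ≤ N) (n : Fin N) {φ : ℝ → ℝ} (hφ : Measurable φ)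
    {C : ℝ} (hC : ∀ t, |φ t| ≤ C) :
    ∫ x, (if x n ≤ ordStat K x then φ (x n) else 0) ∂(sampleLaw ρ N)
      = ∑ h ∈ Finset.Icc 1 K,
        ∫ x, (if numBelow x n = h - 1 then φ (x n) else 0) ∂(sampleLaw ρ N) := by
  have hint : ∀ h : ℕ, Integrable (fun x => if numBelow x n = h - 1 then φ (x n) else 0)
      (sampleLaw ρ N) := fun h =>
    Integrable.of_bound (Measurable.ite (measurable_numBelow n (measurableSet_singleton _))
      (hφ.comp (measurable_pi_apply n)) measurable_const).aestronglyMeasurable C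
      (Eventually.of_forall fun x => by
        split_ifs
        · exact hC _
        · simpa using (abs_nonneg _).trans (hC 0))
  rw [← integral_finsetSum _ fun h _ => hint h]
  refine integral_congr_ae ?_
  filter_upwards [ae_injective_sampleLaw (ρ := ρ) N] with x hx
  simp only [le_ordStat_iff hK hKN hx]
  split_ifs with h
  · rw [Finset.sum_eq_single (numBelow x n + 1)]
    · simp
    · intro b hb hne
      rw [Finset.mem_Icc] at hb
      rw [if_neg (by omega)]
    · intro h'
      rw [Finset.mem_Icc] at h'
      omega
  · refine (Finset.sum_eq_zero fun b hb => ?_).symm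
    rw [Finset.mem_Icc] at hb
    rw [if_neg (by omega)]

/-- Exactly K coordinates do not exceed the K-th smallest, and each contributes equally by
exchangeability: the origin of the factors K / N. -/
lemma integral_le_ordStat_comp_ordStat (hK : 1 ≤ K) (hKN : K ≤ N) (n : Fin N) {φ : ℝ → ℝ}
    (hφ : Measurable φ) {C : ℝ} (hC : ∀ t, |φ t| ≤ C) :
    ∫ x, (if x n ≤ ordStat K x then φ (ordStat K x) else 0) ∂(sampleLaw ρ N)
      = K / N * ∫ x, φ (ordStat K x) ∂(sampleLaw ρ N) := by
  have hT : Measurable (ordStat K : (Fin N → ℝ) → ℝ) := measurable_ordStat hK hKN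
  have hint : ∀ m : Fin N, Integrable (fun x => if x m ≤ ordStat K x then φ (ordStat K x) else 0)
      (sampleLaw ρ N) := fun m =>
    Integrable.of_bound (Measurable.ite (measurableSet_le (measurable_pi_apply m) hT)
      (hφ.comp hT) measurable_const).aestronglyMeasurable C
      (Eventually.of_forall fun x => by
        split_ifs
        · exact hC _
        · simpa using (abs_nonneg _).trans (hC 0))
  have hsum : ∫ x, ∑ m, (if x m ≤ ordStat K x then φ (ordStat K x) else 0) ∂(sampleLaw ρ N)
      = ∫ x, K * φ (ordStat K x) ∂(sampleLaw ρ N) := by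
    refine integral_congr_ae ?_
    filter_upwards [ae_injective_sampleLaw (ρ := ρ) N] with x hx
    rw [← Finset.sum_filter, Finset.sum_const, card_le_ordStat hK hKN hx, nsmul_eq_mul]
  rw [integral_finsetSum _ fun m _ => hint m, integral_const_mul,
    Finset.sum_congr rfl fun m _ => integral_sampleLaw_exchange m n
      (fun x i => if x i ≤ ordStat K x then φ (ordStat K x) else 0) fun x σ i => by
        simp only [ordStat_comp_equiv]] at hsum
  have hN : (N : ℝ) ≠ 0 := by have := n.pos; positivity
  rw [Finset.sum_const, Finset.card_univ, Fintype.card_fin, nsmul_eq_mul] at hsum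
  rw [div_mul_eq_mul_div, eq_div_iff hN, mul_comm, hsum]

end Sample

/-! ### The shifted exponential law -/

section ShiftedExp

variable {lam c : ℝ}

lemma isProbabilityMeasure_shiftedExp (hlam : 0 < lam) :
    IsProbabilityMeasure (shiftedExp lam c) := by
  have := isProbabilityMeasure_expMeasure hlam
  exact Measure.isProbabilityMeasure_map (by fun_prop)

lemma nullSingletonClass_shiftedExp : NullSingletonClass (shiftedExp lam c) := by
  refine ⟨fun t => ?_⟩
  rw [shiftedExp, (measurableEmbedding_addRight c).map_apply]
  have h : (fun y : ℝ => y + c) ⁻¹' {t} = {t - c} := by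
    ext y; simp only [Set.mem_preimage, Set.mem_singleton_iff, eq_sub_iff_add_eq]
  rw [h]
  exact withDensity_absolutelyContinuous _ _ (measure_singleton _)

lemma integral_shiftedExp (hlam : 0 < lam) (f : ℝ → ℝ) :
    ∫ t, f t ∂(shiftedExp lam c)
      = ∫ t in Set.Ioi c, f t * (lam * Real.exp (-(lam * (t - c)))) := by
  have h1 : expMeasure lam = volume.withDensity (exponentialPDF lam) := rfl
  rw [shiftedExp, (measurableEmbedding_addRight c).integral_map, h1,
    integral_withDensity_eq_integral_toReal_smul (f := exponentialPDF lam)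
      (measurable_exponentialPDFReal lam).ennreal_ofReal (by simp [exponentialPDF]),
    ← integral_sub_right_eq_self _ c, ← integral_Ici_eq_integral_Ioi,
    ← integral_indicator measurableSet_Ici]
  refine integral_congr_ae (Eventually.of_forall fun t => ?_)
  dsimp only
  by_cases ht : c ≤ t
  · have : 0 ≤ t - c := by linarith
    rw [Set.indicator_of_mem (by exact ht), exponentialPDF_of_nonneg this,
      ENNReal.toReal_ofReal (by positivity), sub_add_cancel, smul_eq_mul, mul_comm]
  · rw [Set.indicator_of_notMem (by exact ht), exponentialPDF_of_neg (sub_neg.2 (not_le.1 ht))]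
    simp

lemma shiftedExp_real_Iic (hlam : 0 < lam) {t : ℝ} (ht : c ≤ t) :
    (shiftedExp lam c).real (Set.Iic t) = 1 - Real.exp (-(lam * (t - c))) := by
  have := isProbabilityMeasure_expMeasure hlam
  have h : (fun y : ℝ => y + c) ⁻¹' Set.Iic t = Set.Iic (t - c) := by
    ext y; simp [le_sub_iff_add_le]
  rw [measureReal_def, shiftedExp, (measurableEmbedding_addRight c).map_apply, h, ← measureReal_def,
    ← cdf_eq_real, cdf_expMeasure_eq hlam, if_pos (by linarith)]

lemma ae_lt_shiftedExp (hlam : 0 < lam) : ∀ᵐ t ∂(shiftedExp lam c), c < t := by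
  have := isProbabilityMeasure_shiftedExp (c := c) hlam
  have h := shiftedExp_real_Iic (c := c) hlam le_rfl
  rw [sub_self, mul_zero, neg_zero, Real.exp_zero, sub_self, measureReal_eq_zero_iff] at h
  rw [ae_iff]
  simpa [Set.Iic] using h

lemma integrableOn_exp_neg_sub {a : ℝ} (ha : 0 < a) (lam c : ℝ) :
    IntegrableOn (fun t => lam * Real.exp (-(a * (t - c)))) (Set.Ioi c) := by
  have h : IntegrableOn (fun t => lam * (Real.exp (a * c) * Real.exp (-a * t))) (Set.Ioi c) :=
    ((exp_neg_integrableOn_Ioi c ha).const_mul (Real.exp (a * c))).const_mul lam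
  refine h.congr_fun (fun t _ => ?_) measurableSet_Ioi
  dsimp only
  rw [← Real.exp_add]
  congr 2; ring

/-- Total mass one of the shifted exponential law of rate `lam * U`. -/
lemma integral_exp_neg_sub {lam : ℝ} (hlam : 0 < lam) {U : ℝ} (hU : 0 < U) (c : ℝ) :
    ∫ t in Set.Ioi c, lam * Real.exp (-(lam * U * (t - c))) = 1 / U := by
  have := isProbabilityMeasure_shiftedExp (c := c) (mul_pos hlam hU)
  have h := integral_shiftedExp (c := c) (mul_pos hlam hU) fun _ => (1 : ℝ)
  simp only [one_mul, integral_const, probReal_univ, smul_eq_mul, mul_one, mul_right_comm lam U (Real.exp _)] at h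
  have h2 : ∀ t, lam * Real.exp (-(lam * U * (t - c))) * U
      = U * (lam * Real.exp (-(lam * U * (t - c)))) := fun t => by ring
  simp only [h2] at h
  rw [integral_const_mul] at h
  rw [eq_div_iff hU.ne', mul_comm, ← h]

end ShiftedExp

/-! ### Closed forms -/

section ClosedForms

variable {N : ℕ} {lam c TD : ℝ}

lemma cU_pos {h j : ℕ} (hN : h ≤ N) : 0 < cU N h j := by
  have : (h : ℝ) ≤ N := by exact_mod_cast hN
  have : (0 : ℝ) ≤ j := by positivity
  unfold cU; linarith

/-- The density of the `h`-th order statistic as a sum of exponentials. -/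
lemma orderStat_density {h : ℕ} (h1 : 1 ≤ h) (hN : h ≤ N) (y : ℝ) :
    (N : ℝ) * ((N - 1).choose (h - 1) * (1 - Real.exp (-(lam * y))) ^ (h - 1)
        * (1 - (1 - Real.exp (-(lam * y)))) ^ (N - 1 - (h - 1))) * (lam * Real.exp (-(lam * y)))
      = ∑ j ∈ Finset.range h, cB N h j * (lam * Real.exp (-(lam * cU N h j * y))) := by
  obtain ⟨k, rfl⟩ : ∃ k, h = k + 1 := ⟨h - 1, by omega⟩
  obtain ⟨l, rfl⟩ : ∃ l, N = l + (k + 1) := ⟨N - (k + 1), by omega⟩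
  set e := Real.exp (-(lam * y)) with he
  have hexp : ∀ j, Real.exp (-(lam * cU (l + (k + 1)) (k + 1) j * y)) = e ^ (l + 1 + j) := by
    intro j
    rw [he, ← Real.exp_nat_mul, cU]
    congr 1
    push_cast
    ring
  have hbin : (1 - e) ^ k = ∑ j ∈ Finset.range (k + 1), (k.choose j : ℝ) * (-1) ^ j * e ^ j := by
    rw [show 1 - e = -e + 1 by ring, add_pow]
    refine Finset.sum_congr rfl fun j _ => ?_
    rw [neg_pow]; ring
  -- Absorption identity N·C(N-1, h-1) = h·C(N, h), which produces the prefactor of `cB`.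
  have hch : ((l + (k + 1) : ℕ) : ℝ) * ((l + k).choose k : ℝ)
      = ((k + 1 : ℕ) : ℝ) * ((l + (k + 1)).choose (k + 1) : ℝ) := by
    have := Nat.add_one_mul_choose_eq (l + k) k
    rw [← add_assoc, mul_comm ((k + 1 : ℕ) : ℝ)]
    exact_mod_cast this
  rw [show l + (k + 1) - 1 = l + k by omega, show k + 1 - 1 = k by omega,
    show l + k - k = l by omega, hbin, show 1 - (1 - e) = e by ring]
  calc ((l + (k + 1) : ℕ) : ℝ) * ((l + k).choose k *
        (∑ j ∈ Finset.range (k + 1), (k.choose j : ℝ) * (-1) ^ j * e ^ j) * e ^ l) * (lam * e)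
      = (((l + (k + 1) : ℕ) : ℝ) * ((l + k).choose k : ℝ)) *
        (∑ j ∈ Finset.range (k + 1), (k.choose j : ℝ) * (-1) ^ j * e ^ j) * (lam * e ^ (l + 1)) := by
          ring
    _ = _ := by
      rw [hch, Finset.mul_sum, Finset.sum_mul]
      refine Finset.sum_congr rfl fun j _ => ?_
      rw [hexp, cB, show k + 1 - 1 = k by omega, pow_add e (l + 1) j]
      ring

lemma integral_numBelow_shiftedExp (hlam : 0 < lam) (n : Fin N) {h : ℕ} (h1 : 1 ≤ h) (hN : h ≤ N)
    {φ : ℝ → ℝ} (hφ : Measurable φ) {C : ℝ} (hC : ∀ t, |φ t| ≤ C)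
    [IsProbabilityMeasure (shiftedExp lam c)] :
    (N : ℝ) * ∫ x, (if numBelow x n = h - 1 then φ (x n) else 0) ∂(sampleLaw (shiftedExp lam c) N)
      = ∑ j ∈ Finset.range h, cB N h j *
        ∫ t in Set.Ioi c, φ t * (lam * Real.exp (-(lam * cU N h j * (t - c)))) := by
  have hi : ∀ j, IntegrableOn (fun t => φ t * (lam * Real.exp (-(lam * cU N h j * (t - c)))))
      (Set.Ioi c) := fun j =>
    (integrableOn_exp_neg_sub (mul_pos hlam (cU_pos hN)) lam c).bdd_mul hφ.aestronglyMeasurable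
      (Eventually.of_forall hC)
  rw [integral_numBelow _ N (h - 1) n hφ hC, integral_shiftedExp hlam, ← integral_const_mul]
  simp only [← integral_const_mul]
  rw [← integral_finsetSum _ fun j _ => (hi j).const_mul _]
  refine setIntegral_congr_fun measurableSet_Ioi fun t ht => ?_
  rw [shiftedExp_real_Iic hlam (le_of_lt ht)]
  calc _ = φ t * ((N : ℝ) * ((N - 1).choose (h - 1) * (1 - Real.exp (-(lam * (t - c)))) ^ (h - 1)
        * (1 - (1 - Real.exp (-(lam * (t - c))))) ^ (N - 1 - (h - 1)))
          * (lam * Real.exp (-(lam * (t - c))))) := by ring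
    _ = _ := by
      rw [orderStat_density h1 hN, Finset.mul_sum]
      exact Finset.sum_congr rfl fun j _ => by ring

/-- The total mass of the law of the h-th order statistic; the sum does not involve the shift, which
is set to 0. It turns Σ B(1 - V)/U into 1 - Z. -/
lemma sum_cB_div_cU (hlam : 0 < lam) {h : ℕ} (h1 : 1 ≤ h) (hN : h ≤ N) :
    ∑ j ∈ Finset.range h, cB N h j / cU N h j = 1 := by
  have hp := isProbabilityMeasure_shiftedExp (c := 0) hlam
  have := nullSingletonClass_shiftedExp (lam := lam) (c := 0)
  let n : Fin N := ⟨0, by omega⟩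
  have h2 := integral_comp_ordStat (ρ := shiftedExp lam 0) h1 hN n (φ := fun _ => 1)
    measurable_const (C := 1) (by simp)
  rw [integral_numBelow_shiftedExp hlam n h1 hN (φ := fun _ => 1) measurable_const (C := 1) (by simp)]
    at h2
  simp only [one_mul, integral_exp_neg_sub hlam (cU_pos hN), integral_const, probReal_univ,
    smul_eq_mul, mul_one_div] at h2
  exact h2.symm

/-- The power function truncated to `(0, TD]`. -/
def truncPow (TD : ℝ) (i : ℕ) : ℝ → ℝ := (Set.Ioc 0 TD).indicator fun t => t ^ i

lemma measurable_truncPow (i : ℕ) : Measurable (truncPow TD i) :=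
  (measurable_id.pow_const i).indicator measurableSet_Ioc

lemma truncPow_of_mem {i : ℕ} {t : ℝ} (h0 : 0 < t) (h1 : t ≤ TD) : truncPow TD i t = t ^ i :=
  Set.indicator_of_mem (s := Set.Ioc 0 TD) ⟨h0, h1⟩ _

lemma truncPow_of_lt {i : ℕ} {t : ℝ} (h : TD < t) : truncPow TD i t = 0 :=
  Set.indicator_of_notMem (fun ht => absurd ht.2 (not_le.2 h)) _

/-- The cut at 0 makes the test function bounded on all of ℝ and loses nothing, since service times
almost surely exceed c > 0. -/
lemma abs_truncPow_le (hTD : 0 < TD) (i : ℕ) (t : ℝ) : |truncPow TD i t| ≤ TD ^ i := by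
  by_cases ht : t ∈ Set.Ioc 0 TD
  · rw [truncPow_of_mem ht.1 ht.2, abs_of_nonneg (pow_nonneg ht.1.le i)]
    exact pow_le_pow_left₀ ht.1.le ht.2 i
  · rw [truncPow, Set.indicator_of_notMem ht, abs_zero]
    positivity

/-- Only (c, TD] contributes. In the three cases below, `F` is the antiderivative obtained by
repeated integration by parts. -/
lemma integral_truncPow (hc : 0 < c) (hTD : c < TD) (i : ℕ) {w F : ℝ → ℝ} (hw : Continuous w)
    (hF : ∀ t, HasDerivAt F (t ^ i * w t) t) :
    ∫ t in Set.Ioi c, truncPow TD i t * w t = F TD - F c := by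
  have hmul : ∀ t, truncPow TD i t * w t = (Set.Ioc 0 TD).indicator (fun t => t ^ i * w t) t := by
    intro t
    by_cases ht : t ∈ Set.Ioc 0 TD <;> simp [truncPow, ht]
  simp only [hmul]
  rw [setIntegral_indicator measurableSet_Ioc]
  have : Set.Ioi c ∩ Set.Ioc 0 TD = Set.Ioc c TD := by
    ext t
    simp only [Set.mem_inter_iff, Set.mem_Ioi, Set.mem_Ioc]
    exact ⟨fun h => ⟨h.1, h.2.2⟩, fun h => ⟨h.1, hc.trans h.1, h.2⟩⟩
  rw [this, ← intervalIntegral.integral_of_le hTD.le]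
  refine intervalIntegral.integral_eq_sub_of_hasDerivAt (fun t _ => hF t) ?_
  exact ((continuous_pow i).mul hw).intervalIntegrable _ _

lemma hasDerivAt_exp_neg_sub (a c t : ℝ) :
    HasDerivAt (fun t => Real.exp (-(a * (t - c)))) (-(a * Real.exp (-(a * (t - c))))) t := by
  have h := (((hasDerivAt_id' t).sub_const c).const_mul (-a)).exp
  simp only [neg_mul] at h
  convert h using 1
  ring

lemma integral_truncPow_zero (hlam : 0 < lam) (hc : 0 < c) (hTD : c < TD) {h j : ℕ} (hN : h ≤ N) :
    ∫ t in Set.Ioi c, truncPow TD 0 t * (lam * Real.exp (-(lam * cU N h j * (t - c))))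
      = (1 - cV N lam c TD h j) / cU N h j := by
  have hU := (cU_pos (j := j) hN).ne'
  rw [integral_truncPow hc hTD 0 (F := fun t =>
    -(1 / cU N h j) * Real.exp (-(lam * cU N h j * (t - c)))) (by fun_prop)]
  · simp only [cV, sub_self, mul_zero, neg_zero, Real.exp_zero]
    ring
  · intro t
    convert! (hasDerivAt_exp_neg_sub (lam * cU N h j) c t).const_mul (-(1 / cU N h j)) using 1
    field_simp

lemma integral_truncPow_one (hlam : 0 < lam) (hc : 0 < c) (hTD : c < TD) {h j : ℕ} (hN : h ≤ N) :
    ∫ t in Set.Ioi c, truncPow TD 1 t * (lam * Real.exp (-(lam * cU N h j * (t - c))))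
      = (1 + c * lam * cU N h j - (1 + TD * lam * cU N h j) * cV N lam c TD h j)
        / (lam * cU N h j ^ 2) := by
  have hU := (cU_pos (j := j) hN).ne'
  have hl := hlam.ne'
  rw [integral_truncPow hc hTD 1 (F := fun t => (-(1 / (lam * cU N h j ^ 2)) *
    (1 + t * lam * cU N h j)) * Real.exp (-(lam * cU N h j * (t - c)))) (by fun_prop)]
  · simp only [cV, sub_self, mul_zero, neg_zero, Real.exp_zero]
    ring
  · intro t
    have h1 : HasDerivAt (fun t => -(1 / (lam * cU N h j ^ 2)) * (1 + t * lam * cU N h j))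
        (-(1 / (lam * cU N h j ^ 2)) * (lam * cU N h j)) t := by
      convert! (((((hasDerivAt_id t).mul_const lam).mul_const (cU N h j)).const_add 1).const_mul
        (-(1 / (lam * cU N h j ^ 2)))) using 1
      ring
    convert! h1.mul (hasDerivAt_exp_neg_sub (lam * cU N h j) c t) using 1
    field_simp
    ring

lemma integral_truncPow_two (hlam : 0 < lam) (hc : 0 < c) (hTD : c < TD) {h j : ℕ} (hN : h ≤ N) :
    ∫ t in Set.Ioi c, truncPow TD 2 t * (lam * Real.exp (-(lam * cU N h j * (t - c))))
      = ((1 + c * lam * cU N h j) ^ 2 + 1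
        - ((1 + TD * lam * cU N h j) ^ 2 + 1) * cV N lam c TD h j) / (lam ^ 2 * cU N h j ^ 3) := by
  have hU := (cU_pos (j := j) hN).ne'
  have hl := hlam.ne'
  rw [integral_truncPow hc hTD 2 (F := fun t => (-(1 / (lam ^ 2 * cU N h j ^ 3)) *
    ((1 + t * lam * cU N h j) ^ 2 + 1)) * Real.exp (-(lam * cU N h j * (t - c)))) (by fun_prop)]
  · simp only [cV, sub_self, mul_zero, neg_zero, Real.exp_zero]
    ring
  · intro t
    have h1 : HasDerivAt (fun t => -(1 / (lam ^ 2 * cU N h j ^ 3)) *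
        ((1 + t * lam * cU N h j) ^ 2 + 1))
        (-(1 / (lam ^ 2 * cU N h j ^ 3)) * (2 * (1 + t * lam * cU N h j) * (lam * cU N h j))) t := by
      convert! ((((((hasDerivAt_id t).mul_const lam).mul_const (cU N h j)).const_add 1).pow 2).add_const
        1).const_mul (-(1 / (lam ^ 2 * cU N h j ^ 3))) using 1
      simp
    convert! h1.mul (hasDerivAt_exp_neg_sub (lam * cU N h j) c t) using 1
    field_simp
    ring

/-- Closed form of `E[T_N(h)^i; T_N(h) ≤ TD]` for `i = 0, 1, 2`. -/
def truncMoment (N : ℕ) (lam c TD : ℝ) (h : ℕ) : ℕ → ℝ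
  | 0 => 1 - cZ N lam c TD h
  | 1 => ∑ j ∈ Finset.range h, cB N h j / (lam * cU N h j ^ 2) *
      (1 + c * lam * cU N h j - (1 + TD * lam * cU N h j) * cV N lam c TD h j)
  | _ => ∑ j ∈ Finset.range h, cB N h j / (lam ^ 2 * cU N h j ^ 3) *
      ((1 + c * lam * cU N h j) ^ 2 + 1 - ((1 + TD * lam * cU N h j) ^ 2 + 1) * cV N lam c TD h j)

lemma integral_numBelow_truncPow (hlam : 0 < lam) (hc : 0 < c) (hTD : c < TD) (n : Fin N) {h : ℕ}
    (h1 : 1 ≤ h) (hN : h ≤ N) {i : ℕ} (hi : i ≤ 2) :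
    (N : ℝ) * ∫ x, (if numBelow x n = h - 1 then truncPow TD i (x n) else 0)
      ∂(sampleLaw (shiftedExp lam c) N) = truncMoment N lam c TD h i := by
  have := isProbabilityMeasure_shiftedExp (c := c) hlam
  rw [integral_numBelow_shiftedExp hlam n h1 hN (measurable_truncPow i)
    (abs_truncPow_le (hc.trans hTD) i)]
  -- The bound i ≤ 2 matters: the last clause of `truncMoment` is meaningful only for i = 2.
  interval_cases i
  · simp only [integral_truncPow_zero hlam hc hTD hN, truncMoment]
    refine Eq.trans ?_ (congrArg (· - _) (sum_cB_div_cU hlam h1 hN))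
    rw [cZ, ← Finset.sum_sub_distrib]
    exact Finset.sum_congr rfl fun j _ => by ring
  · simp only [integral_truncPow_one hlam hc hTD hN, truncMoment]
    exact Finset.sum_congr rfl fun j _ => by ring
  · simp only [integral_truncPow_two hlam hc hTD hN, truncMoment]
    exact Finset.sum_congr rfl fun j _ => by ring

end ClosedForms

/-! ### One status update -/

section Update

variable {N K : ℕ} {lam c TD : ℝ}

lemma measurableSet_evS (hK : 1 ≤ K) (hKN : K ≤ N) (TD : ℝ) (n : Fin N) :
    MeasurableSet (evS K TD n) :=
  measurableSet_le (measurable_pi_apply n) (measurable_duration hK hKN TD)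

lemma mem_evS {n : Fin N} {x : Fin N → ℝ} : x ∈ evS K TD n ↔ x n ≤ TD ∧ x n ≤ ordStat K x :=
  (le_min_iff : x n ≤ min TD (ordStat K x) ↔ _)

lemma mem_evF {n : Fin N} {x : Fin N → ℝ} : x ∈ evF K TD n ↔ min TD (ordStat K x) < x n := Iff.rfl

lemma mem_evServed {x : Fin N → ℝ} : x ∈ evServed K TD ↔ ordStat K x < TD := Iff.rfl

lemma mem_evExpired {x : Fin N → ℝ} : x ∈ evExpired K TD ↔ TD < ordStat K x := Iff.rfl

lemma compl_evS (K : ℕ) (TD : ℝ) (n : Fin N) : (evS K TD n)ᶜ = evF K TD n := by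
  ext x
  rw [Set.mem_compl_iff, mem_evS, mem_evF, ← le_min_iff, not_le]

lemma measurableSet_evServed (hK : 1 ≤ K) (hKN : K ≤ N) (TD : ℝ) :
    MeasurableSet (evServed K TD : Set (Fin N → ℝ)) :=
  measurableSet_lt (measurable_ordStat hK hKN) measurable_const

lemma measurableSet_evExpired (hK : 1 ≤ K) (hKN : K ≤ N) (TD : ℝ) :
    MeasurableSet (evExpired K TD : Set (Fin N → ℝ)) :=
  measurableSet_lt measurable_const (measurable_ordStat hK hKN)

lemma ae_lt_sample (hlam : 0 < lam) (N : ℕ) [IsProbabilityMeasure (shiftedExp lam c)] :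
    ∀ᵐ x ∂(sampleLaw (shiftedExp lam c) N), ∀ i, c < x i :=
  ae_sampleLaw_forall N (S := Set.Ioi c) (ae_lt_shiftedExp hlam)

/-- T_N(K) is one of the service times and these have no atom at TD, so "served" and "expired" are
complementary up to a null set. -/
lemma ae_ordStat (hlam : 0 < lam) (hc : 0 < c) (hK : 1 ≤ K) (hKN : K ≤ N) (TD : ℝ)
    [IsProbabilityMeasure (shiftedExp lam c)] :
    ∀ᵐ x ∂(sampleLaw (shiftedExp lam c) N), 0 < ordStat K x ∧ ordStat K x ≠ TD := by
  have := nullSingletonClass_shiftedExp (lam := lam) (c := c)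
  have hne : ∀ᵐ t ∂(shiftedExp lam c), t ∈ ({TD}ᶜ : Set ℝ) := by
    rw [ae_iff]; simp
  filter_upwards [ae_lt_sample hlam N, ae_sampleLaw_forall N hne] with x h1 h2
  obtain ⟨-, i, hi⟩ := isLeast_ordStat hK hKN x
  rw [← hi]
  exact ⟨hc.trans (h1 i), h2 i⟩

lemma integrable_truncPow_ordStat (hTD : 0 < TD) (hK : 1 ≤ K) (hKN : K ≤ N) (i : ℕ)
    (μ : Measure (Fin N → ℝ)) [IsFiniteMeasure μ] :
    Integrable (fun x => truncPow TD i (ordStat K x)) μ :=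
  Integrable.of_bound ((measurable_truncPow i).comp (measurable_ordStat hK hKN)).aestronglyMeasurable
    (TD ^ i) (Eventually.of_forall fun _ => abs_truncPow_le hTD i _)

lemma exp_neg_lt_one (hlam : 0 < lam) (hTD : c < TD) : Real.exp (-(lam * (TD - c))) < 1 := by
  rw [Real.exp_lt_one_iff]
  have : 0 < TD - c := by linarith
  nlinarith [mul_pos hlam this]

variable [IsProbabilityMeasure (shiftedExp lam c)]

lemma setIntegral_inter_evServed (hlam : 0 < lam) (hc : 0 < c) (hK : 1 ≤ K)
    (hKN : K ≤ N) (TD : ℝ) {S : Set (Fin N → ℝ)} (i : ℕ) :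
    ∫ x in S ∩ evServed K TD, ordStat K x ^ i ∂(sampleLaw (shiftedExp lam c) N)
      = ∫ x in S, truncPow TD i (ordStat K x) ∂(sampleLaw (shiftedExp lam c) N) := by
  rw [← setIntegral_indicator (measurableSet_evServed hK hKN TD)]
  refine integral_congr_ae (ae_restrict_of_ae ?_)
  filter_upwards [ae_ordStat hlam hc hK hKN TD] with x hx
  rcases lt_or_gt_of_ne hx.2 with h | h
  · rw [Set.indicator_of_mem (mem_evServed.2 h), truncPow_of_mem hx.1 h.le]
  · rw [Set.indicator_of_notMem (fun h' => lt_asymm h (mem_evServed.1 h')), truncPow_of_lt h]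

/-- Almost surely min(TD, T)^i equals T^i·1{T ≤ TD} + TD^i (1 - 1{T ≤ TD}), and both indicator terms
are truncated powers of T. -/
lemma setIntegral_duration (hlam : 0 < lam) (hc : 0 < c) (hTD : c < TD) (hK : 1 ≤ K)
    (hKN : K ≤ N) (S : Set (Fin N → ℝ)) (i : ℕ) :
    ∫ x in S, duration K TD x ^ i ∂(sampleLaw (shiftedExp lam c) N)
      = ∫ x in S, truncPow TD i (ordStat K x) ∂(sampleLaw (shiftedExp lam c) N)
        + TD ^ i * ((sampleLaw (shiftedExp lam c) N).real S
          - ∫ x in S, truncPow TD 0 (ordStat K x) ∂(sampleLaw (shiftedExp lam c) N)) := by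
  have hi := fun i => integrable_truncPow_ordStat (hc.trans hTD) hK hKN i
    ((sampleLaw (shiftedExp lam c) N).restrict S)
  have h1 : ∫ x in S, duration K TD x ^ i ∂(sampleLaw (shiftedExp lam c) N)
      = ∫ x in S, (truncPow TD i (ordStat K x) + TD ^ i * (1 - truncPow TD 0 (ordStat K x)))
        ∂(sampleLaw (shiftedExp lam c) N) := by
    refine integral_congr_ae (ae_restrict_of_ae ?_)
    filter_upwards [ae_ordStat hlam hc hK hKN TD] with x hx
    rcases lt_or_gt_of_ne hx.2 with h | h
    · rw [duration, min_eq_right h.le, truncPow_of_mem hx.1 h.le, truncPow_of_mem hx.1 h.le]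
      ring
    · rw [duration, min_eq_left h.le, truncPow_of_lt h, truncPow_of_lt h]
      ring
  have h2 : Integrable (fun x => TD ^ i * (1 - truncPow TD 0 (ordStat K x)))
      ((sampleLaw (shiftedExp lam c) N).restrict S) :=
    ((integrable_const _).sub (hi 0)).const_mul _
  rw [h1, integral_add (hi i) h2, integral_const_mul,
    integral_sub (integrable_const _) (hi 0)]
  simp

lemma measureReal_inter_evExpired (hlam : 0 < lam) (hc : 0 < c) (hTD : c < TD) (hK : 1 ≤ K)
    (hKN : K ≤ N) (S : Set (Fin N → ℝ)) :
    (sampleLaw (shiftedExp lam c) N).real (S ∩ evExpired K TD)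
      = (sampleLaw (shiftedExp lam c) N).real S
          - ∫ x in S, truncPow TD 0 (ordStat K x) ∂(sampleLaw (shiftedExp lam c) N) := by
  have hi := fun i => integrable_truncPow_ordStat (hc.trans hTD) hK hKN i
    ((sampleLaw (shiftedExp lam c) N).restrict S)
  have h1 : ∫ x in S ∩ evExpired K TD, (1 : ℝ) ∂(sampleLaw (shiftedExp lam c) N)
      = ∫ x in S, (1 - truncPow TD 0 (ordStat K x)) ∂(sampleLaw (shiftedExp lam c) N) := by
    rw [← setIntegral_indicator (measurableSet_evExpired hK hKN TD)]
    refine integral_congr_ae (ae_restrict_of_ae ?_)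
    filter_upwards [ae_ordStat hlam hc hK hKN TD] with x hx
    rcases lt_or_gt_of_ne hx.2 with h | h
    · rw [Set.indicator_of_notMem (fun h' => lt_asymm h (mem_evExpired.1 h')),
        truncPow_of_mem hx.1 h.le]
      ring
    · rw [Set.indicator_of_mem (mem_evExpired.2 h), truncPow_of_lt h]
      ring
  rw [integral_sub (integrable_const _) (hi 0)] at h1
  simpa using h1

variable [NullSingletonClass (shiftedExp lam c)]

/-- Reception means rank at most K together with service time at most TD; truncation encodes the
second condition. -/
lemma setIntegral_evS_service (hlam : 0 < lam) (hc : 0 < c) (hTD : c < TD) (hK : 1 ≤ K)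
    (hKN : K ≤ N) (n : Fin N) {i : ℕ} (hi : i ≤ 2) :
    ∫ x in evS K TD n, x n ^ i ∂(sampleLaw (shiftedExp lam c) N)
      = 1 / N * ∑ h ∈ Finset.Icc 1 K, truncMoment N lam c TD h i := by
  have hN : (N : ℝ) ≠ 0 := by have := n.pos; positivity
  have h1 := integral_le_ordStat (ρ := shiftedExp lam c) hK hKN n (measurable_truncPow (TD := TD) i)
    (abs_truncPow_le (hc.trans hTD) i)
  have h2 : ∀ h ∈ Finset.Icc 1 K, ∫ x, (if numBelow x n = h - 1 then truncPow TD i (x n) else 0)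
      ∂(sampleLaw (shiftedExp lam c) N) = truncMoment N lam c TD h i / N := fun h hh =>
    eq_div_of_mul_eq hN ((mul_comm _ _).trans (integral_numBelow_truncPow hlam hc hTD n
      (Finset.mem_Icc.1 hh).1 ((Finset.mem_Icc.1 hh).2.trans hKN) hi))
  rw [Finset.sum_congr rfl h2, ← Finset.sum_div] at h1
  rw [one_div_mul_eq_div, ← h1, ← integral_indicator (measurableSet_evS hK hKN TD n)]
  refine integral_congr_ae ?_
  filter_upwards [ae_lt_sample hlam N] with x hx
  have h0 : 0 < x n := hc.trans (hx n)
  by_cases hT : x n ≤ ordStat K x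
  · by_cases hD : x n ≤ TD
    · rw [Set.indicator_of_mem (mem_evS.2 ⟨hD, hT⟩), if_pos hT, truncPow_of_mem h0 hD]
    · rw [Set.indicator_of_notMem fun h => hD (mem_evS.1 h).1, if_pos hT,
        truncPow_of_lt (not_le.1 hD)]
  · rw [Set.indicator_of_notMem fun h => hT (mem_evS.1 h).2, if_neg hT]

lemma integral_truncPow_ordStat (hlam : 0 < lam) (hc : 0 < c) (hTD : c < TD) (hK : 1 ≤ K)
    (hKN : K ≤ N) {i : ℕ} (hi : i ≤ 2) :
    ∫ x, truncPow TD i (ordStat K x) ∂(sampleLaw (shiftedExp lam c) N)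
      = truncMoment N lam c TD K i := by
  rw [integral_comp_ordStat hK hKN ⟨0, by omega⟩ (measurable_truncPow (TD := TD) i)
    (abs_truncPow_le (hc.trans hTD) i), integral_numBelow_truncPow hlam hc hTD _ hK hKN hi]

/-- The deadline condition on device `n` is automatic here: if TD < x n ≤ T, then the truncated
power of T vanishes. -/
lemma setIntegral_evS_truncPow (hlam : 0 < lam) (hc : 0 < c) (hTD : c < TD) (hK : 1 ≤ K)
    (hKN : K ≤ N) (n : Fin N) {i : ℕ} (hi : i ≤ 2) :
    ∫ x in evS K TD n, truncPow TD i (ordStat K x) ∂(sampleLaw (shiftedExp lam c) N)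
      = K / N * truncMoment N lam c TD K i := by
  rw [← integral_truncPow_ordStat hlam hc hTD hK hKN hi,
    ← integral_le_ordStat_comp_ordStat hK hKN n (measurable_truncPow (TD := TD) i)
    (abs_truncPow_le (hc.trans hTD) i), ← integral_indicator (measurableSet_evS hK hKN TD n)]
  refine integral_congr_ae (Eventually.of_forall fun x => ?_)
  dsimp only
  by_cases hT : x n ≤ ordStat K x
  · by_cases hD : x n ≤ TD
    · rw [Set.indicator_of_mem (mem_evS.2 ⟨hD, hT⟩), if_pos hT]
    · rw [Set.indicator_of_notMem fun h => hD (mem_evS.1 h).1, if_pos hT,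
        truncPow_of_lt ((not_le.1 hD).trans_le hT)]
  · rw [Set.indicator_of_notMem fun h => hT (mem_evS.1 h).2, if_neg hT]

lemma setIntegral_evF_truncPow (hlam : 0 < lam) (hc : 0 < c) (hTD : c < TD) (hK : 1 ≤ K)
    (hKN : K ≤ N) (n : Fin N) {i : ℕ} (hi : i ≤ 2) :
    ∫ x in evF K TD n, truncPow TD i (ordStat K x) ∂(sampleLaw (shiftedExp lam c) N)
      = (1 - K / N) * truncMoment N lam c TD K i := by
  have h := integral_add_compl (measurableSet_evS hK hKN TD n)
    (integrable_truncPow_ordStat (hc.trans hTD) hK hKN i (sampleLaw (shiftedExp lam c) N))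
  rw [setIntegral_evS_truncPow hlam hc hTD hK hKN n hi,
    integral_truncPow_ordStat hlam hc hTD hK hKN hi, compl_evS] at h
  linarith

lemma measureReal_evS (hlam : 0 < lam) (hc : 0 < c) (hTD : c < TD) (hK : 1 ≤ K)
    (hKN : K ≤ N) (n : Fin N) :
    (sampleLaw (shiftedExp lam c) N).real (evS K TD n) = probS N K lam c TD := by
  have h := setIntegral_evS_service hlam hc hTD hK hKN n (i := 0) (by omega)
  simp only [pow_zero, setIntegral_const, smul_eq_mul, mul_one] at h
  exact h

lemma measureReal_evF (hlam : 0 < lam) (hc : 0 < c) (hTD : c < TD) (hK : 1 ≤ K)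
    (hKN : K ≤ N) (n : Fin N) :
    (sampleLaw (shiftedExp lam c) N).real (evF K TD n) = 1 - probS N K lam c TD := by
  rw [← compl_evS, probReal_compl_eq_one_sub (measurableSet_evS hK hKN TD n),
    measureReal_evS hlam hc hTD hK hKN n]

/-- The left side of the difference is P(T_N(K) ≤ TD), at least the probability that all service
times are at most TD. -/
lemma one_sub_cZ_pos (hlam : 0 < lam) (hc : 0 < c) (hTD : c < TD) (hK : 1 ≤ K) (hKN : K ≤ N) :
    0 < 1 - cZ N lam c TD K := by
  have h := integral_truncPow_ordStat hlam hc hTD hK hKN (i := 0) (by omega)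
  rw [truncMoment] at h
  rw [← h]
  set μ := sampleLaw (shiftedExp lam c) N
  have hbox : 0 < μ.real (Set.univ.pi fun _ => Set.Iic TD) := by
    rw [measureReal_def, Measure.pi_pi, ENNReal.toReal_prod]
    refine Finset.prod_pos fun i _ => ?_
    rw [← measureReal_def, shiftedExp_real_Iic hlam hTD.le]
    linarith [exp_neg_lt_one hlam hTD]
  refine hbox.trans_le ?_
  rw [← integral_indicator_one (MeasurableSet.univ_pi fun _ => measurableSet_Iic)]
  refine integral_mono_ae ((integrable_const _).indicator
    (MeasurableSet.univ_pi fun _ => measurableSet_Iic))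
    (integrable_truncPow_ordStat (hc.trans hTD) hK hKN 0 μ) ?_
  filter_upwards [ae_ordStat hlam hc hK hKN TD] with x hx
  by_cases hb : x ∈ Set.univ.pi fun _ : Fin N => Set.Iic TD
  · obtain ⟨-, i, hi⟩ := isLeast_ordStat hK hKN x
    rw [Set.indicator_of_mem hb, truncPow_of_mem hx.1 (hi ▸ hb i trivial)]
    simp
  · rw [Set.indicator_of_notMem hb]
    exact Set.indicator_nonneg (fun t ht => by simp) _

/-- The integral of a truncated power over `evS` equals K/N (1 - Z_K) > 0, so `evS` is not null. -/
lemma probS_pos (hlam : 0 < lam) (hc : 0 < c) (hTD : c < TD) (hK : 1 ≤ K) (hKN : K ≤ N) :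
    0 < probS N K lam c TD := by
  have n : Fin N := ⟨0, by omega⟩
  have hN : (0 : ℝ) < N := by have := n.pos; positivity
  have hK0 : (0 : ℝ) < K := by positivity
  have h := setIntegral_evS_truncPow hlam hc hTD hK hKN n (i := 0) (by omega)
  rw [truncMoment] at h
  have h2 := one_sub_cZ_pos (N := N) hlam hc hTD hK hKN
  have h3 : 0 < (K : ℝ) / N * (1 - cZ N lam c TD K) := by positivity
  rw [← h] at h3
  rw [← measureReal_evS hlam hc hTD hK hKN n]
  have h4 := measureReal_nonneg (μ := sampleLaw (shiftedExp lam c) N) (s := evS K TD n)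
  refine lt_of_le_of_ne h4 fun h5 => ?_
  rw [Measure.restrict_eq_zero.2 ((measureReal_eq_zero_iff).1 h5.symm)] at h3
  simp at h3

/-- Device `n` fails whenever its own service time exceeds the deadline. -/
lemma probS_lt_one (hlam : 0 < lam) (hc : 0 < c) (hTD : c < TD) (hK : 1 ≤ K) (hKN : K ≤ N) :
    0 < 1 - probS N K lam c TD := by
  have n : Fin N := ⟨0, by omega⟩
  rw [← measureReal_evF hlam hc hTD hK hKN n]
  set μ := sampleLaw (shiftedExp lam c) N
  have h1 : μ.real ((fun x : Fin N → ℝ => x n) ⁻¹' Set.Ioi TD) = Real.exp (-(lam * (TD - c))) := by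
    have hm := (measurePreserving_eval (fun _ : Fin N => shiftedExp lam c) n).measure_preimage
      (measurableSet_Ioi (a := TD)).nullMeasurableSet
    have h2 := probReal_compl_eq_one_sub (μ := shiftedExp lam c) (measurableSet_Iic (a := TD))
    rw [shiftedExp_real_Iic hlam hTD.le, Set.compl_Iic] at h2
    rw [measureReal_def]
    refine (congrArg ENNReal.toReal hm).trans ?_
    rw [← measureReal_def, h2]; ring
  have h3 := Real.exp_pos (-(lam * (TD - c)))
  rw [← h1] at h3
  exact h3.trans_le (measureReal_mono fun x (hx : TD < x n) =>
    mem_evF.2 (lt_of_le_of_lt (min_le_left _ _) hx))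

/-- For K = N reception only requires x n ≤ TD; this computes the same probability in two ways. It
serves to simplify the denominator of `probF2`. -/
lemma sum_one_sub_cZ (hlam : 0 < lam) (hc : 0 < c) (hTD : c < TD) (hN : 1 ≤ N) :
    ∑ h ∈ Finset.Icc 1 N, (1 - cZ N lam c TD h) = N * (1 - Real.exp (-(lam * (TD - c)))) := by
  have n : Fin N := ⟨0, by omega⟩
  have hN0 : (N : ℝ) ≠ 0 := by positivity
  have h1 := measureReal_evS hlam hc hTD hN le_rfl n
  have h2 : (sampleLaw (shiftedExp lam c) N).real (evS N TD n)
      = (sampleLaw (shiftedExp lam c) N).real ((fun x : Fin N → ℝ => x n) ⁻¹' Set.Iic TD) := by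
    refine measureReal_congr ?_
    filter_upwards [ae_injective_sampleLaw (ρ := shiftedExp lam c) N] with x hx
    refine propext ⟨fun h => (mem_evS.1 h).1, fun h => mem_evS.2 ⟨h, ?_⟩⟩
    exact (le_ordStat_iff hN le_rfl hx n).2 (numBelow_lt x n)
  have hm := (measurePreserving_eval (fun _ : Fin N => shiftedExp lam c) n).measure_preimage
      (measurableSet_Iic (a := TD)).nullMeasurableSet
  have h3 : (sampleLaw (shiftedExp lam c) N).real ((fun x : Fin N → ℝ => x n) ⁻¹' Set.Iic TD)
      = 1 - Real.exp (-(lam * (TD - c))) := by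
    rw [← shiftedExp_real_Iic hlam hTD.le]
    exact congrArg ENNReal.toReal hm
  rw [h2, h3, probS, one_div_mul_eq_div, eq_div_iff hN0] at h1
  linarith

/-- Numerator and denominator of the closed form are N times P(failed and expired) and N times
P(failed). -/
lemma probF2_eq (hlam : 0 < lam) (hc : 0 < c) (hTD : c < TD) (hK : 1 ≤ K) (hKN : K ≤ N) :
    probF2 N K lam c TD = ((1 - probS N K lam c TD) - (1 - K / N) * (1 - cZ N lam c TD K))
      / (1 - probS N K lam c TD) := by
  have hN0 : (N : ℝ) ≠ 0 := by have : 0 < N := by omega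
                               positivity
  have hsum := sum_one_sub_cZ (N := N) hlam hc hTD (hK.trans hKN)
  have hsplit : ∑ h ∈ Finset.Icc 1 N, (1 - cZ N lam c TD h)
      = ∑ h ∈ Finset.Icc 1 K, (1 - cZ N lam c TD h)
        + ∑ h ∈ Finset.Icc (K + 1) N, (1 - cZ N lam c TD h) := by
    have h := Finset.sum_Ico_consecutive (fun h => 1 - cZ N lam c TD h) (Nat.succ_le_succ K.zero_le)
      (Nat.succ_le_succ hKN)
    simp only [← Finset.Ico_add_one_right_eq_Icc]
    exact h.symm
  have hp : N * probS N K lam c TD = ∑ h ∈ Finset.Icc 1 K, (1 - cZ N lam c TD h) := by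
    rw [probS]; field_simp
  have hcard1 : ∑ h ∈ Finset.Icc 1 K, (1 - cZ N lam c TD h)
      = K - ∑ h ∈ Finset.Icc 1 K, cZ N lam c TD h := by
    rw [Finset.sum_sub_distrib]; simp
  have hcard2 : ∑ h ∈ Finset.Icc (K + 1) N, (1 - cZ N lam c TD h)
      = (N - K) - ∑ h ∈ Finset.Icc (K + 1) N, cZ N lam c TD h := by
    rw [Finset.sum_sub_distrib]; simp [Nat.cast_sub hKN]
  have hden : N * Real.exp (-(lam * (TD - c))) + ((N : ℝ) - K)
      - ∑ h ∈ Finset.Icc (K + 1) N, cZ N lam c TD h = N * (1 - probS N K lam c TD) := by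
    have : (N : ℝ) * (1 - probS N K lam c TD) = N - N * probS N K lam c TD := by ring
    rw [this, hp]; linarith
  have hnum : ((N : ℝ) - K) * cZ N lam c TD K + ∑ h ∈ Finset.Icc 1 K, cZ N lam c TD h
      = N * ((1 - probS N K lam c TD) - (1 - K / N) * (1 - cZ N lam c TD K)) := by
    have : (N : ℝ) * (1 - K / N) = N - K := by field_simp
    have h2 : (N : ℝ) * ((1 - probS N K lam c TD) - (1 - K / N) * (1 - cZ N lam c TD K))
        = N - N * probS N K lam c TD - N * (1 - K / N) * (1 - cZ N lam c TD K) := by ring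
    rw [h2, this, hp, hcard1]; ring
  rw [probF2, hden, hnum, mul_div_mul_left _ _ hN0]

lemma probS1_eq (N K : ℕ) (lam c TD : ℝ) : probS1 N K lam c TD
    = (K / N * (1 - cZ N lam c TD K)) / probS N K lam c TD := by
  rw [probS1, div_mul_eq_mul_div, div_div]

lemma mom1TK_eq (N K : ℕ) (lam c TD : ℝ) : mom1TK N K lam c TD
    = truncMoment N lam c TD K 1 / truncMoment N lam c TD K 0 := by
  rw [mom1TK, one_div_mul_eq_div]; rfl

lemma mom2TK_eq (N K : ℕ) (lam c TD : ℝ) : mom2TK N K lam c TD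
    = truncMoment N lam c TD K 2 / truncMoment N lam c TD K 0 := by
  rw [mom2TK, one_div_mul_eq_div]; rfl

lemma mom1T_eq (N K : ℕ) (lam c TD : ℝ) : mom1T N K lam c TD
    = (1 / N * ∑ h ∈ Finset.Icc 1 K, truncMoment N lam c TD h 1) / probS N K lam c TD := by
  simp only [mom1T, truncMoment, Finset.mul_sum, Finset.sum_div]
  refine Finset.sum_congr rfl fun h _ => Finset.sum_congr rfl fun j _ => ?_
  ring

/-- The closed forms of the moments of the duration given failure and success. -/
lemma mom_XF_XS_eq (hlam : 0 < lam) (hc : 0 < c) (hTD : c < TD) (hK : 1 ≤ K)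
    (hKN : K ≤ N) (n : Fin N) :
    mom1XF N K lam c TD = (∫ x in evF K TD n, duration K TD x ∂(sampleLaw (shiftedExp lam c) N))
        / (1 - probS N K lam c TD) ∧
    mom2XF N K lam c TD = (∫ x in evF K TD n, duration K TD x ^ 2
        ∂(sampleLaw (shiftedExp lam c) N)) / (1 - probS N K lam c TD) ∧
    mom1XS N K lam c TD = (∫ x in evS K TD n, duration K TD x ∂(sampleLaw (shiftedExp lam c) N))
        / probS N K lam c TD ∧
    mom2XS N K lam c TD = (∫ x in evS K TD n, duration K TD x ^ 2
        ∂(sampleLaw (shiftedExp lam c) N)) / probS N K lam c TD := by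
  have hp := (probS_pos (N := N) hlam hc hTD hK hKN).ne'
  have hq := (probS_lt_one (N := N) hlam hc hTD hK hKN).ne'
  have hZ := (one_sub_cZ_pos (N := N) hlam hc hTD hK hKN).ne'
  have hF := fun i (hi : i ≤ 2) => setIntegral_evF_truncPow hlam hc hTD hK hKN n hi
  have hS := fun i (hi : i ≤ 2) => setIntegral_evS_truncPow hlam hc hTD hK hKN n hi
  have hdF := setIntegral_duration hlam hc hTD hK hKN (evF K TD n)
  have hdS := setIntegral_duration hlam hc hTD hK hKN (evS K TD n)
  have hF1 := hdF 1
  have hS1 := hdS 1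
  simp only [pow_one] at hF1 hS1
  rw [hF1, hdF 2, hS1, hdS 2, hF 0 (by omega), hF 1 (by omega), hF 2 (by omega), hS 0 (by omega),
    hS 1 (by omega), hS 2 (by omega), measureReal_evF hlam hc hTD hK hKN,
    measureReal_evS hlam hc hTD hK hKN, mom1XF, mom2XF, mom1XS, mom2XS, mom1TK_eq, mom2TK_eq,
    probF2_eq hlam hc hTD hK hKN, probS1_eq]
  have h0 : truncMoment N lam c TD K 0 = 1 - cZ N lam c TD K := rfl
  rw [h0]
  generalize truncMoment N lam c TD K 1 = M1
  generalize truncMoment N lam c TD K 2 = M2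
  generalize (K : ℝ) / N = r
  generalize probS N K lam c TD = p at *
  generalize 1 - cZ N lam c TD K = z at *
  refine ⟨?_, ?_, ?_, ?_⟩ <;> (field_simp; try ring)

end Update

/-! ### Conditional probabilities and expectations of a random element with given law -/

section Cond

variable {Ω E : Type*} [MeasurableSpace Ω] [MeasurableSpace E] {P : Measure Ω} {μ : Measure E}
  {X : Ω → E}

lemma cond_preimage_real (hX : MeasurePreserving X P μ) {A B : Set E} (hA : MeasurableSet A)
    (hB : MeasurableSet B) :
    (P[|X ⁻¹' A]).real (X ⁻¹' B) = μ.real (A ∩ B) / μ.real A := by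
  rw [measureReal_def, cond_apply (hX.measurable hA), ← Set.preimage_inter,
    hX.measure_preimage hA.nullMeasurableSet, hX.measure_preimage (hA.inter hB).nullMeasurableSet,
    ENNReal.toReal_mul, ENNReal.toReal_inv, ← measureReal_def, ← measureReal_def, inv_mul_eq_div]

lemma integral_cond_preimage (hX : MeasurePreserving X P μ) {A : Set E} (hA : MeasurableSet A)
    {g : E → ℝ} (hg : Measurable g) :
    ∫ ω, g (X ω) ∂(P[|X ⁻¹' A]) = (∫ x in A, g x ∂μ) / μ.real A := by
  rw [ProbabilityTheory.cond, integral_smul_measure, hX.measure_preimage hA.nullMeasurableSet,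
    ← hX.map_eq, setIntegral_map hA hg.aestronglyMeasurable hX.measurable.aemeasurable, hX.map_eq,
    ENNReal.toReal_inv, smul_eq_mul, inv_mul_eq_div]
  rfl

end Cond

/-! ### From cycles to the age -/

section PathCycle

variable {N K : ℕ} {TD : ℝ} {τ : Fin N → ℕ → ℝ} {n : Fin N}

/-- The vectors of service times of the successive updates. -/
def updates (τ : Fin N → ℕ → ℝ) : ℕ → Fin N → ℝ := fun j m => τ m j

lemma genTime_succ_sub (j : ℕ) :
    genTime K TD τ (j + 1) - genTime K TD τ j = duration K TD (updates τ j) := by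
  rw [RegularPath.genTime_succ]
  exact add_sub_cancel_left _ _

lemma recvIdx_eq_hitIdx (hinf : {j | updates τ j ∈ evS K TD n}.Infinite) (q : ℕ) :
    recvIdx K TD τ n q = hitIdx (evS K TD n) q (updates τ) :=
  nth_mem_eq_hitIdx q hinf

lemma cycleStart_eq_hitStart (hinf : {j | updates τ j ∈ evS K TD n}.Infinite) (q : ℕ) :
    cycleStart K TD τ n q = hitStart (evS K TD n) q (updates τ) := by
  cases q with
  | zero => rfl
  | succ q => rw [cycleStart, hitStart, recvIdx_eq_hitIdx hinf]

lemma succInter_eq_cycle (hinf : {j | updates τ j ∈ evS K TD n}.Infinite) (q : ℕ) :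
    succInter K TD τ n q
      = duration K TD (cycle (evS K TD n) (duration K TD) q (updates τ)).2 := by
  rw [succInter, genTime_succ_sub, cycle_snd, recvIdx_eq_hitIdx hinf]

lemma failSum_eq_cycle (hinf : {j | updates τ j ∈ evS K TD n}.Infinite) (q : ℕ) :
    failSum K TD τ n q = (cycle (evS K TD n) (duration K TD) q (updates τ)).1 := by
  rw [failSum, cycle_fst, recvIdx_eq_hitIdx hinf, cycleStart_eq_hitStart hinf]
  exact Finset.sum_congr rfl fun i _ => genTime_succ_sub i

lemma succService_eq_cycle (hinf : {j | updates τ j ∈ evS K TD n}.Infinite) (q : ℕ) :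
    succService K TD τ n q = (cycle (evS K TD n) (duration K TD) q (updates τ)).2 n := by
  rw [succService, cycle_snd, recvIdx_eq_hitIdx hinf]
  rfl

end PathCycle

/-! ### Expectations over two independent consecutive cycles -/

section ProdMoments

variable {F : Type*} [MeasurableSpace F] {ν : Measure F} [IsProbabilityMeasure ν] {u w v : F → ℝ}

lemma integral_prod_add (hu : Integrable u ν) (hw : Integrable w ν) :
    Integrable (fun p : F × F => u p.1 + w p.2) (ν.prod ν) ∧
      ∫ p, (u p.1 + w p.2) ∂(ν.prod ν) = ∫ y, u y ∂ν + ∫ y, w y ∂ν := by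
  refine ⟨(hu.comp_fst ν).add (hw.comp_snd ν), ?_⟩
  rw [integral_add (hu.comp_fst ν) (hw.comp_snd ν), integral_fun_fst, integral_fun_snd]
  simp

/-- `u` stands for X^S of the earlier cycle, `w` and `v` for W and T̂ of the later one. Only `w` and
`v` share a cycle, so their product is the one term that does not factor here. -/
lemma integral_prod_area (hu : Integrable u ν) (hw : Integrable w ν) (hv : Integrable v ν)
    (hu2 : Integrable (fun y => u y ^ 2) ν) (hw2 : Integrable (fun y => w y ^ 2) ν)
    (hwv : Integrable (fun y => w y * v y) ν) :
    Integrable (fun p : F × F => (u p.1 + w p.2) ^ 2 / 2 + (u p.1 + w p.2) * v p.2) (ν.prod ν) ∧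
      ∫ p, ((u p.1 + w p.2) ^ 2 / 2 + (u p.1 + w p.2) * v p.2) ∂(ν.prod ν)
        = (∫ y, u y ^ 2 ∂ν + ∫ y, w y ^ 2 ∂ν) / 2 + (∫ y, u y ∂ν) * ∫ y, w y ∂ν
          + (∫ y, u y ∂ν) * ∫ y, v y ∂ν + ∫ y, w y * v y ∂ν := by
  have h1 := integral_prod_add hu2 hw2
  have h2 := hu.mul_prod hw
  have h3 := hu.mul_prod hv
  have h4 := hwv.comp_snd ν
  have heq : ∀ p : F × F, (u p.1 + w p.2) ^ 2 / 2 + (u p.1 + w p.2) * v p.2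
      = (((u p.1 ^ 2 + w p.2 ^ 2) / 2 + u p.1 * w p.2) + u p.1 * v p.2) + w p.2 * v p.2 :=
    fun p => by ring
  have h12 : Integrable (fun p : F × F => (u p.1 ^ 2 + w p.2 ^ 2) / 2 + u p.1 * w p.2)
      (ν.prod ν) := (h1.1.div_const 2).add h2
  have h123 : Integrable (fun p : F × F => ((u p.1 ^ 2 + w p.2 ^ 2) / 2 + u p.1 * w p.2)
      + u p.1 * v p.2) (ν.prod ν) := h12.add h3
  simp only [heq]
  refine ⟨h123.add h4, ?_⟩
  rw [integral_add h123 h4, integral_add h12 h3, integral_add (h1.1.div_const 2) h2,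
    integral_div, h1.2, integral_prod_mul, integral_prod_mul,
    integral_fun_snd (fun y => w y * v y)]
  simp

end ProdMoments

/-! ### The cycles of the transmission system -/

section System

variable {N K : ℕ} {lam c TD : ℝ}

/-- The law of one cycle: the total duration of the failed updates, and the service times of the
received update. -/
abbrev sysCycleLaw (K : ℕ) (lam c TD : ℝ) (n : Fin N) : Measure (ℝ × (Fin N → ℝ)) :=
  cycleLaw (sampleLaw (shiftedExp lam c) N) (evS K TD n) (duration K TD)

lemma ae_duration_mem [IsProbabilityMeasure (shiftedExp lam c)] (hlam : 0 < lam) (hTD : c < TD)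
    (hK : 1 ≤ K) (hKN : K ≤ N) :
    ∀ᵐ x ∂(sampleLaw (shiftedExp lam c) N), c ≤ duration K TD x ∧ duration K TD x ≤ TD := by
  filter_upwards [ae_lt_sample hlam N] with x hx
  obtain ⟨-, i, hi⟩ := isLeast_ordStat hK hKN x
  exact ⟨le_min hTD.le (hi ▸ (hx i).le), min_le_left _ _⟩

/-- The moments of one cycle. -/
structure CycleMoments (K : ℕ) (lam c TD : ℝ) (n : Fin N) : Prop where
  memLp_fst : MemLp (fun y : ℝ × (Fin N → ℝ) => y.1) 2 (sysCycleLaw K lam c TD n)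
  memLp_duration : MemLp (fun y : ℝ × (Fin N → ℝ) => duration K TD y.2) 2 (sysCycleLaw K lam c TD n)
  integrable_service : Integrable (fun y : ℝ × (Fin N → ℝ) => y.2 n) (sysCycleLaw K lam c TD n)
  integrable_fst_mul_service :
    Integrable (fun y : ℝ × (Fin N → ℝ) => y.1 * y.2 n) (sysCycleLaw K lam c TD n)
  integral_fst : ∫ y, y.1 ∂(sysCycleLaw K lam c TD n) = mom1W N K lam c TD
  integral_fst_sq : ∫ y, y.1 ^ 2 ∂(sysCycleLaw K lam c TD n) = mom2W N K lam c TD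
  integral_duration : ∫ y, duration K TD y.2 ∂(sysCycleLaw K lam c TD n) = mom1XS N K lam c TD
  integral_duration_sq :
    ∫ y, duration K TD y.2 ^ 2 ∂(sysCycleLaw K lam c TD n) = mom2XS N K lam c TD
  integral_service : ∫ y, y.2 n ∂(sysCycleLaw K lam c TD n) = mom1T N K lam c TD
  integral_fst_mul_service : ∫ y, y.1 * y.2 n ∂(sysCycleLaw K lam c TD n)
    = mom1W N K lam c TD * mom1T N K lam c TD
  mean_pos : 0 < mom1XS N K lam c TD + mom1W N K lam c TD

lemma cycleMoments (hlam : 0 < lam) (hc : 0 < c) (hTD : c < TD) (hK : 1 ≤ K) (hKN : K ≤ N)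
    (n : Fin N) : CycleMoments K lam c TD n := by
  have := isProbabilityMeasure_shiftedExp (c := c) hlam
  have := nullSingletonClass_shiftedExp (lam := lam) (c := c)
  set μ := sampleLaw (shiftedExp lam c) N with hμ
  have hA := measurableSet_evS hK hKN TD n
  have hd : Measurable (duration K TD : (Fin N → ℝ) → ℝ) := measurable_duration hK hKN TD
  have hT0 : 0 < TD := hc.trans hTD
  have hp := probS_pos (N := N) hlam hc hTD hK hKN
  have hq := probS_lt_one (N := N) hlam hc hTD hK hKN
  have hpA : μ.real (evS K TD n) = probS N K lam c TD := measureReal_evS hlam hc hTD hK hKN n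
  have hpos : μ (evS K TD n) ≠ 0 := fun h => by
    rw [measureReal_def, h, ENNReal.toReal_zero] at hpA
    exact hp.ne hpA
  have hdb : ∀ᵐ x ∂μ, |duration K TD x| ≤ TD := by
    filter_upwards [ae_duration_mem hlam hTD hK hKN] with x hx
    rw [abs_of_nonneg (hc.le.trans hx.1)]
    exact hx.2
  have hdb2 : ∀ᵐ x ∂μ, x ∈ evS K TD n → |duration K TD x ^ 2| ≤ TD ^ 2 := by
    filter_upwards [hdb] with x hx _
    rw [abs_pow]
    exact pow_le_pow_left₀ (abs_nonneg _) hx 2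
  have hsb : ∀ᵐ x ∂μ, x ∈ evS K TD n → |x n| ≤ TD := by
    filter_upwards [ae_lt_sample hlam N] with x hx hxS
    rw [abs_of_nonneg (hc.trans (hx n)).le]
    exact (mem_evS.1 hxS).1
  have hs : Measurable fun x : Fin N → ℝ => x n := measurable_pi_apply n
  have := isProbabilityMeasure_cycleLaw μ hA hd
  obtain ⟨hF1, hF2, hS1, hS2⟩ := mom_XF_XS_eq (TD := TD) hlam hc hTD hK hKN n
  have hw1 := integral_cycleLaw_fst μ hA hpos hd hdb
  have hw2 := integral_cycleLaw_fst_sq μ hA hpos hd hdb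
  rw [hpA, compl_evS] at hw1 hw2
  have e1 : ∫ x in evF K TD n, duration K TD x ∂μ = mom1XF N K lam c TD * (1 - probS N K lam c TD) := by
    rw [hF1, div_mul_cancel₀ _ hq.ne']
  have e2 : ∫ x in evF K TD n, duration K TD x ^ 2 ∂μ
      = mom2XF N K lam c TD * (1 - probS N K lam c TD) := by
    rw [hF2, div_mul_cancel₀ _ hq.ne']
  have hW1 : ∫ y, y.1 ∂(sysCycleLaw K lam c TD n) = mom1W N K lam c TD := by
    rw [hw1, e1, mom1W, mom1M]
    field_simp
  have hX1 : ∫ y, duration K TD y.2 ∂(sysCycleLaw K lam c TD n) = mom1XS N K lam c TD := by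
    rw [integral_cycleLaw_snd μ hA hpos hd hd (hdb.mono fun x hx _ => hx), hpA, hS1]
  have hT1 : ∫ y, y.2 n ∂(sysCycleLaw K lam c TD n) = mom1T N K lam c TD := by
    have h := setIntegral_evS_service hlam hc hTD hK hKN n (i := 1) (by omega)
    simp only [pow_one] at h
    rw [integral_cycleLaw_snd μ hA hpos hd hs hsb, hpA, h, mom1T_eq]
  refine ⟨memLp_cycleLaw_fst μ hA hpos hd hdb, ?_, integrable_cycleLaw_snd μ hA hpos hd hs hsb,
    integrable_cycleLaw_fst_mul_snd μ hA hpos hd hdb hs hsb, hW1, ?_, hX1, ?_, hT1, ?_, ?_⟩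
  · exact MemLp.of_bound (hd.comp measurable_snd).aestronglyMeasurable TD
      (ae_cycleLaw μ hA hpos hd (S := {x | |duration K TD x| ≤ TD})
        (measurableSet_le hd.abs measurable_const) (hdb.mono fun x hx _ => hx))
  -- The renewal solution agrees with E[W]² plus the variance of a sum of M - 1 independent failed
  -- durations, M being geometric.
  · rw [hw2, hW1, e1, e2, mom2W, varW, mom1W, mom1M, mom2M]
    field_simp
    ring
  · rw [integral_cycleLaw_snd μ hA hpos hd (hd.pow_const 2) hdb2, hpA, hS2]
  · rw [integral_cycleLaw_fst_mul_snd μ hA hpos hd hdb hs hsb, hW1, hT1]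
  -- Failed and received parts recombine to E[X^S] + E[W] = E[duration] / p (Wald), and durations
  -- are at least c.
  · rw [← hX1, ← hW1, integral_cycleLaw_snd μ hA hpos hd hd (hdb.mono fun x hx _ => hx), hw1, hpA,
      ← add_div]
    have hdi : Integrable (duration K TD) μ := Integrable.of_bound hd.aestronglyMeasurable TD hdb
    rw [← compl_evS, integral_add_compl hA hdi]
    refine div_pos (hc.trans_le ?_) hp
    have := integral_mono_ae (integrable_const c) hdi
      ((ae_duration_mem hlam hTD hK hKN).mono fun x hx => hx.1)
    simpa using this

variable {Ω : Type*} [MeasurableSpace Ω] {P : Measure Ω}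
  {T : Fin N → ℕ → Ω → ℝ}

lemma measurePreserving_updates (hmeas : ∀ m j, Measurable (T m j))
    (hlaw : ∀ m j, P.map (T m j) = shiftedExp lam c)
    (hindep : iIndepFun (fun p : Fin N × ℕ => T p.1 p.2) P)
    [IsProbabilityMeasure (shiftedExp lam c)] :
    MeasurePreserving (fun ω => updates fun m j => T m j ω) P
      (seqLaw (sampleLaw (shiftedExp lam c) N)) := by
  have hm : Measurable fun ω => updates fun m j => T m j ω :=
    measurable_pi_lambda _ fun j => measurable_pi_lambda _ fun m => hmeas m j
  have h1 := (hindep.precomp (g := Prod.swap) Prod.swap_injective).map_fun_eq_infinitePi_map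
    (fun p => hmeas _ _)
  have h2 := Measure.infinitePi_map_curry (fun (_ : ℕ) (_ : Fin N) => shiftedExp lam c)
  simp only [Prod.fst_swap, Prod.snd_swap, hlaw] at h1
  refine ⟨hm, ?_⟩
  rw [← h1, Measure.map_map (MeasurableEquiv.measurable _)
    (measurable_pi_lambda _ fun p => hmeas _ _)] at h2
  simp only [Measure.infinitePi_eq_pi] at h2
  exact h2

lemma ae_regularPath (hlam : 0 < lam) (hc : 0 < c) (hTD : c < TD) (hK : 1 ≤ K) (hKN : K ≤ N)
    (n : Fin N) (hmeas : ∀ m j, Measurable (T m j))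
    (hlaw : ∀ m j, P.map (T m j) = shiftedExp lam c)
    (hindep : iIndepFun (fun p : Fin N × ℕ => T p.1 p.2) P) :
    ∀ᵐ ω ∂P, RegularPath K TD (fun m j => T m j ω) n := by
  have := isProbabilityMeasure_shiftedExp (c := c) hlam
  have := nullSingletonClass_shiftedExp (lam := lam) (c := c)
  have hU := measurePreserving_updates hmeas hlaw hindep
  set μ := sampleLaw (shiftedExp lam c) N with hμ
  have hpos : μ (evS K TD n) ≠ 0 := fun h => by
    have hpA : μ.real (evS K TD n) = probS N K lam c TD := measureReal_evS hlam hc hTD hK hKN n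
    rw [measureReal_def, h, ENNReal.toReal_zero] at hpA
    exact (probS_pos (N := N) hlam hc hTD hK hKN).ne hpA
  have hall : ∀ᵐ s ∂(seqLaw μ), (∀ i, s i ∈ {x : Fin N → ℝ | 0 ≤ duration K TD x ∧ 0 < x n}) ∧
      {j | s j ∈ evS K TD n}.Infinite := by
    refine (ae_seqLaw_forall μ ?_).and (ae_infinite_hits μ (measurableSet_evS hK hKN TD n) hpos)
    filter_upwards [ae_duration_mem hlam hTD hK hKN, ae_lt_sample hlam N] with x h1 h2
    exact ⟨hc.le.trans h1.1, hc.trans (h2 n)⟩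
  filter_upwards [hU.quasiMeasurePreserving.ae hall] with ω hω
  exact ⟨fun j => (hω.1 j).1, fun j => (hω.1 j).2, hω.2⟩

end System

/-! ### Transfer to the probability space and assembly -/

section Main

variable {N K : ℕ} {lam c TD : ℝ} {Ω : Type*} [MeasurableSpace Ω] {P : Measure Ω}
  {T : Fin N → ℕ → Ω → ℝ}

/-- Probabilities and conditional moments for a random update. -/
lemma update_moments (hK : 1 ≤ K) (hKN : K ≤ N) (hlam : 0 < lam) (hc : 0 < c) (hTD : c < TD)
    (n : Fin N) {x : Ω → Fin N → ℝ}
    (hx : MeasurePreserving x P (sampleLaw (shiftedExp lam c) N)) :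
    P.real (x ⁻¹' evS K TD n) = probS N K lam c TD ∧
    (P[|x ⁻¹' evF K TD n]).real (x ⁻¹' evExpired K TD) = probF2 N K lam c TD ∧
    (P[|x ⁻¹' evS K TD n]).real (x ⁻¹' evServed K TD) = probS1 N K lam c TD ∧
    (K < N →
      ∫ ω, ordStat K (x ω) ∂(P[|x ⁻¹' (evF K TD n ∩ evServed K TD)]) = mom1TK N K lam c TD ∧
      ∫ ω, ordStat K (x ω) ^ 2 ∂(P[|x ⁻¹' (evF K TD n ∩ evServed K TD)])
        = mom2TK N K lam c TD) ∧
    ∫ ω, ordStat K (x ω) ∂(P[|x ⁻¹' (evS K TD n ∩ evServed K TD)]) = mom1TK N K lam c TD ∧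
    ∫ ω, ordStat K (x ω) ^ 2 ∂(P[|x ⁻¹' (evS K TD n ∩ evServed K TD)]) = mom2TK N K lam c TD ∧
    ∫ ω, duration K TD (x ω) ∂(P[|x ⁻¹' evF K TD n]) = mom1XF N K lam c TD ∧
    ∫ ω, duration K TD (x ω) ^ 2 ∂(P[|x ⁻¹' evF K TD n]) = mom2XF N K lam c TD := by
  have := isProbabilityMeasure_shiftedExp (c := c) hlam
  have := nullSingletonClass_shiftedExp (lam := lam) (c := c)
  have hS := measurableSet_evS hK hKN TD n
  have hF : MeasurableSet (evF K TD n) := compl_evS K TD n ▸ hS.compl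
  have hV : MeasurableSet (evServed K TD : Set (Fin N → ℝ)) := measurableSet_evServed hK hKN TD
  have hX : MeasurableSet (evExpired K TD : Set (Fin N → ℝ)) := measurableSet_evExpired hK hKN TD
  have hT : Measurable (ordStat K : (Fin N → ℝ) → ℝ) := measurable_ordStat hK hKN
  have hd : Measurable (duration K TD : (Fin N → ℝ) → ℝ) := measurable_duration hK hKN TD
  have hN : (0 : ℝ) < N := by have := n.pos; positivity
  have hZ := one_sub_cZ_pos (N := N) hlam hc hTD hK hKN
  have h0 : truncMoment N lam c TD K 0 = 1 - cZ N lam c TD K := rfl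
  have hmS : (sampleLaw (shiftedExp lam c) N).real (evS K TD n) = probS N K lam c TD :=
    measureReal_evS hlam hc hTD hK hKN n
  have hmF : (sampleLaw (shiftedExp lam c) N).real (evF K TD n) = 1 - probS N K lam c TD :=
    measureReal_evF hlam hc hTD hK hKN n
  have hSV : ∀ i ≤ 2, ∫ x in evS K TD n ∩ evServed K TD, ordStat K x ^ i
      ∂(sampleLaw (shiftedExp lam c) N) = K / N * truncMoment N lam c TD K i := fun i hi => by
    rw [setIntegral_inter_evServed hlam hc hK hKN, setIntegral_evS_truncPow hlam hc hTD hK hKN n hi]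
  have hFV : ∀ i ≤ 2, ∫ x in evF K TD n ∩ evServed K TD, ordStat K x ^ i
      ∂(sampleLaw (shiftedExp lam c) N) = (1 - K / N) * truncMoment N lam c TD K i := fun i hi => by
    rw [setIntegral_inter_evServed hlam hc hK hKN, setIntegral_evF_truncPow hlam hc hTD hK hKN n hi]
  have hmSV := hSV 0 (by omega)
  have hmFV := hFV 0 (by omega)
  simp only [pow_zero, setIntegral_const, smul_eq_mul, mul_one] at hmSV hmFV
  have hSV1 := hSV 1 (by omega)
  have hFV1 := hFV 1 (by omega)
  simp only [pow_one] at hSV1 hFV1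
  obtain ⟨hF1, hF2, -, -⟩ := mom_XF_XS_eq (TD := TD) hlam hc hTD hK hKN n
  have hr : (K : ℝ) / N ≠ 0 := by positivity
  refine ⟨?_, ?_, ?_, fun hlt => ?_, ?_, ?_, ?_, ?_⟩
  · rw [← hmS, measureReal_def, hx.measure_preimage hS.nullMeasurableSet, measureReal_def]
  · rw [cond_preimage_real hx hF hX, measureReal_inter_evExpired hlam hc hTD hK hKN, hmF,
      setIntegral_evF_truncPow hlam hc hTD hK hKN n (by omega), probF2_eq hlam hc hTD hK hKN, h0]
  · rw [cond_preimage_real hx hS hV, hmSV, hmS, probS1_eq, h0]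
  -- For K = N a failed update is almost surely never served in time, and the conditioning would be
  -- on a null event.
  · have hr' : 1 - (K : ℝ) / N ≠ 0 := by
      have : (K : ℝ) / N < 1 := (div_lt_one hN).2 (by exact_mod_cast hlt)
      linarith
    constructor
    · rw [integral_cond_preimage hx (hF.inter hV) hT, hFV1, hmFV, mom1TK_eq,
        mul_div_mul_left _ _ hr']
    · rw [integral_cond_preimage hx (hF.inter hV) (hT.pow_const 2), hFV 2 le_rfl, hmFV, mom2TK_eq,
        mul_div_mul_left _ _ hr']
  · rw [integral_cond_preimage hx (hS.inter hV) hT, hSV1, hmSV, mom1TK_eq, mul_div_mul_left _ _ hr]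
  · rw [integral_cond_preimage hx (hS.inter hV) (hT.pow_const 2), hSV 2 le_rfl, hmSV, mom2TK_eq,
      mul_div_mul_left _ _ hr]
  · rw [integral_cond_preimage hx hF hd, hmF, hF1]
  · rw [integral_cond_preimage hx hF (hd.pow_const 2), hmF, hF2]

/-- The moments of `X^S`, `W` and `T̂`, read off from those of a cycle. -/
lemma interval_moments {n : Fin N} (hM : CycleMoments K lam c TD n) {y : Ω → ℝ × (Fin N → ℝ)}
    (hy : MeasurePreserving y P (sysCycleLaw K lam c TD n)) {X W S : Ω → ℝ}
    (hX : ∀ᵐ ω ∂P, X ω = duration K TD (y ω).2) (hW : ∀ᵐ ω ∂P, W ω = (y ω).1)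
    (hS : ∀ᵐ ω ∂P, S ω = (y ω).2 n) :
    MemLp X 2 P ∧ ∫ ω, X ω ∂P = mom1XS N K lam c TD ∧ ∫ ω, X ω ^ 2 ∂P = mom2XS N K lam c TD ∧
    MemLp W 2 P ∧ ∫ ω, W ω ∂P = mom1W N K lam c TD ∧ ∫ ω, W ω ^ 2 ∂P = mom2W N K lam c TD ∧
    Integrable S P ∧ ∫ ω, S ω ∂P = mom1T N K lam c TD := by
  have hcomp : ∀ g : ℝ × (Fin N → ℝ) → ℝ, AEStronglyMeasurable g (sysCycleLaw K lam c TD n) →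
      ∫ ω, g (y ω) ∂P = ∫ z, g z ∂(sysCycleLaw K lam c TD n) := fun g hg => by
    rw [← hy.map_eq] at hg ⊢
    exact (integral_map hy.measurable.aemeasurable hg).symm
  have hX2 : ∀ᵐ ω ∂P, X ω ^ 2 = duration K TD (y ω).2 ^ 2 := hX.mono fun ω h => by rw [h]
  have hW2 : ∀ᵐ ω ∂P, W ω ^ 2 = (y ω).1 ^ 2 := hW.mono fun ω h => by rw [h]
  refine ⟨(memLp_congr_ae hX).2 (hM.memLp_duration.comp_measurePreserving hy), ?_, ?_,
    (memLp_congr_ae hW).2 (hM.memLp_fst.comp_measurePreserving hy), ?_, ?_,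
    (integrable_congr hS).2 (hy.integrable_comp_of_integrable hM.integrable_service), ?_⟩
  · rw [integral_congr_ae hX, hcomp _ hM.memLp_duration.1, hM.integral_duration]
  · rw [integral_congr_ae hX2, hcomp (fun z => duration K TD z.2 ^ 2) (hM.memLp_duration.1.pow 2),
      hM.integral_duration_sq]
  · rw [integral_congr_ae hW, hcomp _ hM.memLp_fst.1, hM.integral_fst]
  · rw [integral_congr_ae hW2, hcomp (fun z => z.1 ^ 2) (hM.memLp_fst.1.pow 2), hM.integral_fst_sq]
  · rw [integral_congr_ae hS, hcomp _ hM.integrable_service.1, hM.integral_service]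

lemma ae_tendsto_average_of_measurePreserving {F : Type*} [MeasurableSpace F] {ν : Measure F}
    [IsProbabilityMeasure ν] {C : Ω → ℕ → F} (hC : MeasurePreserving C P (seqLaw ν))
    {G : F × F → ℝ} (hG : Measurable G) (hGi : Integrable G (ν.prod ν)) {L : ℝ}
    (hL : ∫ p, G p ∂(ν.prod ν) = L) :
    ∀ᵐ ω ∂P, Tendsto (fun Q : ℕ => (∑ q ∈ Finset.range Q, G (C ω q, C ω (q + 1))) / Q) atTop
      (𝓝 L) := by
  subst hL
  exact hC.quasiMeasurePreserving.ae (ae_tendsto_average_consecutive ν hG hGi)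

lemma RegularPath.infinite_hits {τ : Fin N → ℕ → ℝ} {n : Fin N} (h : RegularPath K TD τ n) :
    {j | updates τ j ∈ evS K TD n}.Infinite :=
  h.infinite_received

/-- The zeroth peak involves `a₀` and has a different form; divided by Q + 1 it vanishes in the
limit. -/
lemma RegularPath.tendsto_average_peakAge {a₀ : ℝ} {τ : Fin N → ℕ → ℝ} {n : Fin N}
    (h : RegularPath K TD τ n) (ha₀ : 0 ≤ a₀) {L : ℝ}
    (hL : Tendsto (fun Q : ℕ => (∑ q ∈ Finset.range Q, (succInter K TD τ n q
      + failSum K TD τ n (q + 1) + succService K TD τ n (q + 1))) / (Q : ℝ)) atTop (𝓝 L)) :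
    Tendsto (fun Q : ℕ => 1 / (Q : ℝ) * ∑ q ∈ Finset.range Q, peakAge K TD a₀ τ n q) atTop
      (𝓝 L) := by
  rw [← tendsto_add_atTop_iff_nat 1]
  have h0 : Tendsto (fun Q : ℕ => peakAge K TD a₀ τ n 0 / ((Q : ℝ) + 1)) atTop (𝓝 0) := by
    have := (tendsto_const_div_atTop_nhds_zero_nat (peakAge K TD a₀ τ n 0))
    simpa using (tendsto_add_atTop_iff_nat 1).2 this
  have h1 := (hL.mul (tendsto_natCast_div_add_atTop (1 : ℝ))).add h0
  rw [mul_one, add_zero] at h1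
  refine h1.congr' ?_
  filter_upwards [eventually_ge_atTop 1] with Q hQ
  have hQ0 : (Q : ℝ) ≠ 0 := by positivity
  rw [Finset.sum_range_succ', Finset.sum_congr rfl fun q _ =>
    (h.peakAge_succ ha₀ q).trans (h.recvTime_succ_sub q), div_mul_div_cancel₀ hQ0]
  push_cast
  ring

end Main

end MulticastAoI

end

open MulticastAoI in
theorem mainTheorem1 {Ω : Type*} [MeasurableSpace Ω] (P : Measure Ω) [IsProbabilityMeasure P]
    (N K : ℕ) (hK : 1 ≤ K) (hKN : K ≤ N)
    (lam c TD a₀ : ℝ) (hlam : 0 < lam) (hc : 0 < c) (hTD : c < TD) (ha₀ : 0 ≤ a₀)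
    (T : Fin N → ℕ → Ω → ℝ) (hmeas : ∀ m j, Measurable (T m j))
    (hlaw : ∀ m j, P.map (T m j) = shiftedExp lam c)
    (hindep : iIndepFun (fun p : Fin N × ℕ => T p.1 p.2) P)
    (n : Fin N) :
    -- one status update: probabilities and conditional moments
    (∀ (j : ℕ) (x : Ω → Fin N → ℝ), x = (fun ω m => T m j ω) →
      P.real (x ⁻¹' evS K TD n) = probS N K lam c TD ∧
      (P[|x ⁻¹' evF K TD n]).real (x ⁻¹' evExpired K TD) = probF2 N K lam c TD ∧
      (P[|x ⁻¹' evS K TD n]).real (x ⁻¹' evServed K TD) = probS1 N K lam c TD ∧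
      (K < N →
        ∫ ω, ordStat K (x ω) ∂(P[|x ⁻¹' (evF K TD n ∩ evServed K TD)]) = mom1TK N K lam c TD ∧
        ∫ ω, ordStat K (x ω) ^ 2 ∂(P[|x ⁻¹' (evF K TD n ∩ evServed K TD)])
          = mom2TK N K lam c TD) ∧
      ∫ ω, ordStat K (x ω) ∂(P[|x ⁻¹' (evS K TD n ∩ evServed K TD)]) = mom1TK N K lam c TD ∧
      ∫ ω, ordStat K (x ω) ^ 2 ∂(P[|x ⁻¹' (evS K TD n ∩ evServed K TD)]) = mom2TK N K lam c TD ∧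
      ∫ ω, duration K TD (x ω) ∂(P[|x ⁻¹' evF K TD n]) = mom1XF N K lam c TD ∧
      ∫ ω, duration K TD (x ω) ^ 2 ∂(P[|x ⁻¹' evF K TD n]) = mom2XF N K lam c TD) ∧
    -- moments of `X^S`, `W` and `T̂`
    (∀ q : ℕ,
      MemLp (fun ω => succInter K TD (fun m j => T m j ω) n q) 2 P ∧
      ∫ ω, succInter K TD (fun m j => T m j ω) n q ∂P = mom1XS N K lam c TD ∧
      ∫ ω, succInter K TD (fun m j => T m j ω) n q ^ 2 ∂P = mom2XS N K lam c TD ∧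
      MemLp (fun ω => failSum K TD (fun m j => T m j ω) n q) 2 P ∧
      ∫ ω, failSum K TD (fun m j => T m j ω) n q ∂P = mom1W N K lam c TD ∧
      ∫ ω, failSum K TD (fun m j => T m j ω) n q ^ 2 ∂P = mom2W N K lam c TD ∧
      Integrable (fun ω => succService K TD (fun m j => T m j ω) n q) P ∧
      ∫ ω, succService K TD (fun m j => T m j ω) n q ∂P = mom1T N K lam c TD) ∧
    -- the long-run time average of the age
    (∀ᵐ ω ∂P,
      {j : ℕ | Received K TD (fun m j => T m j ω) n j}.Infinite ∧
      (∀ t : ℝ, 0 ≤ t →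
        IntervalIntegrable (age K TD a₀ (fun m j => T m j ω) n) volume 0 t) ∧
      Tendsto (fun t : ℝ => 1 / t * ∫ s in (0 : ℝ)..t, age K TD a₀ (fun m j => T m j ω) n s) atTop
        (𝓝 (aveAge (mom1W N K lam c TD) (mom2W N K lam c TD) (mom1XS N K lam c TD)
          (mom2XS N K lam c TD) (mom1T N K lam c TD)))) ∧
    -- the average peak age, as a long-run average and as an expectation
    (∀ᵐ ω ∂P,
      (∀ q : ℕ, Tendsto (age K TD a₀ (fun m j => T m j ω) n)
        (𝓝[<] (recvTime K TD (fun m j => T m j ω) n q))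
        (𝓝 (peakAge K TD a₀ (fun m j => T m j ω) n q))) ∧
      Tendsto (fun Q : ℕ => 1 / (Q : ℝ) *
          ∑ q ∈ Finset.range Q, peakAge K TD a₀ (fun m j => T m j ω) n q) atTop
        (𝓝 (mom1XS N K lam c TD + mom1W N K lam c TD + mom1T N K lam c TD))) ∧
    (∀ q : ℕ, 1 ≤ q →
      Integrable (fun ω => peakAge K TD a₀ (fun m j => T m j ω) n q) P ∧
      ∫ ω, peakAge K TD a₀ (fun m j => T m j ω) n q ∂P
        = mom1XS N K lam c TD + mom1W N K lam c TD + mom1T N K lam c TD) := by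
  have hρ := isProbabilityMeasure_shiftedExp (c := c) hlam
  have hρ' := nullSingletonClass_shiftedExp (lam := lam) (c := c)
  have hU := measurePreserving_updates hmeas hlaw hindep
  have hM := cycleMoments (K := K) hlam hc hTD hK hKN n
  have hreg := ae_regularPath (TD := TD) hlam hc hTD hK hKN n hmeas hlaw hindep
  have hA := measurableSet_evS hK hKN TD n
  have hd : Measurable (duration K TD : (Fin N → ℝ) → ℝ) := measurable_duration hK hKN TD
  have hpos : sampleLaw (shiftedExp lam c) N (evS K TD n) ≠ 0 := fun h => by
    have hpA := measureReal_evS (N := N) hlam hc hTD hK hKN n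
    rw [measureReal_def, h, ENNReal.toReal_zero] at hpA
    exact (probS_pos (N := N) hlam hc hTD hK hKN).ne hpA
  have hν := isProbabilityMeasure_cycleLaw (sampleLaw (shiftedExp lam c) N) hA hd
  have hC := (measurePreserving_cycle (sampleLaw (shiftedExp lam c) N) hA hpos hd).comp hU
  have hmom := fun q : ℕ => interval_moments hM
    (X := fun ω => succInter K TD (fun m j => T m j ω) n q)
    (W := fun ω => failSum K TD (fun m j => T m j ω) n q)
    (S := fun ω => succService K TD (fun m j => T m j ω) n q)
    ((measurePreserving_eval_infinitePi (fun _ : ℕ => sysCycleLaw K lam c TD n) q).comp hC)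
    (hreg.mono fun ω h => succInter_eq_cycle h.infinite_hits q)
    (hreg.mono fun ω h => failSum_eq_cycle h.infinite_hits q)
    (hreg.mono fun ω h => succService_eq_cycle h.infinite_hits q)
  have hu := hM.memLp_duration.integrable one_le_two
  have hw := hM.memLp_fst.integrable one_le_two
  have hs := hM.integrable_service
  -- For the peak age, W and T̂ of the later cycle are grouped into a single function.
  have hws : Integrable (fun y => y.1 + y.2 n) (sysCycleLaw K lam c TD n) := hw.add hs
  obtain ⟨hYi, hY⟩ := integral_prod_add hu hw
  obtain ⟨hGi, hG⟩ := integral_prod_area hu hw hs hM.memLp_duration.integrable_sq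
    hM.memLp_fst.integrable_sq hM.integrable_fst_mul_service
  obtain ⟨hVi, hV⟩ := integral_prod_add hu hws
  rw [hM.integral_duration, hM.integral_fst] at hY
  rw [hM.integral_duration, hM.integral_fst, hM.integral_duration_sq, hM.integral_fst_sq,
    hM.integral_service, hM.integral_fst_mul_service] at hG
  rw [integral_add hw hs, hM.integral_duration, hM.integral_fst, hM.integral_service] at hV
  have hYlim := ae_tendsto_average_of_measurePreserving hC (by fun_prop) hYi hY
  have hGlim := ae_tendsto_average_of_measurePreserving hC (by fun_prop) hGi hG
  have hVlim := ae_tendsto_average_of_measurePreserving hC (by fun_prop) hVi hV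
  refine ⟨fun j x hx => ?_, hmom, ?_, ?_, fun q hq => ?_⟩
  · subst hx
    exact update_moments hK hKN hlam hc hTD n ((measurePreserving_eval_infinitePi
      (fun _ : ℕ => sampleLaw (shiftedExp lam c) N) j).comp hU)
  · filter_upwards [hreg, hYlim, hGlim] with ω h h1 h2
    refine ⟨h.infinite_received, fun t _ => h.intervalIntegrable_age 0 t, ?_⟩
    have hage := h.tendsto_average_age ha₀ hM.mean_pos (by
      simp only [succInter_eq_cycle h.infinite_hits, failSum_eq_cycle h.infinite_hits]
      exact h1) (by
      simp only [succInter_eq_cycle h.infinite_hits, failSum_eq_cycle h.infinite_hits,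
        succService_eq_cycle h.infinite_hits]
      exact h2)
    -- What remains is the identity between the stated formula and mean area over mean spacing.
    convert hage using 2
    have hpos := hM.mean_pos.ne'
    rw [aveAge, ← add_div, show 2 * mom1W N K lam c TD + 2 * mom1XS N K lam c TD
      = 2 * (mom1XS N K lam c TD + mom1W N K lam c TD) by ring]
    field_simp
    ring
  · filter_upwards [hreg, hVlim] with ω h h1
    refine ⟨h.tendsto_age_peakAge ha₀, h.tendsto_average_peakAge ha₀ ?_⟩
    simp only [succInter_eq_cycle h.infinite_hits, failSum_eq_cycle h.infinite_hits,
      succService_eq_cycle h.infinite_hits, add_assoc]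
    exact h1
  · obtain ⟨q, rfl⟩ := Nat.exists_eq_add_of_le' hq
    -- From q ≥ 1 on, a peak is X^S of the previous cycle plus W and T̂ of the current one, so
    -- linearity of the expectation suffices.
    have hpeak : ∀ᵐ ω ∂P, peakAge K TD a₀ (fun m j => T m j ω) n (q + 1)
        = succInter K TD (fun m j => T m j ω) n q + failSum K TD (fun m j => T m j ω) n (q + 1)
          + succService K TD (fun m j => T m j ω) n (q + 1) :=
      hreg.mono fun ω h => (h.peakAge_succ ha₀ q).trans (h.recvTime_succ_sub q)
    obtain ⟨hX, hX1, -⟩ := hmom q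
    obtain ⟨-, -, -, hW, hW1, -, hS, hS1⟩ := hmom (q + 1)
    have hXi := hX.integrable one_le_two
    have hWi := hW.integrable one_le_two
    have hXWi : Integrable (fun ω => succInter K TD (fun m j => T m j ω) n q
        + failSum K TD (fun m j => T m j ω) n (q + 1)) P := hXi.add hWi
    refine ⟨(integrable_congr hpeak).2 (hXWi.add hS), ?_⟩
    rw [integral_congr_ae hpeak, integral_add hXWi hS, integral_add hXi hWi, hX1, hW1, hS1]
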